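/- **Setting.** Let $T\in(0,\infty)$, $m,n\in\mathbb N$, $\alpha\in(\tfrac13,\tfrac12]$, $\beta\in(0,\infty)$, $q\in(0,\infty]$. *Spaces.* For $b>0$ let $\Psi_b(x)=e^{x^b}-1$, let $x_b=(\frac{1-b}{b})^{1/b}$ if $b<1$ and $x_b=0$ if $b\ge1$, let $E_b=\Psi_b$ on $[x_b,\infty)$ and let $E_b$ be the tangent of $\Psi_b$ at $x_b$ on $[0,x_b)$; put $\Phi_b=E_b-E_b(0)$. Let $\|g\|_{\Phi_b(D)}=\inf\{\lambda>0:\int_D\Phi_b(|g_r|/\lambda)\,dr\le1\}$ be the Luxemburg norm. For a measurable function $A$ on $\{0\le s\le t\le T\}$ with values in a finite-dimensional normed space, and $a>0$, $p\in(0,\infty]$, put $$\omega_{\Phi_b}(A,\tau)=\sup_{0\le h\le\tau}\big\||A_{\cdot,\cdot+h}|\big\|_{\Phi_b([0,T-h])},\qquad \|A\|_{B^{a;2}_{\Phi_b,p}}=\Big\|\frac{\omega_{\Phi_b}(A,\tau)}{\tau^{a}}\Big\|_{L^p([0,T],\,d\tau/\tau)},$$ and let $B^{a;2}_{\Phi_b,p}$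 be the set of those $A$ with $\|A\|_{B^{a;2}_{\Phi_b,p}}<\infty$. With $\delta g_{s,t}=g_t-g_s$, let $B^{\alpha}_{\Phi_\beta,q}$ be the space of functions $g$ on $[0,T]$ in the Orlicz space $L^{\Phi_\beta}$ with $\|\delta g\|_{B^{\alpha;2}_{\Phi_\beta,q}}<\infty$; its elements are identified with their continuous representatives. *Rough paths.* An exponential Besov–Orlicz rough path is a pair $\mathbf X=(X,\mathbb X)$ with $X\in B^\alpha_{\Phi_\beta,q}([0,T];\mathbb R^n)$, $\mathbb X\in B^{2\alpha;2}_{\Phi_{\beta/2},q/2}([0,T];\mathbb R^{n\times n})$ and $\mathbb X_{s,t}-\mathbb X_{s,u}-\mathbb X_{u,t}=(\delta X_{s,u})(\delta X_{u,t})^\top$ for $0\le s\le u\le t\le T$. *Controlled paths.* $\mathscr D^{2\alpha;X}_{\Phi_{\beta/2},q/2}([0,T];W)$ is the set of pairs $(Y,Y')$ with $Y\in B^\alpha_{\Phi_\beta,q}([0,T];W)$, $Y'\in B^\alpha_{\Phi_\beta,q}([0,T];\mathcal L(\mathbb R^n;W))$ and $R^Y_{s,t}:=\delta Y_{s,t}-Y'_s\,\delta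 X_{s,t}\in B^{2\alpha;2}_{\Phi_{\beta/2},q/2}$. *Rough integral.* For $(Z,Z')\in\mathscr D^{2\alpha;X}_{\Phi_{\beta/2},q/2}([0,T];\mathbb R^{m\times n})$ put $\Xi_{s,t}=Z_s\,\delta X_{s,t}+Z'_s\mathbb X_{s,t}$, where $Z'_s$ acts on matrices by linear extension of $ab^\top\mapsto(Z'_sa)b$. The rough integral $I=\int_0^\cdot Z\,d\mathbf X$ is the continuous path $I:[0,T]\to\mathbb R^m$ with $I_0=0$, with $\delta I-\Xi\in B^{3\alpha;2}_{\Phi_{\beta/3},q/3}$, and such that, for every $r\in(0,\infty]$ with $r\ge q/3$ and $r>\frac1{3\alpha}$ and every sequence of partitions $\pi_k=\{0=t_0<\dots<t_N=1\}$ of $[0,1]$ with vanishing mesh, $(s,t)\mapsto\delta I_{s,t}-\sum_{i}\Xi_{s+t_i(t-s),\,s+t_{i+1}(t-s)}$ tends to $0$ in $B^{3\alpha;2}_{\Phi_{\beta/3},r}$. **Theorem.** Let $\mathbf X=(X,\mathbb X)$ be an exponential Besov–Orlicz rough path as above and let $f\in C^3_b(\mathbb R^m,\mathbb R^{m\times n})$.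 Then for every $y\in\mathbb R^m$ the rough differential equation $dY=f(Y)\,d\mathbf X$, $Y_0=y$, has a unique solution in $\mathscr D^{2\alpha;X}_{\Phi_{\beta/2},q/2}([0,T];\mathbb R^m)$: there is exactly one pair $(Y,Y')$ in this space such that $Y'_t=f(Y_t)$ and $$Y_t=y+\int_0^t f(Y_s)\,d\mathbf X_s\qquad\text{for all }t\in[0,T],$$ where the integral is the rough integral of the controlled path $(f(Y),Df(Y)Y')$. -/

import Mathlib

open MeasureTheory Filter Topology Set
open scoped ENNReal

noncomputable section

namespace BesovOrlicz

/-! ### Exponential Young functions and Orlicz spaces -/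

/-- `Ψ_β(x) = exp(x^β) - 1`. -/
def youngPsi (β x : ℝ) : ℝ := Real.exp (x ^ β) - 1

/-- The point from which `Ψ_β` is convex: `((1-β)/β)^(1/β)` if `β < 1`, and `0` otherwise. -/
def youngPt (β : ℝ) : ℝ := if β < 1 then ((1 - β) / β) ^ (1 / β) else 0

/-- `E_β`: equal to `Ψ_β` on `[x_β, ∞)`, and to the tangent of `Ψ_β` at `x_β` on `[0, x_β)`. -/
def youngE (β x : ℝ) : ℝ :=
  if youngPt β ≤ x then youngPsi β x
  else youngPsi β (youngPt β) + deriv (youngPsi β) (youngPt β) * (x - youngPt β)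

/-- The exponential Young function `Φ_β(x) = E_β(x) - E_β(0)`. -/
def youngPhi (β x : ℝ) : ℝ := youngE β x - youngE β 0

/-- The Luxemburg norm on `D` of a real function with respect to `Φ_β`; it is `∞` if no `l` is
admissible, that is, outside the Orlicz space. -/
def luxNorm (β : ℝ) (D : Set ℝ) (g : ℝ → ℝ) : ℝ≥0∞ :=
  ⨅ (l : ℝ) (_ : 0 < l ∧ ∫⁻ r in D, ENNReal.ofReal (youngPhi β (|g r| / l)) ≤ 1),
    ENNReal.ofReal l

/-- Membership in the exponential Orlicz space of `V`-valued functions on `D`. -/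
def MemOrlicz {V : Type*} [NormedAddCommGroup V] (β : ℝ) (D : Set ℝ) (g : ℝ → V) : Prop :=
  AEStronglyMeasurable g (volume.restrict D) ∧
    ∃ l : ℝ, 0 < l ∧ ∫⁻ r in D, ENNReal.ofReal (youngPhi β (‖g r‖ / l)) < ∞

/-! ### Besov-Orlicz(-type) spaces -/

/-- The simplex of pairs `0 ≤ s ≤ t ≤ T`. -/
def simplex (T : ℝ) : Set (ℝ × ℝ) := {p | 0 ≤ p.1 ∧ p.1 ≤ p.2 ∧ p.2 ≤ T}

/-- The measure `dτ/τ` on `(0, T]`. -/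
def logMeasure (T : ℝ) : Measure ℝ :=
  (volume.restrict (Ioc 0 T)).withDensity fun τ => ENNReal.ofReal τ⁻¹

/-- The increments `f_t - f_s`. -/
def incr {V : Type*} [NormedAddCommGroup V] (f : ℝ → V) (s t : ℝ) : V := f t - f s

/-- The `Φ_β`-modulus of continuity of a two-parameter function. -/
def modulus₂ {V : Type*} [NormedAddCommGroup V] (T β : ℝ) (A : ℝ → ℝ → V) (τ : ℝ) : ℝ≥0∞ :=
  ⨆ h ∈ Icc (0 : ℝ) τ, luxNorm β (Icc 0 (T - h)) fun r => ‖A r (r + h)‖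

/-- The quasi-norm of the two-parameter space `B^{α;2}_{Φ_β,q}([0,T];V)`: the `L^q(dτ/τ)`-norm
of `τ ↦ ω(A,τ)/τ^α`. -/
def besovNorm₂ {V : Type*} [NormedAddCommGroup V] (T α β : ℝ) (q : ℝ≥0∞)
    (A : ℝ → ℝ → V) : ℝ≥0∞ :=
  eLpNorm (fun τ => modulus₂ T β A τ / ENNReal.ofReal (τ ^ α)) q (logMeasure T)

/-- Measurability of a two-parameter function on the simplex, together with that of the
sections `r ↦ A_{r,r+h}` whose Orlicz norms enter the modulus of continuity. -/
def Measurable₂ {V : Type*} [NormedAddCommGroup V] (T : ℝ) (A : ℝ → ℝ → V) : Prop :=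
  AEStronglyMeasurable (fun p : ℝ × ℝ => A p.1 p.2) (volume.restrict (simplex T)) ∧
    ∀ h ∈ Icc (0 : ℝ) T,
      AEStronglyMeasurable (fun r => A r (r + h)) (volume.restrict (Icc 0 (T - h)))

/-- Membership in `B^{α;2}_{Φ_β,q}([0,T];V)`. -/
def MemBesov₂ {V : Type*} [NormedAddCommGroup V] (T α β : ℝ) (q : ℝ≥0∞)
    (A : ℝ → ℝ → V) : Prop :=
  Measurable₂ T A ∧ besovNorm₂ T α β q A < ∞

/-- `f` is the continuous representative of an element of `B^α_{Φ_β,q}([0,T];V)`. (For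
`0 < α < 1`, every element of this space has exactly one continuous representative.) The
seminorm of `f` is the two-parameter quasi-norm of its increments. -/
def MemBesov {V : Type*} [NormedAddCommGroup V] (T α β : ℝ) (q : ℝ≥0∞) (f : ℝ → V) : Prop :=
  ContinuousOn f (Icc 0 T) ∧ MemOrlicz β (Icc 0 T) f ∧ besovNorm₂ T α β q (incr f) < ∞

/-! ### Rough paths and controlled paths -/

/-- `(X, XX)` is an exponential Besov-Orlicz rough path over `ℝ^n`. The `n × n`-matrices are
`EuclideanSpace ℝ (Fin n × Fin n)`, whose norm is the Hilbert-Schmidt norm. -/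
structure IsRoughPath {n : ℕ} (T α β : ℝ) (q : ℝ≥0∞) (X : ℝ → EuclideanSpace ℝ (Fin n))
    (XX : ℝ → ℝ → EuclideanSpace ℝ (Fin n × Fin n)) : Prop where
  path : MemBesov T α β q X
  area : MemBesov₂ T (2 * α) (β / 2) (q / 2) XX
  chen : ∀ s u t : ℝ, 0 ≤ s → s ≤ u → u ≤ t → t ≤ T → ∀ i j : Fin n,
    XX s t (i, j) - XX s u (i, j) - XX u t (i, j) = (X u i - X s i) * (X t j - X u j)

/-- The remainder `R^Y_{s,t} = Y_t - Y_s - Y'_s (X_t - X_s)`. -/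
def remainder {V W : Type*} [NormedAddCommGroup V] [NormedSpace ℝ V] [NormedAddCommGroup W]
    [NormedSpace ℝ W] (X : ℝ → V) (Y : ℝ → W) (Y' : ℝ → V →L[ℝ] W) (s t : ℝ) : W :=
  incr Y s t - Y' s (incr X s t)

/-- `(Y, Y')` belongs to the space of paths controlled by `X`,
`D^{2α;X}_{Φ_{β/2},q/2}([0,T];W)`. -/
structure IsControlled {V W : Type*} [NormedAddCommGroup V] [NormedSpace ℝ V]
    [NormedAddCommGroup W] [NormedSpace ℝ W] (T α β : ℝ) (q : ℝ≥0∞) (X : ℝ → V)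
    (Y : ℝ → W) (Y' : ℝ → V →L[ℝ] W) : Prop where
  path : MemBesov T α β q Y
  deriv : MemBesov T α β q Y'
  rem : MemBesov₂ T (2 * α) (β / 2) (q / 2) (remainder X Y Y')

/-! ### The rough integral -/

/-- A partition `0 = t_0 < t_1 < ⋯ < t_N = 1` of `[0,1]`. -/
structure UnitPartition where
  N : ℕ
  pt : ℕ → ℝ
  pt_lt : ∀ i < N, pt i < pt (i + 1)
  pt_zero : pt 0 = 0
  pt_last : pt N = 1

/-- The norm `max_i (t_{i+1} - t_i)` of a partition. -/
def UnitPartition.mesh (π : UnitPartition) : ℝ :=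
  ⨆ i : Fin π.N, (π.pt (i + 1) - π.pt i)

/-- The sums `∑_i A_{s + t_i (t-s), s + t_{i+1} (t-s)}`. -/
def UnitPartition.sum {W : Type*} [NormedAddCommGroup W] (π : UnitPartition)
    (A : ℝ → ℝ → W) (s t : ℝ) : W :=
  ∑ i ∈ Finset.range π.N, A (s + π.pt i * (t - s)) (s + π.pt (i + 1) * (t - s))

/-- The local approximation `Z_s (X_t - X_s) + Z'_s XX_{s,t}` of the rough integral. Matrices
in `ℝ^{m×n}` are linear maps `ℝ^n → W`, and `Z'_s` in `L(ℝ^n; ℝ^{m×n})` acts on `n × n`-matrices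
by the linear extension of `a bᵀ ↦ (Z'_s a) b`. -/
def localApprox {n : ℕ} {W : Type*} [NormedAddCommGroup W] [NormedSpace ℝ W]
    (X : ℝ → EuclideanSpace ℝ (Fin n)) (XX : ℝ → ℝ → EuclideanSpace ℝ (Fin n × Fin n))
    (Z : ℝ → EuclideanSpace ℝ (Fin n) →L[ℝ] W)
    (Z' : ℝ → EuclideanSpace ℝ (Fin n) →L[ℝ] EuclideanSpace ℝ (Fin n) →L[ℝ] W)
    (s t : ℝ) : W :=
  Z s (incr X s t) + ∑ i : Fin n, ∑ j : Fin n,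
    XX s t (i, j) • Z' s (EuclideanSpace.single i 1) (EuclideanSpace.single j 1)

/-- `I` is the rough integral `∫_0^· Z dX` of `(Z, Z')`, that is, the continuous path with
`I_0 = 0` obtained by sewing the local approximation: the increments of `I` are, for every
sequence of partitions with vanishing norms, the limit of the compensated sums in
`B^{3α;2}_{Φ_{β/3},r}` for all `r ≥ q/3` with `r > 1/(3α)`, and they differ from the local
approximation by an element of `B^{3α;2}_{Φ_{β/3},q/3}`. -/
structure IsRoughIntegral {n : ℕ} {W : Type*} [NormedAddCommGroup W] [NormedSpace ℝ W]
    (T α β : ℝ) (q : ℝ≥0∞)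
    (X : ℝ → EuclideanSpace ℝ (Fin n)) (XX : ℝ → ℝ → EuclideanSpace ℝ (Fin n × Fin n))
    (Z : ℝ → EuclideanSpace ℝ (Fin n) →L[ℝ] W)
    (Z' : ℝ → EuclideanSpace ℝ (Fin n) →L[ℝ] EuclideanSpace ℝ (Fin n) →L[ℝ] W)
    (I : ℝ → W) : Prop where
  continuousOn : ContinuousOn I (Icc 0 T)
  zero : I 0 = 0
  approx : MemBesov₂ T (3 * α) (β / 3) (q / 3) fun s t => incr I s t - localApprox X XX Z Z' s t
  tendsto_sum : ∀ r : ℝ≥0∞, q / 3 ≤ r → ENNReal.ofReal (1 / (3 * α)) < r →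
    ∀ π : ℕ → UnitPartition, Tendsto (fun k => (π k).mesh) atTop (𝓝 0) →
      Tendsto (fun k => besovNorm₂ T (3 * α) (β / 3) r
        fun s t => incr I s t - (π k).sum (localApprox X XX Z Z') s t) atTop (𝓝 0)

/-! ### Rough differential equations -/

/-- `f` belongs to `C^3_b`. -/
def IsCb3 {V W : Type*} [NormedAddCommGroup V] [NormedSpace ℝ V] [NormedAddCommGroup W]
    [NormedSpace ℝ W] (f : V → W) : Prop :=
  ContDiff ℝ 3 f ∧ ∀ k : ℕ, k ≤ 3 → ∃ C : ℝ, ∀ x, ‖iteratedFDeriv ℝ k f x‖ ≤ C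

/-- `(Y, Y')` is a solution on `[0,T]` of `dY = f(Y) dX`, `Y_0 = y`: a controlled path with
`Y' = f(Y)` and `Y_t = y + ∫_0^t f(Y) dX`, where the integrand `f(Y)` has the Gubinelli
derivative `Df(Y) Y'`. -/
structure IsSolution {m n : ℕ} (T α β : ℝ) (q : ℝ≥0∞)
    (X : ℝ → EuclideanSpace ℝ (Fin n)) (XX : ℝ → ℝ → EuclideanSpace ℝ (Fin n × Fin n))
    (f : EuclideanSpace ℝ (Fin m) → EuclideanSpace ℝ (Fin n) →L[ℝ] EuclideanSpace ℝ (Fin m))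
    (y : EuclideanSpace ℝ (Fin m)) (Y : ℝ → EuclideanSpace ℝ (Fin m))
    (Y' : ℝ → EuclideanSpace ℝ (Fin n) →L[ℝ] EuclideanSpace ℝ (Fin m)) : Prop where
  controlled : IsControlled T α β q X Y Y'
  deriv_eq : ∀ t ∈ Icc 0 T, Y' t = f (Y t)
  eq : ∃ I : ℝ → EuclideanSpace ℝ (Fin m),
    IsRoughIntegral T α β q X XX (fun s => f (Y s))
      (fun s => (fderiv ℝ f (Y s)).comp (Y' s)) I ∧
    ∀ t ∈ Icc 0 T, Y t = y + I t

end BesovOrlicz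

end

noncomputable section

namespace BesovOrlicz

/-! ### Exponential Young functions -/

/-! Besov–Orlicz regularity with an exponential Young function is, up to an arbitrarily small loss
of exponent, Hölder regularity. The equation is therefore solved in Hölder spaces of an exponent θ
with 1/3 < θ < α, and the sharp Besov–Orlicz regularity is recovered afterwards. No fixed point is
sought in the Besov–Orlicz spaces themselves.

From Besov–Orlicz to Hölder. An exponential Orlicz norm controls all moments. A chaining argument of
Garsia–Rodemich–Rumsey type (`exists_ae_holder`) turns moment bounds on the sections r ↦ A(r, r+h)
into pointwise bounds |A(s,t)| ≤ K|t-s|^θ off a null set, provided A is subadditive up to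
O(|t-s|^θ). Paths are additive, the second level is almost subadditive by Chen's relation, and so
are the remainders and local errors of a solution. As 𝕏 need not be continuous, it is first replaced
by a version that is (`IsRoughPath.exists_continuous_version`). The two versions agree when both
arguments avoid a null set, which none of the norms can see.

The Hölder problem. A path Y is a solution in the sense of Davie if its local error N(s,t) = Y_t -
Y_s - f(Y_s)δX_{s,t} - Df(Y_s)f(Y_s)𝕏_{s,t} is O(|t-s|^{3θ}). Chen's relation makes the failure of
additivity of N explicit (`sub_davieStep`), and 3θ > 1 makes such failures summable. Existence
(`exists_isDavie`) follows from bounds on Euler schemes that are uniform in the step size, and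
compactness. Uniqueness (`IsDavie.eqOn`) follows by comparing the local errors of two solutions on
short intervals.

Back to Besov–Orlicz (`IsDavie.isSolution`). The increments of a Davie solution are dominated by
those of X up to O(|t-s|^{2θ}), and its remainder by 𝕏 up to O(|t-s|^{3θ}). Since 2θ > α and 3θ > 1
≥ 2α, these errors are negligible at the levels α and 2α. At the level 3α the Hölder bound is too
weak, and N is treated by sewing along dyadic partitions with Orlicz norms
(`logMem_modulus₂_of_sewing`). The modulus of the defect of N is a product of moduli of orders 2α
and α, and Φ_{β/2} and Φ_β multiply into Φ_{β/3}. The compensated sums differ from δI by the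
partition sums of N, which vanish because 3α > 1.

Conversely, every Besov–Orlicz solution is a Davie solution (`IsSolution.exists_isDavie`): the
chaining argument applies in turn to Y, to its remainder and to N. Uniqueness among Davie solutions
then gives uniqueness in the theorem. -/

lemma youngPt_nonneg {b : ℝ} (hb : 0 < b) : 0 ≤ youngPt b := by
  unfold youngPt
  split_ifs with h
  · exact Real.rpow_nonneg (div_nonneg (by linarith) hb.le) _
  · exact le_rfl

lemma youngPt_pos {b : ℝ} (hb : 0 < b) (h1 : b < 1) : 0 < youngPt b := by
  unfold youngPt
  rw [if_pos h1]
  exact Real.rpow_pos_of_pos (div_pos (by linarith) hb) _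

lemma hasDerivAt_youngPsi {b x : ℝ} (hx : 0 < x) :
    HasDerivAt (youngPsi b) (b * x ^ (b - 1) * Real.exp (x ^ b)) x := by
  have h := ((Real.hasDerivAt_rpow_const (p := b) (Or.inl hx.ne')).exp).sub_const 1
  refine h.congr_deriv ?_
  ring

lemma continuous_youngPsi {b : ℝ} (hb : 0 < b) : Continuous (youngPsi b) := by
  unfold youngPsi
  have : Continuous fun x : ℝ => x ^ b := Real.continuous_rpow_const hb.le
  fun_prop

/-- The second derivative of Ψ_b has the sign of b - 1 + b x^b, and for b < 1 the point x_b is the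
zero of this expression. -/
lemma one_sub_le_of_youngPt_le {b x : ℝ} (hb : 0 < b) (hx : youngPt b ≤ x) :
    1 - b ≤ b * x ^ b := by
  have hx0 := (youngPt_nonneg hb).trans hx
  by_cases h : b < 1
  · have h1 : (youngPt b) ^ b ≤ x ^ b := Real.rpow_le_rpow (youngPt_nonneg hb) hx hb.le
    have h2 : (youngPt b) ^ b = (1 - b) / b := by
      unfold youngPt
      rw [if_pos h, ← Real.rpow_mul (div_nonneg (by linarith) hb.le),
        one_div_mul_cancel hb.ne', Real.rpow_one]
    rw [h2, div_le_iff₀ hb] at h1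
    linarith
  · have := Real.rpow_nonneg hx0 b
    nlinarith

lemma convexOn_youngPsi {b : ℝ} (hb : 0 < b) : ConvexOn ℝ (Ici (youngPt b)) (youngPsi b) := by
  have hpos : ∀ x ∈ interior (Ici (youngPt b)), 0 < x := fun x hx => by
    rw [interior_Ici] at hx
    exact (youngPt_nonneg hb).trans_lt hx
  refine convexOn_of_hasDerivWithinAt2_nonneg (convex_Ici _)
    (continuous_youngPsi hb).continuousOn
    (f' := fun x => b * x ^ (b - 1) * Real.exp (x ^ b))
    (f'' := fun x => b * Real.exp (x ^ b) * x ^ (b - 2) * (b - 1 + b * x ^ b))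
    (fun x hx => (hasDerivAt_youngPsi (hpos x hx)).hasDerivWithinAt)
    (fun x hx => ?_) (fun x hx => ?_)
  · have hx0 := hpos x hx
    have h1 := (Real.hasDerivAt_rpow_const (p := b - 1) (Or.inl hx0.ne')).const_mul b
    have h2 := (Real.hasDerivAt_rpow_const (p := b) (Or.inl hx0.ne')).exp
    refine ((h1.mul h2).congr_deriv ?_).hasDerivWithinAt
    have e1 : x ^ (b - 1 - 1) = x ^ (b - 2) := by congr 1; ring
    have e2 : x ^ (b - 1) * x ^ (b - 1) = x ^ (b - 2) * x ^ b := by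
      rw [← Real.rpow_add hx0, ← Real.rpow_add hx0]; congr 1; ring
    rw [e1]
    linear_combination (b * b * Real.exp (x ^ b)) * e2
  · have hx0 := hpos x hx
    rw [interior_Ici] at hx
    have := one_sub_le_of_youngPt_le hb hx.le
    have h3 := Real.rpow_pos_of_pos hx0 (b - 2)
    have := Real.exp_pos (x ^ b)
    exact mul_nonneg (by positivity) (by linarith)

lemma strictMonoOn_youngPsi {b : ℝ} (hb : 0 < b) : StrictMonoOn (youngPsi b) (Ici 0) := by
  intro x hx y _ hxy
  have := Real.exp_lt_exp.2 (Real.rpow_lt_rpow hx hxy hb)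
  unfold youngPsi
  linarith

/-- The tangent of `Ψ_b` at `x_b`, with slope `0` if `b ≥ 1`. -/
lemma exists_youngPhi_eq {b : ℝ} (hb : 0 < b) : ∃ c : ℝ, 0 ≤ c ∧
    MonotoneOn (fun x => youngPsi b x - c * x) (Ici (youngPt b)) ∧
    ∀ x, 0 ≤ x → youngPhi b x =
      c * x + (youngPsi b (max x (youngPt b)) - c * max x (youngPt b)) -
        (youngPsi b (youngPt b) - c * youngPt b) := by
  by_cases h : b < 1
  · have hp := youngPt_pos hb h
    have hd := hasDerivAt_youngPsi (b := b) hp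
    set c := b * youngPt b ^ (b - 1) * Real.exp (youngPt b ^ b) with hc
    have hc0 : 0 ≤ c := by
      have := Real.rpow_pos_of_pos hp (b - 1)
      positivity
    have hconv : ConvexOn ℝ (Ici (youngPt b)) (fun x => youngPsi b x - c * x) := by
      have h2 : ConcaveOn ℝ (Ici (youngPt b)) (fun x => c * x) :=
        ((concaveOn_id (convex_Ici _)).smul hc0)
      exact (convexOn_youngPsi hb).sub h2
    have hmin : ∀ y, youngPt b ≤ y →
        youngPsi b (youngPt b) - c * youngPt b ≤ youngPsi b y - c * y := by
      intro y hy
      rcases hy.eq_or_lt with rfl | hlt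
      · exact le_rfl
      have h3 := (convexOn_youngPsi hb).le_slope_of_hasDerivAt self_mem_Ici hy hlt hd
      rw [slope_def_field, le_div_iff₀ (by linarith)] at h3
      linarith
    refine ⟨c, hc0, ?_, ?_⟩
    -- The tangent at x_b makes x_b a minimum of the convex function Ψ_b(x) - c x on [x_b, ∞), and a
    -- convex function that is minimal at the left end is monotone.
    · intro x hx y hy hxy
      have := hconv.le_max_of_mem_Icc self_mem_Ici hy ⟨hx, hxy⟩
      exact this.trans (max_le (hmin y hy) le_rfl)
    · intro x hx
      unfold youngPhi youngE
      rw [if_neg (not_le.2 hp), hd.deriv]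
      split_ifs with h4
      · rw [max_eq_left h4]; ring
      · rw [max_eq_right (not_le.1 h4).le]; ring
  · have hp : youngPt b = 0 := by unfold youngPt; rw [if_neg h]
    refine ⟨0, le_rfl, ?_, ?_⟩
    · simp only [zero_mul, sub_zero]
      rw [hp]
      exact (strictMonoOn_youngPsi hb).monotoneOn
    · intro x hx
      unfold youngPhi youngE
      simp [hp, hx]

lemma youngPhi_zero (b : ℝ) : youngPhi b 0 = 0 := by simp [youngPhi]

lemma monotoneOn_youngPhi {b : ℝ} (hb : 0 < b) : MonotoneOn (youngPhi b) (Ici 0) := by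
  obtain ⟨c, hc, hm, he⟩ := exists_youngPhi_eq hb
  intro x hx y hy hxy
  rw [he x hx, he y hy]
  have h1 := hm (le_max_right x (youngPt b)) (le_max_right y (youngPt b))
    (max_le_max_right (youngPt b) hxy)
  have h2 := mul_le_mul_of_nonneg_left hxy hc
  simp only at h1
  linarith

lemma youngPhi_nonneg {b x : ℝ} (hb : 0 < b) (hx : 0 ≤ x) : 0 ≤ youngPhi b x := by
  rw [← youngPhi_zero b]
  exact monotoneOn_youngPhi hb self_mem_Ici hx hx

/-- Writing Φ_b(x) as c x plus g(max(x, x_b)) plus a constant, with g convex and monotone, avoids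
glueing two convex pieces. -/
lemma convexOn_youngPhi {b : ℝ} (hb : 0 < b) : ConvexOn ℝ (Ici 0) (youngPhi b) := by
  obtain ⟨c, hc, hm, he⟩ := exists_youngPhi_eq hb
  have himg : (fun x => max x (youngPt b)) '' (Ici 0) = Ici (youngPt b) := by
    ext y
    constructor
    · rintro ⟨x, -, rfl⟩
      exact le_max_right x (youngPt b)
    · intro hy
      exact ⟨y, (youngPt_nonneg hb).trans hy, max_eq_left hy⟩
  have h2 : ConcaveOn ℝ (Ici (youngPt b)) (fun x => c * x) :=
    ((concaveOn_id (convex_Ici _)).smul hc)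
  have h3 : ConvexOn ℝ (Ici (youngPt b)) (fun x => youngPsi b x - c * x) :=
    (convexOn_youngPsi hb).sub h2
  have h4 : ConvexOn ℝ (Ici (0 : ℝ)) (fun x => max x (youngPt b)) :=
    (convexOn_id (convex_Ici _)).sup (convexOn_const _ (convex_Ici _))
  have h5 := ConvexOn.comp (g := fun x => youngPsi b x - c * x)
    (f := fun x => max x (youngPt b)) (s := Ici (0 : ℝ)) (by rwa [himg]) h4 (by rwa [himg])
  have h6 : ConvexOn ℝ (Ici (0 : ℝ)) (fun x => c * x) :=
    ((convexOn_id (convex_Ici _)).smul hc)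
  have h7 := (h6.add h5).add_const (-(youngPsi b (youngPt b) - c * youngPt b))
  refine h7.congr ?_
  intro x hx
  simp only [Pi.add_apply, Function.comp]
  rw [he x hx]
  ring

/-- Estimates for Φ_b reduce to estimates for exp(x^b). The additive error K is harmless because all
domains of integration have measure at most T. -/
lemma exists_abs_youngPhi_sub_exp_le {b : ℝ} (hb : 0 < b) :
    ∃ K : ℝ, 0 ≤ K ∧ ∀ x, 0 ≤ x → |youngPhi b x - Real.exp (x ^ b)| ≤ K := by
  obtain ⟨c, hc, hm, he⟩ := exists_youngPhi_eq hb
  set p := youngPt b with hp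
  have hp0 : 0 ≤ p := youngPt_nonneg hb
  have hcp : 0 ≤ c * p := mul_nonneg hc hp0
  have hE : 0 < Real.exp (p ^ b) := Real.exp_pos _
  refine ⟨1 + c * p + Real.exp (p ^ b), by positivity, ?_⟩
  intro x hx
  rw [he x hx]
  unfold youngPsi
  rcases le_total p x with h | h
  · rw [max_eq_left h, abs_le]
    constructor <;> linarith
  · rw [max_eq_right h, abs_le]
    have h1 : Real.exp (x ^ b) ≤ Real.exp (p ^ b) :=
      Real.exp_le_exp.2 (Real.rpow_le_rpow hx h hb.le)
    have h2 := mul_le_mul_of_nonneg_left h hc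
    have h3 := mul_nonneg hc hx
    have := Real.exp_pos (x ^ b)
    constructor <;> linarith

lemma measurable_youngPhi {b : ℝ} : Measurable (youngPhi b) := by
  have h1 : Measurable (youngPsi b) := by
    unfold youngPsi
    fun_prop
  have : Measurable (youngE b) := by
    unfold youngE
    refine Measurable.ite measurableSet_Ici h1 ?_
    fun_prop
  unfold youngPhi
  exact this.sub_const _

/-- `Φ_b(x/M) ≤ Φ_b(x)/M` for `M ≥ 1`. -/
lemma youngPhi_div_le {b x M : ℝ} (hb : 0 < b) (hx : 0 ≤ x) (hM : 1 ≤ M) :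
    youngPhi b (x / M) ≤ youngPhi b x / M := by
  have hM0 : 0 < M := by linarith
  have h := (convexOn_youngPhi hb).2 (mem_Ici.2 hx) (mem_Ici.2 le_rfl)
    (show 0 ≤ 1 / M by positivity)
    (show 0 ≤ 1 - 1 / M by rw [sub_nonneg, div_le_one hM0]; exact hM) (by ring)
  simp only [smul_eq_mul, mul_zero, add_zero, youngPhi_zero] at h
  calc youngPhi b (x / M) = youngPhi b (1 / M * x) := by congr 1; ring
    _ ≤ 1 / M * youngPhi b x := h
    _ = _ := by ring

/-- This is y^k ≤ k! e^y for y = x^b, with k so large that b k ≥ p. -/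
lemma exists_pow_le_youngPhi {b : ℝ} (hb : 0 < b) (p : ℕ) :
    ∃ C : ℝ, 0 < C ∧ ∀ x, 0 ≤ x → x ^ p ≤ C * (1 + youngPhi b x) := by
  obtain ⟨K, hK0, hK⟩ := exists_abs_youngPhi_sub_exp_le hb
  obtain ⟨k, hk⟩ := exists_nat_ge ((p : ℝ) / b)
  have hkb : (p : ℝ) ≤ b * k := by rwa [div_le_iff₀ hb, mul_comm] at hk
  refine ⟨(1 + k.factorial) * (1 + K), by positivity, fun x hx => ?_⟩
  have hΦ := youngPhi_nonneg hb hx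
  have h1 : (x ^ b) ^ k ≤ k.factorial * Real.exp (x ^ b) := by
    have := Real.pow_div_factorial_le_exp (x ^ b) (Real.rpow_nonneg hx b) k
    rw [div_le_iff₀ (by positivity)] at this
    linarith
  have h2 : x ^ p ≤ 1 + (x ^ b) ^ k := by
    have hxb : 0 ≤ (x ^ b) ^ k := pow_nonneg (Real.rpow_nonneg hx b) k
    rcases le_total x 1 with h | h
    · have := pow_le_one₀ hx h (n := p)
      linarith
    · have e : (x ^ b) ^ k = x ^ (b * k) := by
        rw [← Real.rpow_natCast, ← Real.rpow_mul hx]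
      have : x ^ (p : ℝ) ≤ x ^ (b * k) := Real.rpow_le_rpow_of_exponent_le h hkb
      rw [Real.rpow_natCast] at this
      rw [e]
      linarith
  have h3 : Real.exp (x ^ b) ≤ K + youngPhi b x := by
    have := (abs_le.1 (hK x hx)).1
    linarith
  have h4 : (1 : ℝ) ≤ Real.exp (x ^ b) := Real.one_le_exp (Real.rpow_nonneg hx b)
  calc x ^ p ≤ (1 + k.factorial) * Real.exp (x ^ b) := by nlinarith
    _ ≤ (1 + k.factorial) * (K + youngPhi b x) := by gcongr
    _ ≤ (1 + k.factorial) * ((1 + K) * (1 + youngPhi b x)) := by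
        gcongr
        nlinarith
    _ = _ := by ring

/-! ### The Luxemburg norm -/

lemma luxNorm_le_ofReal {b l : ℝ} {D : Set ℝ} {g : ℝ → ℝ} (hl : 0 < l)
    (h : ∫⁻ r in D, ENNReal.ofReal (youngPhi b (|g r| / l)) ≤ 1) :
    luxNorm b D g ≤ ENNReal.ofReal l :=
  iInf₂_le l ⟨hl, h⟩

lemma lintegral_youngPhi_le_one {b l : ℝ} {D : Set ℝ} {g : ℝ → ℝ} (hb : 0 < b)
    (h : luxNorm b D g < ENNReal.ofReal l) :
    ∫⁻ r in D, ENNReal.ofReal (youngPhi b (|g r| / l)) ≤ 1 := by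
  unfold luxNorm at h
  simp only [iInf_lt_iff] at h
  obtain ⟨l', ⟨hl', h1⟩, h2⟩ := h
  have hll : l' < l := (ENNReal.ofReal_lt_ofReal_iff_of_nonneg hl'.le).1 h2
  refine (lintegral_mono fun r => ENNReal.ofReal_le_ofReal ?_).trans h1
  have h0 := abs_nonneg (g r)
  exact monotoneOn_youngPhi hb (div_nonneg h0 (hl'.trans hll).le) (div_nonneg h0 hl'.le)
    (div_le_div_of_nonneg_left h0 hl' hll.le)

/-- Together with `lintegral_youngPhi_le_one`, which needs a strict inequality, this makes it
unnecessary to know that the infimum in the norm is attained. -/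
lemma luxNorm_le_ofReal_of_forall {b c : ℝ} {D : Set ℝ} {g : ℝ → ℝ}
    (h : ∀ l, c < l → luxNorm b D g ≤ ENNReal.ofReal l) : luxNorm b D g ≤ ENNReal.ofReal c := by
  have ht : Tendsto (fun l => ENNReal.ofReal l) (𝓝[>] c) (𝓝 (ENNReal.ofReal c)) :=
    (ENNReal.continuous_ofReal.tendsto c).mono_left nhdsWithin_le_nhds
  exact ge_of_tendsto ht (eventually_nhdsWithin_of_forall fun l hl => h l hl)

lemma luxNorm_mono {b : ℝ} {D D' : Set ℝ} {g g' : ℝ → ℝ} (hb : 0 < b) (hD : D ⊆ D')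
    (h : ∀ᵐ r ∂volume.restrict D, |g r| ≤ |g' r|) : luxNorm b D g ≤ luxNorm b D' g' := by
  refine le_iInf₂ fun l hl => luxNorm_le_ofReal hl.1 ?_
  calc ∫⁻ r in D, ENNReal.ofReal (youngPhi b (|g r| / l))
      ≤ ∫⁻ r in D, ENNReal.ofReal (youngPhi b (|g' r| / l)) := by
        refine lintegral_mono_ae (h.mono fun r hr => ENNReal.ofReal_le_ofReal ?_)
        exact monotoneOn_youngPhi hb (div_nonneg (abs_nonneg _) hl.1.le)
          (div_nonneg (abs_nonneg _) hl.1.le) (div_le_div_of_nonneg_right hr hl.1.le)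
    _ ≤ ∫⁻ r in D', ENNReal.ofReal (youngPhi b (|g' r| / l)) :=
        lintegral_mono_set hD
    _ ≤ 1 := hl.2

lemma aemeasurable_youngPhi {b l : ℝ} {μ : Measure ℝ} {g : ℝ → ℝ} (hg : AEMeasurable g μ) :
    AEMeasurable (fun r => ENNReal.ofReal (youngPhi b (|g r| / l))) μ :=
  (measurable_youngPhi.comp_aemeasurable
    ((measurable_norm.comp_aemeasurable hg).div_const l)).ennreal_ofReal

lemma luxNorm_add_le {b : ℝ} {D : Set ℝ} {F f g : ℝ → ℝ} (hb : 0 < b)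
    (hf : AEMeasurable f (volume.restrict D))
    (h : ∀ᵐ r ∂volume.restrict D, |F r| ≤ |f r| + |g r|) :
    luxNorm b D F ≤ luxNorm b D f + luxNorm b D g := by
  by_cases hft : luxNorm b D f = ∞
  · simp [hft]
  by_cases hgt : luxNorm b D g = ∞
  · simp [hgt]
  obtain ⟨x, hx, hfx⟩ : ∃ x : ℝ, 0 ≤ x ∧ luxNorm b D f = ENNReal.ofReal x :=
    ⟨_, ENNReal.toReal_nonneg, (ENNReal.ofReal_toReal hft).symm⟩
  obtain ⟨y, hy, hgy⟩ : ∃ y : ℝ, 0 ≤ y ∧ luxNorm b D g = ENNReal.ofReal y :=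
    ⟨_, ENNReal.toReal_nonneg, (ENNReal.ofReal_toReal hgt).symm⟩
  rw [hfx, hgy, ← ENNReal.ofReal_add hx hy]
  refine luxNorm_le_ofReal_of_forall fun l hl => ?_
  -- The excess of l over the two norms is split equally. The convex combination below has weights
  -- u/(u+v) and v/(u+v).
  obtain ⟨u, v, hu, hv, rfl⟩ : ∃ u v, x < u ∧ y < v ∧ u + v = l :=
    ⟨x + (l - x - y) / 2, y + (l - x - y) / 2, by linarith, by linarith, by ring⟩
  have hu0 : 0 < u := by linarith
  have hv0 : 0 < v := by linarith
  have h1 : ∫⁻ r in D, ENNReal.ofReal (youngPhi b (|f r| / u)) ≤ 1 :=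
    lintegral_youngPhi_le_one hb (by rw [hfx]; exact (ENNReal.ofReal_lt_ofReal_iff hu0).2 hu)
  have h2 : ∫⁻ r in D, ENNReal.ofReal (youngPhi b (|g r| / v)) ≤ 1 :=
    lintegral_youngPhi_le_one hb (by rw [hgy]; exact (ENNReal.ofReal_lt_ofReal_iff hv0).2 hv)
  refine luxNorm_le_ofReal (by positivity) ?_
  have hw1 : 0 ≤ u / (u + v) := by positivity
  have hw2 : 0 ≤ v / (u + v) := by positivity
  calc ∫⁻ r in D, ENNReal.ofReal (youngPhi b (|F r| / (u + v)))
      ≤ ∫⁻ r in D, (ENNReal.ofReal (u / (u + v)) * ENNReal.ofReal (youngPhi b (|f r| / u)) +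
          ENNReal.ofReal (v / (u + v)) * ENNReal.ofReal (youngPhi b (|g r| / v))) := by
        refine lintegral_mono_ae (h.mono fun r hr => ?_)
        have hp1 : 0 ≤ |f r| / u := by positivity
        have hp2 : 0 ≤ |g r| / v := by positivity
        rw [← ENNReal.ofReal_mul hw1, ← ENNReal.ofReal_mul hw2, ← ENNReal.ofReal_add
          (mul_nonneg hw1 (youngPhi_nonneg hb hp1)) (mul_nonneg hw2 (youngPhi_nonneg hb hp2))]
        refine ENNReal.ofReal_le_ofReal ?_
        have hc := (convexOn_youngPhi hb).2 (mem_Ici.2 hp1) (mem_Ici.2 hp2) hw1 hw2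
          (by field_simp)
        simp only [smul_eq_mul] at hc
        refine le_trans ?_ hc
        have e : u / (u + v) * (|f r| / u) + v / (u + v) * (|g r| / v) =
            (|f r| + |g r|) / (u + v) := by field_simp
        rw [e]
        exact monotoneOn_youngPhi hb (mem_Ici.2 (by positivity)) (mem_Ici.2 (by positivity))
          (div_le_div_of_nonneg_right hr (by positivity))
    _ = ENNReal.ofReal (u / (u + v)) * (∫⁻ r in D, ENNReal.ofReal (youngPhi b (|f r| / u))) +
          ENNReal.ofReal (v / (u + v)) * ∫⁻ r in D, ENNReal.ofReal (youngPhi b (|g r| / v)) := by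
        rw [lintegral_add_left' ((aemeasurable_youngPhi hf).const_mul _),
          lintegral_const_mul' _ _ ENNReal.ofReal_ne_top,
          lintegral_const_mul' _ _ ENNReal.ofReal_ne_top]
    _ ≤ ENNReal.ofReal (u / (u + v)) * 1 + ENNReal.ofReal (v / (u + v)) * 1 := by gcongr
    _ = 1 := by
        rw [mul_one, mul_one, ← ENNReal.ofReal_add hw1 hw2]
        have : u / (u + v) + v / (u + v) = 1 := by field_simp
        rw [this, ENNReal.ofReal_one]

lemma luxNorm_zero (b : ℝ) (D : Set ℝ) : luxNorm b D (fun _ => 0) = 0 := by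
  rw [← nonpos_iff_eq_zero, ← ENNReal.ofReal_zero]
  refine luxNorm_le_ofReal_of_forall fun l hl => luxNorm_le_ofReal hl ?_
  simp [youngPhi_zero]

lemma luxNorm_le_mul {b c : ℝ} {D : Set ℝ} {F g : ℝ → ℝ} (hb : 0 < b) (hc : 0 ≤ c)
    (h : ∀ᵐ r ∂volume.restrict D, |F r| ≤ c * |g r|) :
    luxNorm b D F ≤ ENNReal.ofReal c * luxNorm b D g := by
  rcases hc.eq_or_lt with rfl | hc0
  · rw [ENNReal.ofReal_zero, zero_mul, ← luxNorm_zero b D]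
    exact luxNorm_mono hb le_rfl (h.mono fun r hr => by simpa using hr)
  by_cases hgt : luxNorm b D g = ∞
  · rw [hgt, ENNReal.mul_top (by simpa using hc0)]
    exact le_top
  obtain ⟨y, hy, hgy⟩ : ∃ y : ℝ, 0 ≤ y ∧ luxNorm b D g = ENNReal.ofReal y :=
    ⟨_, ENNReal.toReal_nonneg, (ENNReal.ofReal_toReal hgt).symm⟩
  rw [hgy, ← ENNReal.ofReal_mul hc]
  refine luxNorm_le_ofReal_of_forall fun l hl => ?_
  have hl0 : 0 < l := lt_of_le_of_lt (by positivity) hl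
  have hlc : 0 < l / c := by positivity
  refine luxNorm_le_ofReal hl0 ?_
  have h2 : ∫⁻ r in D, ENNReal.ofReal (youngPhi b (|g r| / (l / c))) ≤ 1 :=
    lintegral_youngPhi_le_one hb (by
      rw [hgy]
      exact (ENNReal.ofReal_lt_ofReal_iff hlc).2 (by rw [lt_div_iff₀ hc0]; linarith))
  refine (lintegral_mono_ae (h.mono fun r hr => ENNReal.ofReal_le_ofReal ?_)).trans h2
  refine monotoneOn_youngPhi hb (mem_Ici.2 (by positivity)) (mem_Ici.2 (by positivity)) ?_
  calc |F r| / l ≤ c * |g r| / l := div_le_div_of_nonneg_right hr hl0.le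
    _ = |g r| / (l / c) := by field_simp

/-- For l > C M the integrand is at most Φ_b(1/C) ≤ Φ_b(1)/C by convexity, so C = 1 + Φ_b(1) T
brings the integral below 1. -/
lemma exists_luxNorm_le_of_bound {b : ℝ} (hb : 0 < b) {T : ℝ} (hT : 0 ≤ T) :
    ∃ C : ℝ, 0 < C ∧ ∀ (D : Set ℝ), D ⊆ Icc 0 T → ∀ (g : ℝ → ℝ) (M : ℝ), 0 ≤ M →
      (∀ᵐ r ∂volume.restrict D, |g r| ≤ M) → luxNorm b D g ≤ ENNReal.ofReal (C * M) := by
  have hΦ : 0 ≤ youngPhi b 1 := youngPhi_nonneg hb zero_le_one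
  have hC : 0 < 1 + youngPhi b 1 * T := by positivity
  refine ⟨1 + youngPhi b 1 * T, hC, fun D hD g M hM h => ?_⟩
  set C := 1 + youngPhi b 1 * T with hCdef
  refine luxNorm_le_ofReal_of_forall fun l hl => ?_
  have hl0 : 0 < l := lt_of_le_of_lt (by positivity) hl
  refine luxNorm_le_ofReal hl0 ?_
  calc ∫⁻ r in D, ENNReal.ofReal (youngPhi b (|g r| / l))
      ≤ ∫⁻ _ in D, ENNReal.ofReal (youngPhi b 1 / C) := by
        refine lintegral_mono_ae (h.mono fun r hr => ENNReal.ofReal_le_ofReal ?_)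
        refine le_trans ?_ (youngPhi_div_le hb zero_le_one (by nlinarith))
        refine monotoneOn_youngPhi hb (mem_Ici.2 (by positivity)) (mem_Ici.2 (by positivity)) ?_
        rw [div_le_div_iff₀ hl0 hC]
        nlinarith
    _ = ENNReal.ofReal (youngPhi b 1 / C) * volume D := by
        rw [lintegral_const, Measure.restrict_apply_univ]
    _ ≤ ENNReal.ofReal (youngPhi b 1 / C) * ENNReal.ofReal T := by
        gcongr
        calc volume D ≤ volume (Icc 0 T) := measure_mono hD
          _ = ENNReal.ofReal T := by rw [Real.volume_Icc, sub_zero]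
    _ ≤ 1 := by
        rw [← ENNReal.ofReal_mul (by positivity), ← ENNReal.ofReal_one]
        refine ENNReal.ofReal_le_ofReal ?_
        rw [div_mul_eq_mul_div, div_le_one hC]
        linarith

lemma luxNorm_shift (b x y c : ℝ) (g : ℝ → ℝ) :
    luxNorm b (Icc x y) (fun r => g (r + c)) = luxNorm b (Icc (x + c) (y + c)) g := by
  unfold luxNorm
  have key : ∀ l : ℝ, ∫⁻ r in Icc x y, ENNReal.ofReal (youngPhi b (|g (r + c)| / l)) =
      ∫⁻ r in Icc (x + c) (y + c), ENNReal.ofReal (youngPhi b (|g r| / l)) := by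
    intro l
    have h := (measurePreserving_add_right (volume : Measure ℝ) c).setLIntegral_comp_preimage_emb
      (measurableEmbedding_addRight c) (fun r => ENNReal.ofReal (youngPhi b (|g r| / l)))
      (Icc (x + c) (y + c))
    rw [← h]
    congr 2
    ext r
    simp
  simp only [key]

lemma luxNorm_shift_le {b x y c x' y' : ℝ} {g : ℝ → ℝ} (hb : 0 < b) (h1 : x' ≤ x + c)
    (h2 : y + c ≤ y') :
    luxNorm b (Icc x y) (fun r => g (r + c)) ≤ luxNorm b (Icc x' y') g := by
  rw [luxNorm_shift]
  exact luxNorm_mono hb (Icc_subset_Icc h1 h2) (ae_of_all _ fun r => le_rfl)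

/-- Hölder's inequality for exponential Orlicz spaces. Since b/b₁ + b/b₂ = 1, the power (uv)^b is a
weighted geometric mean of u^{b₁} and v^{b₂}, hence at most their maximum, and the exponential of a
maximum is at most the sum of the exponentials. Dividing by C through `youngPhi_div_le` absorbs the
additive constants. -/
lemma exists_luxNorm_mul_le {b b₁ b₂ : ℝ} (h₁ : 0 < b₁) (h₂ : 0 < b₂) (hb : 0 < b)
    (hbb : 1 / b = 1 / b₁ + 1 / b₂) {T : ℝ} (hT : 0 ≤ T) :
    ∃ C : ℝ, 0 < C ∧ ∀ (D : Set ℝ), D ⊆ Icc 0 T → ∀ (F f g : ℝ → ℝ) (x y : ℝ), 0 ≤ x → 0 ≤ y →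
      AEMeasurable f (volume.restrict D) →
      (∀ᵐ r ∂volume.restrict D, |F r| ≤ |f r| * |g r|) →
      luxNorm b₁ D f ≤ ENNReal.ofReal x → luxNorm b₂ D g ≤ ENNReal.ofReal y →
      luxNorm b D F ≤ ENNReal.ofReal (C * (x * y)) := by
  obtain ⟨K, hK0, hK⟩ := exists_abs_youngPhi_sub_exp_le hb
  obtain ⟨K₁, hK₁0, hK₁⟩ := exists_abs_youngPhi_sub_exp_le h₁
  obtain ⟨K₂, hK₂0, hK₂⟩ := exists_abs_youngPhi_sub_exp_le h₂
  have key : ∀ u v : ℝ, 0 ≤ u → 0 ≤ v →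
      youngPhi b (u * v) ≤ youngPhi b₁ u + (youngPhi b₂ v + (K + K₁ + K₂)) := by
    intro u v hu hv
    have e1 : (u * v) ^ b = (u ^ b₁) ^ (b / b₁) * (v ^ b₂) ^ (b / b₂) := by
      rw [← Real.rpow_mul hu, ← Real.rpow_mul hv, mul_div_cancel₀ _ h₁.ne',
        mul_div_cancel₀ _ h₂.ne', Real.mul_rpow hu hv]
    have hw : b / b₁ + b / b₂ = 1 := by
      have : b / b₁ + b / b₂ = b * (1 / b₁ + 1 / b₂) := by ring
      rw [this, ← hbb]
      field_simp
    have hw1 : 0 ≤ b / b₁ := by positivity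
    have hw2 : 0 ≤ b / b₂ := by positivity
    have h1 := Real.geom_mean_le_arith_mean2_weighted hw1 hw2
      (Real.rpow_nonneg hu b₁) (Real.rpow_nonneg hv b₂) hw
    have h3 : (u * v) ^ b ≤ max (u ^ b₁) (v ^ b₂) := by
      rw [e1]
      refine h1.trans ?_
      calc b / b₁ * u ^ b₁ + b / b₂ * v ^ b₂
          ≤ b / b₁ * max (u ^ b₁) (v ^ b₂) + b / b₂ * max (u ^ b₁) (v ^ b₂) := by
            gcongr
            · exact le_max_left _ _
            · exact le_max_right _ _
        _ = _ := by rw [← add_mul, hw, one_mul]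
    have h4 : Real.exp ((u * v) ^ b) ≤ Real.exp (u ^ b₁) + Real.exp (v ^ b₂) := by
      refine (Real.exp_le_exp.2 h3).trans ?_
      have := Real.exp_pos (u ^ b₁)
      have := Real.exp_pos (v ^ b₂)
      rcases max_cases (u ^ b₁) (v ^ b₂) with ⟨h, -⟩ | ⟨h, -⟩ <;> rw [h] <;> linarith
    have := (abs_le.1 (hK _ (mul_nonneg hu hv))).2
    have := (abs_le.1 (hK₁ _ hu)).1
    have := (abs_le.1 (hK₂ _ hv)).1
    linarith
  set C := 2 + (K + K₁ + K₂) * T with hC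
  have hC1 : 1 ≤ C := by
    have : 0 ≤ (K + K₁ + K₂) * T := by positivity
    linarith
  have hC0 : 0 < C := by linarith
  refine ⟨C, hC0, fun D hD F f g x y hx hy hf hF hfx hgy => ?_⟩
  have main : ∀ ε : ℝ, 0 < ε → luxNorm b D F ≤ ENNReal.ofReal (C * ((x + ε) * (y + ε))) := by
    intro ε hε
    have hx0 : 0 < x + ε := by linarith
    have hy0 : 0 < y + ε := by linarith
    have i1 : ∫⁻ r in D, ENNReal.ofReal (youngPhi b₁ (|f r| / (x + ε))) ≤ 1 :=
      lintegral_youngPhi_le_one h₁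
        (hfx.trans_lt ((ENNReal.ofReal_lt_ofReal_iff hx0).2 (by linarith)))
    have i2 : ∫⁻ r in D, ENNReal.ofReal (youngPhi b₂ (|g r| / (y + ε))) ≤ 1 :=
      lintegral_youngPhi_le_one h₂
        (hgy.trans_lt ((ENNReal.ofReal_lt_ofReal_iff hy0).2 (by linarith)))
    refine luxNorm_le_ofReal (by positivity) ?_
    calc ∫⁻ r in D, ENNReal.ofReal (youngPhi b (|F r| / (C * ((x + ε) * (y + ε)))))
        ≤ ∫⁻ r in D, ENNReal.ofReal C⁻¹ * (ENNReal.ofReal (youngPhi b₁ (|f r| / (x + ε))) +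
            (ENNReal.ofReal (youngPhi b₂ (|g r| / (y + ε))) +
              ENNReal.ofReal (K + K₁ + K₂))) := by
          refine lintegral_mono_ae (hF.mono fun r hr => ?_)
          have p1 : 0 ≤ |f r| / (x + ε) := by positivity
          have p2 : 0 ≤ |g r| / (y + ε) := by positivity
          have q1 := youngPhi_nonneg h₁ p1
          have q2 := youngPhi_nonneg h₂ p2
          rw [← ENNReal.ofReal_add q2 (by positivity), ← ENNReal.ofReal_add q1 (by positivity),
            ← ENNReal.ofReal_mul (by positivity)]
          refine ENNReal.ofReal_le_ofReal ?_
          calc youngPhi b (|F r| / (C * ((x + ε) * (y + ε))))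
              ≤ youngPhi b (|f r| / (x + ε) * (|g r| / (y + ε)) / C) := by
                refine monotoneOn_youngPhi hb (mem_Ici.2 (by positivity))
                  (mem_Ici.2 (by positivity)) ?_
                have e : |f r| / (x + ε) * (|g r| / (y + ε)) / C =
                    |f r| * |g r| / (C * ((x + ε) * (y + ε))) := by field_simp
                rw [e]
                exact div_le_div_of_nonneg_right hr (by positivity)
            _ ≤ youngPhi b (|f r| / (x + ε) * (|g r| / (y + ε))) / C :=
                youngPhi_div_le hb (by positivity) hC1
            _ = C⁻¹ * youngPhi b (|f r| / (x + ε) * (|g r| / (y + ε))) := by ring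
            _ ≤ _ := by
                refine mul_le_mul_of_nonneg_left (key _ _ p1 p2) (by positivity)
      _ = ENNReal.ofReal C⁻¹ * ((∫⁻ r in D, ENNReal.ofReal (youngPhi b₁ (|f r| / (x + ε)))) +
            ((∫⁻ r in D, ENNReal.ofReal (youngPhi b₂ (|g r| / (y + ε)))) +
              ENNReal.ofReal (K + K₁ + K₂) * volume D)) := by
          rw [lintegral_const_mul' _ _ ENNReal.ofReal_ne_top,
            lintegral_add_left' (aemeasurable_youngPhi hf),
            lintegral_add_right _ measurable_const, lintegral_const, Measure.restrict_apply_univ]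
      _ ≤ ENNReal.ofReal C⁻¹ * (1 + (1 + ENNReal.ofReal (K + K₁ + K₂) * ENNReal.ofReal T)) := by
          gcongr
          calc volume D ≤ volume (Icc 0 T) := measure_mono hD
            _ = ENNReal.ofReal T := by rw [Real.volume_Icc, sub_zero]
      _ = 1 := by
          rw [← ENNReal.ofReal_mul (by positivity), ← ENNReal.ofReal_one,
            ← ENNReal.ofReal_add (by positivity) (by positivity),
            ← ENNReal.ofReal_add (by positivity) (by positivity),
            ← ENNReal.ofReal_mul (by positivity)]
          congr 1
          rw [hC]
          have : (2 + (K + K₁ + K₂) * T) ≠ 0 := by rw [← hC]; exact hC0.ne'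
          field_simp
          ring
  have ht : Tendsto (fun ε => ENNReal.ofReal (C * ((x + ε) * (y + ε)))) (𝓝[>] 0)
      (𝓝 (ENNReal.ofReal (C * ((x + 0) * (y + 0))))) := by
    refine Tendsto.mono_left ?_ nhdsWithin_le_nhds
    have : Continuous fun ε : ℝ => ENNReal.ofReal (C * ((x + ε) * (y + ε))) := by
      refine ENNReal.continuous_ofReal.comp ?_
      fun_prop
    exact this.tendsto 0
  simp only [add_zero] at ht
  exact ge_of_tendsto ht (eventually_nhdsWithin_of_forall fun ε hε => main ε hε)

/-- Moments of every order are controlled. Hence the loss of Hölder exponent in the chaining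
argument, which is of order 1/p, can be made as small as desired. -/
lemma exists_lintegral_pow_le {b : ℝ} (hb : 0 < b) {T : ℝ} (hT : 0 ≤ T) (p : ℕ) :
    ∃ C : ℝ, 0 < C ∧ ∀ (D : Set ℝ), D ⊆ Icc 0 T → ∀ (g : ℝ → ℝ) (l : ℝ), 0 < l →
      luxNorm b D g < ENNReal.ofReal l →
      ∫⁻ r in D, ENNReal.ofReal (|g r| ^ p) ≤ ENNReal.ofReal (C * l ^ p) := by
  obtain ⟨C, hC, h⟩ := exists_pow_le_youngPhi hb p
  refine ⟨C * (T + 1), by positivity, fun D hD g l hl hlux => ?_⟩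
  have h1 := lintegral_youngPhi_le_one hb hlux
  calc ∫⁻ r in D, ENNReal.ofReal (|g r| ^ p)
      ≤ ∫⁻ r in D, ENNReal.ofReal (l ^ p * C) *
          (1 + ENNReal.ofReal (youngPhi b (|g r| / l))) := by
        refine lintegral_mono fun r => ?_
        have hp : 0 ≤ |g r| / l := by positivity
        have h2 := youngPhi_nonneg hb hp
        rw [← ENNReal.ofReal_one, ← ENNReal.ofReal_add zero_le_one h2,
          ← ENNReal.ofReal_mul (by positivity)]
        refine ENNReal.ofReal_le_ofReal ?_
        have h3 := h _ hp
        rw [div_pow, div_le_iff₀ (by positivity)] at h3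
        linarith
    _ = ENNReal.ofReal (l ^ p * C) *
          (volume D + ∫⁻ r in D, ENNReal.ofReal (youngPhi b (|g r| / l))) := by
        rw [lintegral_const_mul' _ _ ENNReal.ofReal_ne_top, lintegral_add_left measurable_const,
          lintegral_const, Measure.restrict_apply_univ, one_mul]
    _ ≤ ENNReal.ofReal (l ^ p * C) * (ENNReal.ofReal T + ENNReal.ofReal 1) := by
        rw [ENNReal.ofReal_one]
        gcongr
        calc volume D ≤ volume (Icc 0 T) := measure_mono hD
          _ = ENNReal.ofReal T := by rw [Real.volume_Icc, sub_zero]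
    _ = _ := by
        rw [← ENNReal.ofReal_add hT zero_le_one, ← ENNReal.ofReal_mul (by positivity)]
        congr 1
        ring

/-! ### Weighted `L^q(dτ/τ)` spaces of moduli -/

lemma ae_logMeasure (T : ℝ) : ∀ᵐ τ ∂logMeasure T, τ ∈ Ioc 0 T :=
  (withDensity_absolutelyContinuous _ _).ae_le (ae_restrict_mem measurableSet_Ioc)

/-- The modulus `w` satisfies `‖w(τ)/τ^a‖_{L^q(dτ/τ)} < ∞`. -/
def LogMem (T a : ℝ) (q : ℝ≥0∞) (w : ℝ → ℝ≥0∞) : Prop :=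
  eLpNorm (fun τ => w τ / ENNReal.ofReal (τ ^ a)) q (logMeasure T) < ∞

lemma measurable_div_ofReal_rpow {w : ℝ → ℝ≥0∞} (hw : Measurable w) (a : ℝ) :
    Measurable fun τ : ℝ => w τ / ENNReal.ofReal (τ ^ a) :=
  hw.div (by fun_prop)

lemma LogMem.mono {T a : ℝ} {q : ℝ≥0∞} {w w' : ℝ → ℝ≥0∞} (hw : LogMem T a q w)
    (h : ∀ τ ∈ Ioc 0 T, w' τ ≤ w τ) : LogMem T a q w' := by
  refine lt_of_le_of_lt (eLpNorm_mono_enorm_ae ?_) hw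
  filter_upwards [ae_logMeasure T] with τ hτ
  simp only [enorm_eq_self]
  exact ENNReal.div_le_div_right (h τ hτ) _

lemma LogMem.add {T a : ℝ} {q : ℝ≥0∞} {w w' : ℝ → ℝ≥0∞} (hw : LogMem T a q w)
    (hw' : LogMem T a q w') (hm : Measurable w) (hm' : Measurable w') :
    LogMem T a q fun τ => w τ + w' τ := by
  have h := eLpNorm_add_le' (μ := logMeasure T)
    (measurable_div_ofReal_rpow hm a).aestronglyMeasurable
    (measurable_div_ofReal_rpow hm' a).aestronglyMeasurable q
  have e : (fun τ => (w τ + w' τ) / ENNReal.ofReal (τ ^ a)) =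
      (fun τ => w τ / ENNReal.ofReal (τ ^ a)) + fun τ => w' τ / ENNReal.ofReal (τ ^ a) := by
    ext τ
    simp [ENNReal.add_div]
  unfold LogMem
  rw [e]
  exact h.trans_lt (ENNReal.mul_lt_top (ENNReal.LpAddConst_lt_top q) (ENNReal.add_lt_top.2 ⟨hw, hw'⟩))

lemma LogMem.const_mul {T a : ℝ} {q : ℝ≥0∞} {w : ℝ → ℝ≥0∞} (hw : LogMem T a q w)
    (hm : Measurable w) {C : ℝ≥0∞} (hC : C ≠ ∞) : LogMem T a q fun τ => C * w τ := by
  have h := eLpNorm_le_mul_eLpNorm_of_ae_le_mul'' (μ := logMeasure T)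
    (f := fun τ => C * w τ / ENNReal.ofReal (τ ^ a)) (c := C) q
    (measurable_div_ofReal_rpow hm a).aestronglyMeasurable
    (ae_of_all _ fun τ => by simp [mul_div_assoc])
  exact h.trans_lt (ENNReal.mul_lt_top hC.lt_top hw)

lemma LogMem.rpow {T a k : ℝ} {q : ℝ≥0∞} {w : ℝ → ℝ≥0∞} (hw : LogMem T a q w) (hk : 0 < k) :
    LogMem T (k * a) (q / ENNReal.ofReal k) fun τ => w τ ^ k := by
  have h := eLpNorm_enorm_rpow (μ := logMeasure T) (p := q / ENNReal.ofReal k)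
    (fun τ => w τ / ENNReal.ofReal (τ ^ a)) hk
  rw [ENNReal.div_mul_cancel (by simpa using hk) ENNReal.ofReal_ne_top] at h
  unfold LogMem
  have e : eLpNorm (fun τ => w τ ^ k / ENNReal.ofReal (τ ^ (k * a))) (q / ENNReal.ofReal k)
      (logMeasure T) = eLpNorm (fun τ => ‖w τ / ENNReal.ofReal (τ ^ a)‖ₑ ^ k)
        (q / ENNReal.ofReal k) (logMeasure T) := by
    refine eLpNorm_congr_ae ?_
    filter_upwards [ae_logMeasure T] with τ hτ
    rw [enorm_eq_self, ENNReal.div_rpow_of_nonneg _ _ hk.le,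
      ENNReal.ofReal_rpow_of_nonneg (Real.rpow_nonneg hτ.1.le a) hk.le, ← Real.rpow_mul hτ.1.le,
      mul_comm k a]
  rw [e, h]
  exact ENNReal.rpow_lt_top_of_nonneg hk.le hw.ne

/-- With x = w^{1/2} one has w w' = x² w' ≤ (x + w')³, so the product is handled by sums and powers
only. This covers small and infinite q without Hölder's inequality. -/
lemma LogMem.mul {T a : ℝ} {q : ℝ≥0∞} {w w' : ℝ → ℝ≥0∞} (hw : LogMem T (2 * a) (q / 2) w)
    (hw' : LogMem T a q w') (hm : Measurable w) (hm' : Measurable w') :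
    LogMem T (3 * a) (q / 3) fun τ => w τ * w' τ := by
  have h1 := hw.rpow (k := 1 / 2) (by norm_num)
  have e1 : (1 / 2 : ℝ) * (2 * a) = a := by ring
  have e2 : q / 2 / ENNReal.ofReal (1 / 2) = q := by
    rw [one_div, ENNReal.ofReal_inv_of_pos two_pos, ENNReal.ofReal_ofNat, div_eq_mul_inv, inv_inv,
      ENNReal.div_mul_cancel two_ne_zero ENNReal.ofNat_ne_top]
  rw [e1, e2] at h1
  have h2 := (h1.add hw' (hm.pow_const _) hm').rpow (k := 3) (by norm_num)
  rw [ENNReal.ofReal_ofNat] at h2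
  refine h2.mono fun τ _ => ?_
  set x := w τ ^ (1 / 2 : ℝ) with hx
  have hxw : w τ = x * x := by
    rw [hx, ← ENNReal.rpow_add_of_nonneg _ _ (by norm_num) (by norm_num)]
    norm_num
  have e3 : (x + w' τ) ^ (3 : ℝ) = (x + w' τ) * (x + w' τ) * (x + w' τ) := by
    rw [show (3 : ℝ) = ((3 : ℕ) : ℝ) by norm_num, ENNReal.rpow_natCast]
    ring
  simp only [e3, hxw]
  gcongr
  · exact le_self_add
  · exact le_self_add
  · exact le_add_self

lemma logMem_sq {T a : ℝ} {q : ℝ≥0∞} {w : ℝ → ℝ≥0∞} (hw : LogMem T a q w) :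
    LogMem T (2 * a) (q / 2) fun τ => w τ * w τ := by
  have h := hw.rpow (k := 2) (by norm_num)
  rw [ENNReal.ofReal_ofNat] at h
  refine h.mono fun τ _ => ?_
  rw [ENNReal.rpow_two, sq]

lemma lintegral_logMeasure (T : ℝ) (f : ℝ → ℝ≥0∞) :
    ∫⁻ τ, f τ ∂logMeasure T = ∫⁻ τ in Ioc 0 T, ENNReal.ofReal τ⁻¹ * f τ := by
  unfold logMeasure
  rw [lintegral_withDensity_eq_lintegral_mul_non_measurable _ (by fun_prop)
    (ae_of_all _ fun _ => ENNReal.ofReal_lt_top)]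
  rfl

/-- Powers above the critical exponent a belong to the space for every third index, so errors of
higher Hölder order may be discarded. -/
lemma logMem_rpow {T a κ : ℝ} {q : ℝ≥0∞} (hq : q ≠ 0) (h : a < κ) (hT : 0 ≤ T) :
    LogMem T a q fun τ => ENNReal.ofReal (τ ^ κ) := by
  have e : ∀ τ ∈ Ioc 0 T, ENNReal.ofReal (τ ^ κ) / ENNReal.ofReal (τ ^ a) =
      ENNReal.ofReal (τ ^ (κ - a)) := fun τ hτ => by
    rw [← ENNReal.ofReal_div_of_pos (Real.rpow_pos_of_pos hτ.1 a), ← Real.rpow_sub hτ.1]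
  unfold LogMem
  by_cases hqt : q = ∞
  · subst hqt
    rw [eLpNorm_exponent_top]
    refine lt_of_le_of_lt (eLpNormEssSup_le_of_ae_enorm_bound
      (C := ENNReal.ofReal (T ^ (κ - a))) ?_) ENNReal.ofReal_lt_top
    filter_upwards [ae_logMeasure T] with τ hτ
    rw [enorm_eq_self, e τ hτ]
    exact ENNReal.ofReal_le_ofReal (Real.rpow_le_rpow hτ.1.le hτ.2 (by linarith))
  · have hq0 : 0 < q.toReal := ENNReal.toReal_pos hq hqt
    rw [eLpNorm_lt_top_iff_lintegral_rpow_enorm_lt_top hq hqt, lintegral_logMeasure]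
    have hint : IntegrableOn (fun τ : ℝ => τ ^ ((κ - a) * q.toReal - 1)) (Ioc 0 T) := by
      have : 0 < (κ - a) * q.toReal := mul_pos (by linarith) hq0
      exact (intervalIntegrable_iff_integrableOn_Ioc_of_le hT).1
        (intervalIntegral.intervalIntegrable_rpow' (by linarith))
    refine lt_of_le_of_lt (le_of_eq ?_) hint.lintegral_lt_top
    refine setLIntegral_congr_fun measurableSet_Ioc fun τ hτ => ?_
    simp only [enorm_eq_self]
    rw [e τ hτ, ENNReal.ofReal_rpow_of_nonneg (Real.rpow_nonneg hτ.1.le _) hq0.le,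
      ← ENNReal.ofReal_mul (inv_nonneg.2 hτ.1.le), ← Real.rpow_mul hτ.1.le,
      Real.rpow_sub_one hτ.1.ne']
    congr 1
    ring

/-- The measure dτ/τ is invariant under dilations, and τ ↦ cτ carries (0, T] to (0, cT] ⊆ (0, T]. -/
lemma map_mul_logMeasure_le {T c : ℝ} (hc : 0 < c) (hc1 : c ≤ 1) (hT : 0 ≤ T) :
    (logMeasure T).map (fun τ => c * τ) ≤ logMeasure T := by
  refine Measure.le_iff.2 fun s hs => ?_
  have hm : Measurable fun τ : ℝ => c * τ := measurable_const_mul c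
  rw [Measure.map_apply hm hs]
  have e : ∀ s : Set ℝ, MeasurableSet s →
      logMeasure T s = ∫⁻ τ, (Ioc 0 T).indicator
        (fun τ => s.indicator (fun τ => ENNReal.ofReal τ⁻¹) τ) τ := by
    intro s hs
    rw [lintegral_indicator measurableSet_Ioc, ← lintegral_indicator_one hs,
      lintegral_logMeasure]
    refine lintegral_congr fun τ => ?_
    by_cases h : τ ∈ s <;> simp [h]
  rw [e _ (hm hs), e s hs]
  set g : ℝ → ℝ≥0∞ := (Ioc 0 T).indicator
        (fun τ => s.indicator (fun τ => ENNReal.ofReal τ⁻¹) τ) with hg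
  have hgm : Measurable g := by
    refine Measurable.indicator (Measurable.indicator ?_ hs) measurableSet_Ioc
    fun_prop
  have h1 : ∫⁻ τ, g (c * τ) = ENNReal.ofReal c⁻¹ * ∫⁻ τ, g τ := by
    rw [← lintegral_map (f := g) hgm hm, Real.map_volume_mul_left hc.ne', lintegral_smul_measure,
      abs_of_pos (inv_pos.2 hc), smul_eq_mul]
  have h2 : ∫⁻ τ, g τ = ENNReal.ofReal c * ∫⁻ τ, g (c * τ) := by
    rw [h1, ← mul_assoc, ← ENNReal.ofReal_mul hc.le, mul_inv_cancel₀ hc.ne', ENNReal.ofReal_one,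
      one_mul]
  rw [h2, ← lintegral_const_mul' _ _ ENNReal.ofReal_ne_top]
  have key : ∀ τ, (Ioc 0 (T / c)).indicator (fun τ => ((fun τ => c * τ) ⁻¹' s).indicator
      (fun τ => ENNReal.ofReal τ⁻¹) τ) τ = ENNReal.ofReal c * g (c * τ) := by
    intro τ
    have i1 : (c * τ ∈ Ioc 0 T) ↔ τ ∈ Ioc 0 (T / c) := by
      simp only [mem_Ioc, le_div_iff₀ hc, mul_comm τ c, mul_pos_iff_of_pos_left hc]
    by_cases h3 : τ ∈ Ioc 0 (T / c)
    · by_cases h4 : c * τ ∈ s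
      · rw [hg, indicator_of_mem h3, indicator_of_mem (show τ ∈ (fun τ => c * τ) ⁻¹' s from h4),
          indicator_of_mem (i1.2 h3), indicator_of_mem h4, ← ENNReal.ofReal_mul hc.le]
        congr 1
        field_simp
      · rw [hg, indicator_of_mem h3, indicator_of_notMem (show τ ∉ (fun τ => c * τ) ⁻¹' s from h4),
          indicator_of_mem (i1.2 h3), indicator_of_notMem h4, mul_zero]
    · rw [hg, indicator_of_notMem h3, indicator_of_notMem (fun h => h3 (i1.1 h)), mul_zero]
  simp_rw [← key]
  refine lintegral_mono fun τ => ?_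
  refine indicator_le_indicator_of_subset (Ioc_subset_Ioc_right ?_) (fun _ => zero_le) τ
  rw [le_div_iff₀ hc]
  nlinarith

lemma eLpNorm_comp_mul_le {T c : ℝ} (hc : 0 < c) (hc1 : c ≤ 1) (hT : 0 ≤ T) {g : ℝ → ℝ≥0∞}
    (hg : Measurable g) (q : ℝ≥0∞) :
    eLpNorm (fun τ => g (c * τ)) q (logMeasure T) ≤ eLpNorm g q (logMeasure T) := by
  have h := eLpNorm_map_measure (p := q) (μ := logMeasure T) (f := fun τ => c * τ) (g := g)
    hg.aestronglyMeasurable (measurable_const_mul c).aemeasurable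
  have h2 : (g ∘ fun τ => c * τ) = fun τ => g (c * τ) := rfl
  rw [← h2, ← h]
  exact eLpNorm_mono_measure _ (map_mul_logMeasure_le hc hc1 hT)

lemma comp_mul_div_ofReal_rpow (w : ℝ → ℝ≥0∞) {a c τ : ℝ} (hc : 0 < c) (hτ : 0 < τ) :
    w (c * τ) / ENNReal.ofReal (τ ^ a) =
      ENNReal.ofReal (c ^ a) * (w (c * τ) / ENNReal.ofReal ((c * τ) ^ a)) := by
  have h1 := Real.rpow_pos_of_pos hc a
  have h2 := Real.rpow_pos_of_pos hτ a
  rw [Real.mul_rpow hc.le hτ.le, ENNReal.ofReal_mul h1.le, div_eq_mul_inv, div_eq_mul_inv,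
    ENNReal.mul_inv (Or.inr ENNReal.ofReal_ne_top) (Or.inl ENNReal.ofReal_ne_top)]
  have h3 : ENNReal.ofReal (c ^ a) * (ENNReal.ofReal (c ^ a))⁻¹ = 1 :=
    ENNReal.mul_inv_cancel (by simpa using h1) ENNReal.ofReal_ne_top
  calc w (c * τ) * (ENNReal.ofReal (τ ^ a))⁻¹
      = (ENNReal.ofReal (c ^ a) * (ENNReal.ofReal (c ^ a))⁻¹) *
          (w (c * τ) * (ENNReal.ofReal (τ ^ a))⁻¹) := by rw [h3, one_mul]
    _ = _ := by ring

/-- For q < 1 there is no triangle inequality. Half of the geometric decay, θ = σ², is spent on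
bounding the series by S · sup_k σ^k ρ_k, and the other half on bounding the p-th power of the
supremum by the sum of the p-th powers. -/
lemma eLpNorm_tsum_geometric_lt_top {X : Type*} [MeasurableSpace X] {μ : Measure X} {q : ℝ≥0∞}
    (hq : q ≠ 0) {ρ : ℕ → X → ℝ≥0∞} (hρ : ∀ k, Measurable (ρ k)) {M : ℝ≥0∞} (hM : M ≠ ∞)
    (h : ∀ k, eLpNorm (ρ k) q μ ≤ M) {θ : ℝ≥0∞} (hθ : θ < 1) :
    eLpNorm (fun x => ∑' k, θ ^ k * ρ k x) q μ < ∞ := by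
  have hgeo : ∀ σ : ℝ≥0∞, σ < 1 → (∑' k : ℕ, σ ^ k) < ∞ := fun σ hσ => by
    rw [ENNReal.tsum_geometric]
    exact ENNReal.inv_lt_top.2 (tsub_pos_of_lt hσ)
  by_cases hqt : q = ∞
  · subst hqt
    simp only [eLpNorm_exponent_top] at h ⊢
    have h1 : ∀ᵐ x ∂μ, ∀ k, ρ k x ≤ M := ae_all_iff.2 fun k => by
      filter_upwards [ae_le_eLpNormEssSup (f := ρ k) (μ := μ)] with x hx
      rw [enorm_eq_self] at hx
      exact hx.trans (h k)
    refine lt_of_le_of_lt (eLpNormEssSup_le_of_ae_enorm_bound (C := (∑' k, θ ^ k) * M) ?_)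
      (ENNReal.mul_lt_top (hgeo θ hθ) hM.lt_top)
    filter_upwards [h1] with x hx
    rw [enorm_eq_self, ← ENNReal.tsum_mul_right]
    exact ENNReal.tsum_le_tsum fun k => by gcongr; exact hx k
  · have hq0 : 0 < q.toReal := ENNReal.toReal_pos hq hqt
    set p := q.toReal with hp
    set σ := θ ^ (1 / 2 : ℝ) with hσdef
    have hσ : σ < 1 := ENNReal.rpow_lt_one hθ (by norm_num)
    have hσσ : θ = σ * σ := by
      rw [hσdef, ← ENNReal.rpow_add_of_nonneg _ _ (by norm_num) (by norm_num)]
      norm_num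
    set S := ∑' k : ℕ, σ ^ k with hS
    have hSt : S < ∞ := hgeo σ hσ
    rw [eLpNorm_lt_top_iff_lintegral_rpow_enorm_lt_top hq hqt]
    have pw : ∀ x, ‖∑' k, θ ^ k * ρ k x‖ₑ ^ p ≤ S ^ p * ∑' k, (σ ^ p) ^ k * ρ k x ^ p := by
      intro x
      rw [enorm_eq_self]
      have h1 : ∑' k, θ ^ k * ρ k x ≤ S * ⨆ k, σ ^ k * ρ k x := by
        rw [hS, ← ENNReal.tsum_mul_right]
        refine ENNReal.tsum_le_tsum fun k => ?_
        rw [hσσ, mul_pow, mul_assoc]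
        gcongr
        exact le_iSup (fun k => σ ^ k * ρ k x) k
      calc (∑' k, θ ^ k * ρ k x) ^ p ≤ (S * ⨆ k, σ ^ k * ρ k x) ^ p :=
            ENNReal.rpow_le_rpow h1 hq0.le
        _ = S ^ p * (⨆ k, σ ^ k * ρ k x) ^ p := ENNReal.mul_rpow_of_nonneg _ _ hq0.le
        _ ≤ _ := by
            gcongr
            have h2 := (ENNReal.orderIsoRpow p hq0).map_iSup fun k => σ ^ k * ρ k x
            simp only [ENNReal.orderIsoRpow_apply] at h2
            rw [h2]
            refine iSup_le fun k => ?_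
            have h3 : (σ ^ k * ρ k x) ^ p = (σ ^ p) ^ k * ρ k x ^ p := by
              clear_value σ
              rw [ENNReal.mul_rpow_of_nonneg _ _ hq0.le, ← ENNReal.rpow_natCast σ k,
                ← ENNReal.rpow_natCast (σ ^ p) k, ← ENNReal.rpow_mul, ← ENNReal.rpow_mul,
                mul_comm (k : ℝ)]
            rw [h3]
            exact ENNReal.le_tsum k
    refine lt_of_le_of_lt (lintegral_mono pw) ?_
    rw [lintegral_const_mul' _ _ (ENNReal.rpow_ne_top_of_nonneg hq0.le hSt.ne),
      lintegral_tsum fun k => (((hρ k).pow_const p).const_mul _).aemeasurable]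
    refine ENNReal.mul_lt_top (ENNReal.rpow_lt_top_of_nonneg hq0.le hSt.ne) ?_
    have h4 : ∀ k, ∫⁻ x, (σ ^ p) ^ k * ρ k x ^ p ∂μ ≤ (σ ^ p) ^ k * M ^ p := by
      intro k
      rw [lintegral_const_mul _ ((hρ k).pow_const p)]
      gcongr
      have h5 := h k
      rw [eLpNorm_eq_lintegral_rpow_enorm_toReal hq hqt, one_div, ENNReal.rpow_inv_le_iff hq0] at h5
      simpa only [enorm_eq_self] using h5
    refine lt_of_le_of_lt (ENNReal.tsum_le_tsum h4) ?_
    rw [ENNReal.tsum_mul_right]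
    exact ENNReal.mul_lt_top (hgeo _ (ENNReal.rpow_lt_one hσ hq0))
      (ENNReal.rpow_lt_top_of_nonneg hq0.le hM)

/-- The series that arises from sewing along dyadic partitions. -/
lemma LogMem.tsum_dyadic {T a : ℝ} {q : ℝ≥0∞} {w : ℝ → ℝ≥0∞} (hT : 0 ≤ T) (ha : 1 < a)
    (hq : q ≠ 0) (hm : Measurable w) (hw : LogMem T a q w) :
    LogMem T a q fun τ => ∑' k : ℕ, 2 ^ k * w ((1 / 2) ^ (k + 1) * τ) := by
  set ρ : ℝ → ℝ≥0∞ := fun τ => w τ / ENNReal.ofReal (τ ^ a) with hρdef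
  have hρ : Measurable ρ := measurable_div_ofReal_rpow hm a
  have hc : ∀ k : ℕ, (0 : ℝ) < (1 / 2) ^ (k + 1) := fun k => by positivity
  have h1 := eLpNorm_tsum_geometric_lt_top (μ := logMeasure T) hq
    (ρ := fun k τ => ρ ((1 / 2) ^ (k + 1) * τ)) (fun k => hρ.comp (measurable_const_mul _))
    (M := eLpNorm ρ q (logMeasure T)) hw.ne
    (fun k => eLpNorm_comp_mul_le (hc k) (pow_le_one₀ (by norm_num) (by norm_num)) hT hρ q)
    -- Each level doubles the number of intervals and gains 2^{-a} by rescaling. The ratio is below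
    -- 1 because a > 1.
    (θ := ENNReal.ofReal (2 * (1 / 2) ^ a))
    (by
      rw [← ENNReal.ofReal_one]
      refine (ENNReal.ofReal_lt_ofReal_iff one_pos).2 ?_
      have : (1 / 2 : ℝ) ^ a < (1 / 2) ^ (1 : ℝ) :=
        Real.rpow_lt_rpow_of_exponent_gt (by norm_num) (by norm_num) ha
      rw [Real.rpow_one] at this
      linarith)
  have h2 := eLpNorm_le_mul_eLpNorm_of_ae_le_mul'' (μ := logMeasure T)
    (f := fun τ => (∑' k : ℕ, 2 ^ k * w ((1 / 2) ^ (k + 1) * τ)) / ENNReal.ofReal (τ ^ a))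
    (c := ENNReal.ofReal ((1 / 2) ^ a)) q
    (g := fun τ => ∑' k, ENNReal.ofReal (2 * (1 / 2) ^ a) ^ k * ρ ((1 / 2) ^ (k + 1) * τ))
    (Measurable.aestronglyMeasurable (by fun_prop)) ?_
  · exact h2.trans_lt (ENNReal.mul_lt_top ENNReal.ofReal_lt_top h1)
  filter_upwards [ae_logMeasure T] with τ hτ
  simp only [enorm_eq_self]
  rw [div_eq_mul_inv, ← ENNReal.tsum_mul_right, ← ENNReal.tsum_mul_left]
  refine ENNReal.tsum_le_tsum fun k => le_of_eq ?_
  rw [mul_assoc, ← div_eq_mul_inv, comp_mul_div_ofReal_rpow w (hc k) hτ.1, ← mul_assoc, ← mul_assoc]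
  congr 1
  have h3 : (0 : ℝ) ≤ (1 / 2) ^ a := by positivity
  rw [← ENNReal.ofReal_pow (by positivity), ← ENNReal.ofReal_mul h3,
    show (2 : ℝ≥0∞) ^ k = ENNReal.ofReal (2 ^ k) by
      rw [ENNReal.ofReal_pow (by norm_num), ENNReal.ofReal_ofNat],
    ← ENNReal.ofReal_mul (by positivity)]
  congr 1
  rw [mul_pow, ← Real.rpow_natCast (1 / 2 : ℝ) (k + 1), ← Real.rpow_mul (by norm_num),
    mul_comm ((k + 1 : ℕ) : ℝ) a, Real.rpow_mul (by norm_num), Real.rpow_natCast]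
  ring

/-- By monotonicity the quotient w(σ)/σ^a is at least w(τ)/(2τ)^a on (τ, 2τ], a set of dσ/σ-measure
at least 1/2 that lies in (0, T] when τ ≤ T/2. -/
lemma LogMem.sup_bound {T a : ℝ} {q : ℝ≥0∞} {w : ℝ → ℝ≥0∞} (ha : 0 ≤ a) (hq : q ≠ 0)
    (hmono : Monotone w) (hw : LogMem T a q w) :
    ∃ K : ℝ, 0 < K ∧ ∀ τ, 0 < τ → τ ≤ T / 2 → w τ ≤ ENNReal.ofReal (K * τ ^ a) := by
  set N := eLpNorm (fun τ => w τ / ENNReal.ofReal (τ ^ a)) q (logMeasure T) with hN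
  have hNt : N ≠ ∞ := hw.ne
  have key : ∀ τ, 0 < τ → τ ≤ T / 2 → w τ / ENNReal.ofReal ((2 * τ) ^ a) *
      ENNReal.ofReal (1 / 2) ^ (1 / q.toReal) ≤ N := by
    intro τ hτ hτT
    have hmeas : ENNReal.ofReal (1 / 2) ≤ logMeasure T (Ioc τ (2 * τ)) := by
      rw [← lintegral_indicator_one measurableSet_Ioc, lintegral_logMeasure]
      calc ENNReal.ofReal (1 / 2) = ∫⁻ _ in Ioc τ (2 * τ), ENNReal.ofReal (2 * τ)⁻¹ := by
            rw [lintegral_const, Measure.restrict_apply_univ, Real.volume_Ioc,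
              ← ENNReal.ofReal_mul (by positivity)]
            congr 1
            field_simp
            ring
        _ ≤ ∫⁻ σ in Ioc τ (2 * τ), ENNReal.ofReal σ⁻¹ * (Ioc τ (2 * τ)).indicator 1 σ := by
            refine setLIntegral_mono' measurableSet_Ioc fun σ hσ => ?_
            rw [indicator_of_mem hσ, Pi.one_apply, mul_one]
            exact ENNReal.ofReal_le_ofReal (inv_anti₀ (hτ.trans hσ.1) hσ.2)
        _ ≤ _ := lintegral_mono_set (Ioc_subset_Ioc hτ.le (by linarith))
    have h0 : logMeasure T (Ioc τ (2 * τ)) ≠ 0 := fun h => by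
      rw [h] at hmeas
      norm_num at hmeas
    calc w τ / ENNReal.ofReal ((2 * τ) ^ a) * ENNReal.ofReal (1 / 2) ^ (1 / q.toReal)
        ≤ w τ / ENNReal.ofReal ((2 * τ) ^ a) *
            logMeasure T (Ioc τ (2 * τ)) ^ (1 / q.toReal) := by
          gcongr
      _ = eLpNorm ((Ioc τ (2 * τ)).indicator fun _ => w τ / ENNReal.ofReal ((2 * τ) ^ a)) q
            (logMeasure T) := by
          rw [eLpNorm_indicator_const' measurableSet_Ioc h0 hq, enorm_eq_self]
      _ ≤ N := by
          refine eLpNorm_mono_enorm_ae (ae_of_all _ fun σ => ?_)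
          simp only [enorm_eq_self]
          by_cases hσ : σ ∈ Ioc τ (2 * τ)
          · rw [indicator_of_mem hσ]
            refine ENNReal.div_le_div (hmono hσ.1.le) (ENNReal.ofReal_le_ofReal ?_)
            exact Real.rpow_le_rpow (hτ.trans hσ.1).le hσ.2 ha
          · rw [indicator_of_notMem hσ]
            exact zero_le
  set c : ℝ≥0∞ := ENNReal.ofReal (1 / 2) ^ (1 / q.toReal) with hc
  have hc0 : c ≠ 0 := by
    rw [hc]
    exact (ENNReal.rpow_pos (by norm_num) ENNReal.ofReal_ne_top).ne'
  have hct : c ≠ ∞ := ENNReal.rpow_ne_top_of_nonneg (by positivity) ENNReal.ofReal_ne_top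
  have hNc : N / c ≠ ∞ := ENNReal.div_ne_top hNt hc0
  refine ⟨((N / c).toReal + 1) * 2 ^ a, by positivity, fun τ hτ hτT => ?_⟩
  have h1 := key τ hτ hτT
  rw [← ENNReal.le_div_iff_mul_le (Or.inl hc0) (Or.inl hct)] at h1
  have h2p : 0 < (2 * τ) ^ a := by positivity
  rw [ENNReal.div_le_iff (by simpa using h2p) ENNReal.ofReal_ne_top] at h1
  refine h1.trans ?_
  calc N / c * ENNReal.ofReal ((2 * τ) ^ a)
      = ENNReal.ofReal (N / c).toReal * ENNReal.ofReal ((2 * τ) ^ a) := by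
        rw [ENNReal.ofReal_toReal hNc]
    _ = ENNReal.ofReal ((N / c).toReal * (2 * τ) ^ a) := by
        rw [ENNReal.ofReal_mul ENNReal.toReal_nonneg]
    _ ≤ _ := by
        refine ENNReal.ofReal_le_ofReal ?_
        rw [Real.mul_rpow zero_le_two hτ.le, mul_assoc]
        gcongr
        linarith

/-- For bounded `w(τ)/τ^a`, the third index may be increased. -/
lemma LogMem.of_le {T a : ℝ} {p r : ℝ≥0∞} {w : ℝ → ℝ≥0∞} (hp : p ≠ 0) (hpr : p ≤ r)
    {K : ℝ≥0∞} (hK : K ≠ ∞)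
    (hb : ∀ τ ∈ Ioc 0 T, w τ / ENNReal.ofReal (τ ^ a) ≤ K) (hw : LogMem T a p w) :
    LogMem T a r w := by
  unfold LogMem
  by_cases hrt : r = ∞
  · subst hrt
    rw [eLpNorm_exponent_top]
    refine lt_of_le_of_lt (eLpNormEssSup_le_of_ae_enorm_bound (C := K) ?_) hK.lt_top
    filter_upwards [ae_logMeasure T] with τ hτ
    rw [enorm_eq_self]
    exact hb τ hτ
  have hpt : p ≠ ∞ := fun h => hrt (top_le_iff.1 (h ▸ hpr))
  have hr : r ≠ 0 := fun h => hp (nonpos_iff_eq_zero.1 (h ▸ hpr))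
  have hp0 : 0 < p.toReal := ENNReal.toReal_pos hp hpt
  have hpr' : p.toReal ≤ r.toReal := ENNReal.toReal_mono hrt hpr
  unfold LogMem at hw
  rw [eLpNorm_lt_top_iff_lintegral_rpow_enorm_lt_top hp hpt] at hw
  rw [eLpNorm_lt_top_iff_lintegral_rpow_enorm_lt_top hr hrt]
  refine lt_of_le_of_lt (lintegral_mono_ae (g := fun τ => K ^ (r.toReal - p.toReal) *
    ‖w τ / ENNReal.ofReal (τ ^ a)‖ₑ ^ p.toReal) ?_) ?_
  · filter_upwards [ae_logMeasure T] with τ hτ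
    simp only [enorm_eq_self]
    calc (w τ / ENNReal.ofReal (τ ^ a)) ^ r.toReal
        = (w τ / ENNReal.ofReal (τ ^ a)) ^ (r.toReal - p.toReal) *
            (w τ / ENNReal.ofReal (τ ^ a)) ^ p.toReal := by
          rw [← ENNReal.rpow_add_of_nonneg _ _ (by linarith) hp0.le]
          congr 1
          ring
      _ ≤ _ := by
          gcongr
          exact hb τ hτ
  · rw [lintegral_const_mul' _ _ (ENNReal.rpow_ne_top_of_nonneg (by linarith) hK)]
    exact ENNReal.mul_lt_top (ENNReal.rpow_lt_top_of_nonneg (by linarith) hK) hw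

/-- The moduli of sums over a partition of the unit interval. -/
lemma exists_eLpNorm_sum_comp_mul_le {T a : ℝ} {r : ℝ≥0∞} (hT : 0 ≤ T) (ha : 1 < a)
    (hr : ENNReal.ofReal (1 / a) < r) :
    ∃ ε : ℝ, 0 < ε ∧ ∀ (w : ℝ → ℝ≥0∞), Measurable w → ∀ (N : ℕ) (Δ : ℕ → ℝ) (d : ℝ),
      (∀ i ∈ Finset.range N, 0 < Δ i ∧ Δ i ≤ d ∧ Δ i ≤ 1) → ∑ i ∈ Finset.range N, Δ i = 1 →
      0 < d →
      eLpNorm (fun τ => (∑ i ∈ Finset.range N, w (Δ i * τ)) / ENNReal.ofReal (τ ^ a)) r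
        (logMeasure T) ≤ ENNReal.ofReal (d ^ ε) *
          eLpNorm (fun τ => w τ / ENNReal.ofReal (τ ^ a)) r (logMeasure T) := by
  have hsum : ∀ (e : ℝ), 1 < e → ∀ (N : ℕ) (Δ : ℕ → ℝ) (d : ℝ),
      (∀ i ∈ Finset.range N, 0 < Δ i ∧ Δ i ≤ d ∧ Δ i ≤ 1) → ∑ i ∈ Finset.range N, Δ i = 1 →
      ∑ i ∈ Finset.range N, ENNReal.ofReal (Δ i ^ e) ≤ ENNReal.ofReal (d ^ (e - 1)) := by
    intro e he N Δ d hΔ h1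
    rw [← ENNReal.ofReal_sum_of_nonneg fun i hi => Real.rpow_nonneg (hΔ i hi).1.le _]
    refine ENNReal.ofReal_le_ofReal ?_
    calc ∑ i ∈ Finset.range N, Δ i ^ e ≤ ∑ i ∈ Finset.range N, d ^ (e - 1) * Δ i := by
          refine Finset.sum_le_sum fun i hi => ?_
          obtain ⟨h0, hd, -⟩ := hΔ i hi
          have : Δ i ^ e = Δ i ^ (e - 1) * Δ i := by
            rw [← Real.rpow_add_one h0.ne']
            congr 1
            ring
          rw [this]
          exact mul_le_mul_of_nonneg_right (Real.rpow_le_rpow h0.le hd (by linarith)) h0.le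
      _ = d ^ (e - 1) := by rw [← Finset.mul_sum, h1, mul_one]
  have ha0 : 0 < a := by linarith
  -- For r ≥ 1 Minkowski's inequality leads to ∑ Δ_i^a ≤ d^{a-1}. For r < 1 subadditivity of x ↦ x^r
  -- leads to ∑ Δ_i^{a r} ≤ d^{a r - 1}, and the condition r > 1/a makes the exponent positive.
  rcases le_or_gt 1 r with h1r | hr1
  · refine ⟨a - 1, by linarith, fun w hw N Δ d hΔ hΔ1 hd => ?_⟩
    set ρ : ℝ → ℝ≥0∞ := fun τ => w τ / ENNReal.ofReal (τ ^ a) with hρdef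
    have hρ : Measurable ρ := measurable_div_ofReal_rpow hw a
    have hρm : ∀ c : ℝ, Measurable fun τ => ENNReal.ofReal (c ^ a) * ρ (c * τ) := fun c =>
      (hρ.comp (measurable_const_mul c)).const_mul _
    calc eLpNorm (fun τ => (∑ i ∈ Finset.range N, w (Δ i * τ)) / ENNReal.ofReal (τ ^ a)) r
          (logMeasure T)
        = eLpNorm (∑ i ∈ Finset.range N, fun τ => ENNReal.ofReal (Δ i ^ a) * ρ (Δ i * τ)) r
            (logMeasure T) := by
          refine eLpNorm_congr_ae ?_
          filter_upwards [ae_logMeasure T] with τ hτ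
          rw [Finset.sum_apply, div_eq_mul_inv, Finset.sum_mul]
          refine Finset.sum_congr rfl fun i hi => ?_
          rw [← div_eq_mul_inv, comp_mul_div_ofReal_rpow w (hΔ i hi).1 hτ.1]
      _ ≤ ∑ i ∈ Finset.range N, eLpNorm (fun τ => ENNReal.ofReal (Δ i ^ a) * ρ (Δ i * τ)) r
            (logMeasure T) :=
          eLpNorm_sum_le (fun i _ => (hρm _).aestronglyMeasurable) h1r
      _ ≤ ∑ i ∈ Finset.range N, ENNReal.ofReal (Δ i ^ a) * eLpNorm ρ r (logMeasure T) := by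
          refine Finset.sum_le_sum fun i hi => ?_
          refine (eLpNorm_le_mul_eLpNorm_of_ae_le_mul'' (g := fun τ => ρ (Δ i * τ)) r
            (hρ.comp (measurable_const_mul _)).aestronglyMeasurable
            (c := ENNReal.ofReal (Δ i ^ a)) (ae_of_all _ fun τ => by simp)).trans ?_
          gcongr
          exact eLpNorm_comp_mul_le (hΔ i hi).1 (hΔ i hi).2.2 hT hρ r
      _ ≤ _ := by
          rw [← Finset.sum_mul]
          gcongr
          exact hsum a ha N Δ d hΔ hΔ1
  · have hrt : r ≠ ∞ := (hr1.trans ENNReal.one_lt_top).ne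
    have hr0 : r ≠ 0 := (bot_le.trans_lt hr).ne'
    have hp0 : 0 < r.toReal := ENNReal.toReal_pos hr0 hrt
    have hp1 : r.toReal ≤ 1 := by
      rw [← ENNReal.toReal_one]
      exact ENNReal.toReal_mono ENNReal.one_ne_top hr1.le
    have har : 1 < a * r.toReal := by
      have := (ENNReal.ofReal_lt_iff_lt_toReal (by positivity) hrt).1 hr
      rw [div_lt_iff₀ ha0] at this
      linarith
    set p := r.toReal with hp
    refine ⟨(a * p - 1) * p⁻¹, by
      have : 0 < a * p - 1 := by linarith
      positivity, fun w hw N Δ d hΔ hΔ1 hd => ?_⟩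
    set ρ : ℝ → ℝ≥0∞ := fun τ => w τ / ENNReal.ofReal (τ ^ a) with hρdef
    have hρ : Measurable ρ := measurable_div_ofReal_rpow hw a
    rw [eLpNorm_eq_lintegral_rpow_enorm_toReal hr0 hrt, ← hp, one_div, ENNReal.rpow_inv_le_iff hp0,
      ENNReal.mul_rpow_of_nonneg _ _ hp0.le, ENNReal.ofReal_rpow_of_nonneg (by positivity) hp0.le,
      ← Real.rpow_mul hd.le, mul_assoc, inv_mul_cancel₀ hp0.ne', mul_one]
    have hsub : ∀ (s : Finset ℕ) (g : ℕ → ℝ≥0∞), (∑ i ∈ s, g i) ^ p ≤ ∑ i ∈ s, g i ^ p := by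
      intro s g
      induction s using Finset.induction_on with
      | empty => simp [hp0]
      | insert i s hi ih =>
        rw [Finset.sum_insert hi, Finset.sum_insert hi]
        exact (ENNReal.rpow_add_le_add_rpow _ _ hp0.le hp1).trans (by gcongr)
    calc ∫⁻ τ, ‖(∑ i ∈ Finset.range N, w (Δ i * τ)) / ENNReal.ofReal (τ ^ a)‖ₑ ^ p ∂logMeasure T
        ≤ ∫⁻ τ, ∑ i ∈ Finset.range N, ENNReal.ofReal (Δ i ^ (a * p)) * ρ (Δ i * τ) ^ p
            ∂logMeasure T := by
          refine lintegral_mono_ae ?_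
          filter_upwards [ae_logMeasure T] with τ hτ
          rw [enorm_eq_self, div_eq_mul_inv, Finset.sum_mul]
          refine (hsub _ _).trans (le_of_eq (Finset.sum_congr rfl fun i hi => ?_))
          rw [← div_eq_mul_inv, comp_mul_div_ofReal_rpow w (hΔ i hi).1 hτ.1,
            ENNReal.mul_rpow_of_nonneg _ _ hp0.le,
            ENNReal.ofReal_rpow_of_nonneg (Real.rpow_nonneg (hΔ i hi).1.le _) hp0.le,
            ← Real.rpow_mul (hΔ i hi).1.le]
      _ = ∑ i ∈ Finset.range N, ENNReal.ofReal (Δ i ^ (a * p)) *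
            ∫⁻ τ, ρ (Δ i * τ) ^ p ∂logMeasure T := by
          rw [lintegral_finsetSum _ (by fun_prop)]
          exact Finset.sum_congr rfl fun i _ => lintegral_const_mul _ (by fun_prop)
      _ ≤ ∑ i ∈ Finset.range N, ENNReal.ofReal (Δ i ^ (a * p)) *
            eLpNorm ρ r (logMeasure T) ^ p := by
          refine Finset.sum_le_sum fun i hi => ?_
          gcongr
          have h := eLpNorm_comp_mul_le (hΔ i hi).1 (hΔ i hi).2.2 hT hρ r
          rw [eLpNorm_eq_lintegral_rpow_enorm_toReal hr0 hrt, ← hp, one_div,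
            ENNReal.rpow_inv_le_iff hp0] at h
          simpa only [enorm_eq_self] using h
      _ ≤ _ := by
          rw [← Finset.sum_mul]
          gcongr
          exact hsum (a * p) har N Δ d hΔ hΔ1

/-! ### From integral to pointwise bounds for almost additive two-parameter functions -/

/-- The sum of the three normalised functions has integral at most 3 over E. Some point of E off N
does not exceed its mean 3/l, and there each summand obeys the same bound. -/
lemma exists_le_three_averages {μ : Measure ℝ} {E N : Set ℝ} {l m₁ m₂ m₃ : ℝ} (hN : μ N = 0)
    (hE : μ E = ENNReal.ofReal l) (hl : 0 < l)
    {f₁ f₂ f₃ : ℝ → ℝ≥0∞} (h₁ : AEMeasurable f₁ μ) (h₂ : AEMeasurable f₂ μ)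
    (h₃ : AEMeasurable f₃ μ) (hm₁ : 0 < m₁) (hm₂ : 0 < m₂) (hm₃ : 0 < m₃)
    (i₁ : ∫⁻ x in E, f₁ x ∂μ ≤ ENNReal.ofReal m₁) (i₂ : ∫⁻ x in E, f₂ x ∂μ ≤ ENNReal.ofReal m₂)
    (i₃ : ∫⁻ x in E, f₃ x ∂μ ≤ ENNReal.ofReal m₃) :
    ∃ x ∈ E \ N, f₁ x ≤ ENNReal.ofReal (3 * m₁ / l) ∧ f₂ x ≤ ENNReal.ofReal (3 * m₂ / l) ∧
      f₃ x ≤ ENNReal.ofReal (3 * m₃ / l) := by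
  have hE0 : μ E ≠ 0 := by rw [hE]; simpa using hl
  have hEt : μ E ≠ ∞ := by rw [hE]; exact ENNReal.ofReal_ne_top
  set F : ℝ → ℝ≥0∞ := fun x => f₁ x / ENNReal.ofReal m₁ +
    (f₂ x / ENNReal.ofReal m₂ + f₃ x / ENNReal.ofReal m₃) with hF
  have ae : ∀ (f : ℝ → ℝ≥0∞) (m : ℝ), AEMeasurable f μ →
      AEMeasurable (fun x => f x / ENNReal.ofReal m) μ := fun f m hf => hf.div_const _
  have hFm : AEMeasurable F (μ.restrict E) :=
    ((ae _ _ h₁).add ((ae _ _ h₂).add (ae _ _ h₃))).restrict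
  obtain ⟨x, hx, hle⟩ : ∃ x ∈ E \ N, F x ≤ ⨍⁻ a in E, F a ∂μ := by
    have h := measure_le_setLAverage_pos hE0 hEt hFm
    rw [← measure_sdiff_null hN] at h
    obtain ⟨x, hx, hxN⟩ := nonempty_of_measure_ne_zero h.ne'
    exact ⟨x, ⟨hx.1, hxN⟩, hx.2⟩
  have hint : ∫⁻ x in E, F x ∂μ ≤ 3 := by
    rw [hF, lintegral_add_left' (ae _ _ h₁).restrict, lintegral_add_left' (ae _ _ h₂).restrict]
    have one : ∀ (f : ℝ → ℝ≥0∞) (m : ℝ), 0 < m → ∫⁻ x in E, f x ∂μ ≤ ENNReal.ofReal m →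
        ∫⁻ x in E, f x / ENNReal.ofReal m ∂μ ≤ 1 := by
      intro f m hm hi
      simp_rw [div_eq_mul_inv]
      rw [lintegral_mul_const' _ _ (ENNReal.inv_ne_top.2 (by simpa using hm)), ← div_eq_mul_inv]
      exact ENNReal.div_le_of_le_mul (by rwa [one_mul])
    calc _ ≤ (1 : ℝ≥0∞) + (1 + 1) := by
          gcongr
          · exact one _ _ hm₁ i₁
          · exact one _ _ hm₂ i₂
          · exact one _ _ hm₃ i₃
      _ = 3 := by norm_num
  have hFx : F x ≤ ENNReal.ofReal (3 / l) := by
    refine hle.trans ?_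
    rw [setLAverage_eq, hE, ENNReal.ofReal_div_of_pos hl, ENNReal.ofReal_ofNat]
    exact ENNReal.div_le_div_right hint _
  have fin : ∀ (y : ℝ≥0∞) (m : ℝ), 0 < m → y / ENNReal.ofReal m ≤ F x →
      y ≤ ENNReal.ofReal (3 * m / l) := by
    intro y m hm hy
    have := hy.trans hFx
    rw [ENNReal.div_le_iff (by simpa using hm) ENNReal.ofReal_ne_top,
      ← ENNReal.ofReal_mul (by positivity)] at this
    refine this.trans (le_of_eq ?_)
    congr 1
    ring
  refine ⟨x, hx, fin _ _ hm₁ le_self_add, fin _ _ hm₂ (le_self_add.trans le_add_self),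
    fin _ _ hm₃ (le_add_self.trans le_add_self)⟩

/-- The kernel `a(u,v)^p / |v-u|^e` on `{0 ≤ u < v ≤ T, v - u ≤ T/2}`. -/
def sewKernel (T e : ℝ) (p : ℕ) (a : ℝ → ℝ → ℝ) : ℝ × ℝ → ℝ≥0∞ :=
  {z : ℝ × ℝ | 0 ≤ z.1 ∧ z.1 < z.2 ∧ z.2 ≤ T ∧ z.2 - z.1 ≤ T / 2}.indicator
    fun z => ENNReal.ofReal (a z.1 z.2 ^ p / (z.2 - z.1) ^ e)

lemma measurableSet_sewKernel (T : ℝ) :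
    MeasurableSet {z : ℝ × ℝ | 0 ≤ z.1 ∧ z.1 < z.2 ∧ z.2 ≤ T ∧ z.2 - z.1 ≤ T / 2} := by
  refine (measurableSet_le measurable_const measurable_fst).inter
    ((measurableSet_lt measurable_fst measurable_snd).inter
      ((measurableSet_le measurable_snd measurable_const).inter
        (measurableSet_le (measurable_snd.sub measurable_fst) measurable_const)))

lemma aemeasurable_sewKernel {T e : ℝ} {p : ℕ} {a : ℝ → ℝ → ℝ}
    (hm : AEMeasurable (fun z : ℝ × ℝ => a z.1 z.2) (volume.restrict (simplex T))) :
    AEMeasurable (sewKernel T e p a) volume := by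
  unfold sewKernel
  rw [aemeasurable_indicator_iff (measurableSet_sewKernel T)]
  have h1 : AEMeasurable (fun z : ℝ × ℝ => a z.1 z.2)
      (volume.restrict {z : ℝ × ℝ | 0 ≤ z.1 ∧ z.1 < z.2 ∧ z.2 ≤ T ∧ z.2 - z.1 ≤ T / 2}) :=
    hm.mono_measure (Measure.restrict_mono_set _ fun z hz => ⟨hz.1, hz.2.1.le, hz.2.2.1⟩)
  have h2 : Measurable fun z : ℝ × ℝ => (z.2 - z.1) ^ e := by fun_prop
  exact ((h1.pow_const p).div h2.aemeasurable).ennreal_ofReal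

/-- In the coordinates (r, h) with v = r + h, the inner integral is a section integral and its bound
C h^e cancels the singular denominator. -/
lemma lintegral_sewKernel_le {T e C : ℝ} {p : ℕ} {a : ℝ → ℝ → ℝ} (hC : 0 ≤ C)
    (hm : AEMeasurable (fun z : ℝ × ℝ => a z.1 z.2) (volume.restrict (simplex T)))
    (hsec : ∀ h, 0 < h → h ≤ T / 2 →
      ∫⁻ r in Icc 0 (T - h), ENNReal.ofReal (a r (r + h) ^ p) ≤ ENNReal.ofReal (C * h ^ e)) :
    ∫⁻ z, sewKernel T e p a z ≤ ENNReal.ofReal (C * (T / 2)) := by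
  have hF := aemeasurable_sewKernel (e := e) (p := p) hm
  have hmp := measurePreserving_prod_add (volume : Measure ℝ) (volume : Measure ℝ)
  have h1 : ∫⁻ z, sewKernel T e p a z =
      ∫⁻ z, sewKernel T e p a (z.1, z.1 + z.2) ∂((volume : Measure ℝ).prod volume) := by
    have h2 := hmp.map_eq
    conv_lhs => rw [Measure.volume_eq_prod, ← h2]
    rw [lintegral_map' (by rw [h2]; exact hF) hmp.measurable.aemeasurable]
  have h2 : AEMeasurable (fun z : ℝ × ℝ => sewKernel T e p a (z.1, z.1 + z.2))
      ((volume : Measure ℝ).prod volume) :=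
    hF.comp_quasiMeasurePreserving hmp.quasiMeasurePreserving
  rw [h1, lintegral_prod_symm _ h2]
  calc ∫⁻ h, ∫⁻ r, sewKernel T e p a (r, r + h)
      ≤ ∫⁻ h, (Ioc 0 (T / 2)).indicator (fun _ => ENNReal.ofReal C) h := by
        refine lintegral_mono fun h => ?_
        by_cases hh : h ∈ Ioc 0 (T / 2)
        · rw [indicator_of_mem hh]
          have hpos : 0 < h ^ e := Real.rpow_pos_of_pos hh.1 e
          calc ∫⁻ r, sewKernel T e p a (r, r + h)
              ≤ ∫⁻ r, (Icc 0 (T - h)).indicator (fun r => ENNReal.ofReal (1 / h ^ e) *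
                  ENNReal.ofReal (a r (r + h) ^ p)) r := by
                refine lintegral_mono fun r => ?_
                unfold sewKernel
                refine indicator_apply_le' (fun hz => ?_) (fun _ => zero_le)
                simp only [mem_ofPred_eq] at hz
                rw [indicator_of_mem (show r ∈ Icc 0 (T - h) from
                  ⟨hz.1, by linarith [hz.2.2.1]⟩), ← ENNReal.ofReal_mul (by positivity)]
                refine ENNReal.ofReal_le_ofReal (le_of_eq ?_)
                simp only [add_sub_cancel_left]
                ring
            _ = ENNReal.ofReal (1 / h ^ e) *
                  ∫⁻ r in Icc 0 (T - h), ENNReal.ofReal (a r (r + h) ^ p) := by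
                rw [lintegral_indicator measurableSet_Icc,
                  lintegral_const_mul' _ _ ENNReal.ofReal_ne_top]
            _ ≤ ENNReal.ofReal (1 / h ^ e) * ENNReal.ofReal (C * h ^ e) := by
                gcongr
                exact hsec h hh.1 hh.2
            _ = ENNReal.ofReal C := by
                rw [← ENNReal.ofReal_mul (by positivity)]
                congr 1
                field_simp
        · rw [indicator_of_notMem hh]
          have h0 : ∀ r, sewKernel T e p a (r, r + h) = 0 := fun r => by
            unfold sewKernel
            rw [indicator_of_notMem]
            simp only [mem_ofPred_eq, not_and]
            intro _ h2 _ h4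
            exact hh ⟨by linarith, by linarith⟩
          simp only [h0, lintegral_zero, le_refl]
    _ = ENNReal.ofReal C * ENNReal.ofReal (T / 2) := by
        rw [lintegral_indicator measurableSet_Ioc, lintegral_const, Measure.restrict_apply_univ,
          Real.volume_Ioc, sub_zero]
    _ = _ := by rw [ENNReal.ofReal_mul hC]

/-- Symmetric extension of a function on the simplex. -/
def symmExt (a : ℝ → ℝ → ℝ) (u v : ℝ) : ℝ := a (min u v) (max u v)

lemma symmExt_of_le {a : ℝ → ℝ → ℝ} {u v : ℝ} (h : u ≤ v) : symmExt a u v = a u v := by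
  simp [symmExt, h]

lemma symmExt_comm (a : ℝ → ℝ → ℝ) (u v : ℝ) : symmExt a u v = symmExt a v u := by
  simp [symmExt, min_comm, max_comm]

/-- Symmetrising the kernel lets the chaining argument approach a point from the left and from the
right in the same way. -/
lemma sewKernel_add_swap {T e : ℝ} {p : ℕ} {a : ℝ → ℝ → ℝ} {u v : ℝ} (hu : u ∈ Icc 0 T)
    (hv : v ∈ Icc 0 T) (huv : u ≠ v) (hd : |u - v| ≤ T / 2) :
    sewKernel T e p a (u, v) + sewKernel T e p a (v, u) =
      ENNReal.ofReal (symmExt a u v ^ p / |u - v| ^ e) := by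
  unfold sewKernel
  rcases lt_or_gt_of_ne huv with h | h
  · rw [abs_of_neg (by linarith)] at hd ⊢
    rw [indicator_of_mem, indicator_of_notMem, add_zero, symmExt_of_le h.le]
    · simp
    · simp only [mem_ofPred_eq, not_and]
      intro _ h2
      linarith
    · exact ⟨hu.1, h, hv.2, by simpa using hd⟩
  · rw [abs_of_pos (by linarith)] at hd ⊢
    rw [indicator_of_notMem, indicator_of_mem, zero_add, symmExt_comm, symmExt_of_le h.le]
    · exact ⟨hv.1, h, hu.2, by simpa using hd⟩
    · simp only [mem_ofPred_eq, not_and]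
      intro _ h2
      linarith

/-- The surplus 2 in the exponent θp + 2 pays for the factor 1/e'² that two successive averagings
over intervals of length comparable to e' cost. -/
lemma le_of_pow_div_le {b d e' M K θ : ℝ} {p : ℕ} (hp : p ≠ 0) (hd : 0 < d) (hde : d ≤ e')
    (hM : 0 ≤ M) (hK : M ≤ K) (hK1 : 1 ≤ K) (hθ : 0 < θ)
    (h : ENNReal.ofReal (b ^ p / d ^ (θ * p + 2)) ≤ ENNReal.ofReal (M / e' ^ 2)) :
    b ≤ K * e' ^ θ := by
  have he : 0 < e' := hd.trans_le hde
  have h1 : b ^ p / d ^ (θ * p + 2) ≤ M / e' ^ 2 :=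
    (ENNReal.ofReal_le_ofReal_iff (by positivity)).1 h
  have hdp : 0 < d ^ (θ * p + 2) := Real.rpow_pos_of_pos hd _
  rw [div_le_iff₀ hdp] at h1
  have h2 : d ^ (θ * p + 2) ≤ (e' ^ θ) ^ p * e' ^ 2 := by
    calc d ^ (θ * p + 2) ≤ e' ^ (θ * p + 2) :=
          Real.rpow_le_rpow hd.le hde (by positivity)
      _ = (e' ^ θ) ^ p * e' ^ 2 := by
          rw [Real.rpow_add he, Real.rpow_mul he.le, Real.rpow_natCast, Real.rpow_ofNat]
  have h3 : b ^ p ≤ (K * e' ^ θ) ^ p := by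
    calc b ^ p ≤ M / e' ^ 2 * d ^ (θ * p + 2) := h1
      _ ≤ M / e' ^ 2 * ((e' ^ θ) ^ p * e' ^ 2) := by gcongr
      _ = M * (e' ^ θ) ^ p := by field_simp
      _ ≤ K ^ p * (e' ^ θ) ^ p := by
          gcongr
          exact hK.trans (le_self_pow₀ hK1 hp)
      _ = _ := by rw [mul_pow]
  exact le_of_pow_le_pow_left₀ hp (by positivity) h3

set_option maxHeartbeats 1000000 in
/-- A two-parameter function that is additive up to `B (t-s)^θ`, and whose sections satisfy
`∫ a(r,r+h)^p dr ≤ C h^{θ p + 2}`, is bounded by `K (t-s)^θ` off a null set. -/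
theorem exists_ae_holder {T θ B C : ℝ} {p : ℕ} (hT : 0 < T) (hθ : 0 < θ) (hp : p ≠ 0)
    {a : ℝ → ℝ → ℝ} (ha0 : ∀ s t, 0 ≤ a s t) (hC : 0 ≤ C) (hB : 0 ≤ B)
    (hm : AEMeasurable (fun z : ℝ × ℝ => a z.1 z.2) (volume.restrict (simplex T)))
    (hsec : ∀ h, 0 < h → h ≤ T / 2 →
      ∫⁻ r in Icc 0 (T - h), ENNReal.ofReal (a r (r + h) ^ p) ≤
        ENNReal.ofReal (C * h ^ (θ * p + 2)))
    (htri : ∀ s u t, 0 ≤ s → s ≤ u → u ≤ t → t ≤ T → t - s ≤ T / 2 →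
      a s t ≤ a s u + a u t + B * (t - s) ^ θ) :
    ∃ K : ℝ, 0 ≤ K ∧ ∃ N : Set ℝ, volume N = 0 ∧ ∀ s ∈ Icc 0 T, s ∉ N → ∀ t ∈ Icc 0 T, t ∉ N →
      s < t → t - s ≤ T / 2 → a s t ≤ K * (t - s) ^ θ := by
  set e₀ := θ * p + 2 with he₀
  set F := sewKernel T e₀ p a with hFdef
  have hF : AEMeasurable F ((volume : Measure ℝ).prod volume) := aemeasurable_sewKernel hm
  have hFs : AEMeasurable (fun z : ℝ × ℝ => F z.swap) ((volume : Measure ℝ).prod volume) :=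
    hF.comp_quasiMeasurePreserving
      (Measure.measurePreserving_swap (μ := (volume : Measure ℝ))
        (ν := (volume : Measure ℝ))).quasiMeasurePreserving
  have hFi : ∫⁻ z, F z ∂((volume : Measure ℝ).prod volume) ≤ ENNReal.ofReal (C * (T / 2)) :=
    lintegral_sewKernel_le hC hm hsec
  set G : ℝ × ℝ → ℝ≥0∞ := fun z => F z + F z.swap with hGdef
  have hG : AEMeasurable G ((volume : Measure ℝ).prod volume) := hF.add hFs
  set U := 2 * (C * (T / 2)) + 1 with hU
  have hU0 : 0 < U := by positivity
  have hGi : ∫⁻ z, G z ∂((volume : Measure ℝ).prod volume) ≤ ENNReal.ofReal U := by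
    rw [hGdef, lintegral_add_left' hF]
    have : ∫⁻ z : ℝ × ℝ, F z.swap ∂((volume : Measure ℝ).prod volume) =
        ∫⁻ z, F z ∂((volume : Measure ℝ).prod volume) := lintegral_prod_swap F
    rw [this]
    calc _ ≤ ENNReal.ofReal (C * (T / 2)) + ENNReal.ofReal (C * (T / 2)) := by gcongr
      _ = ENNReal.ofReal (C * (T / 2) + C * (T / 2)) := by
          rw [ENNReal.ofReal_add (by positivity) (by positivity)]
      _ ≤ _ := ENNReal.ofReal_le_ofReal (by rw [hU]; linarith)
  set I : ℝ → ℝ≥0∞ := fun u => ∫⁻ v, G (u, v) with hI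
  have hIm : AEMeasurable I volume := hG.lintegral_prod_right'
  have hIi : ∫⁻ u, I u ≤ ENNReal.ofReal U := by
    rw [hI, ← lintegral_prod _ hG]
    exact hGi
  have hIfin : ∀ᵐ u, I u < ∞ :=
    ae_lt_top' hIm (hIi.trans_lt ENNReal.ofReal_lt_top).ne
  have hGsec : ∀ᵐ u, AEMeasurable (fun v => G (u, v)) volume := by
    filter_upwards [hG.aestronglyMeasurable.prodMk_left] with u hu
    exact hu.aemeasurable
  -- The exceptional set consists of the points u where ∫ G(u, v) dv is infinite or the section of G
  -- is not measurable.
  set N : Set ℝ := {u | ¬ (I u < ∞ ∧ AEMeasurable (fun v => G (u, v)) volume)} with hN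
  have hN0 : volume N = 0 := ae_iff.1 (hIfin.and hGsec)
  have hNot : ∀ u, u ∉ N → I u < ∞ ∧ AEMeasurable (fun v => G (u, v)) volume := fun u hu => by
    simpa [hN] using hu
  set b := symmExt a with hb
  have hGb : ∀ u v, u ∈ Icc 0 T → v ∈ Icc 0 T → u ≠ v → |u - v| ≤ T / 2 →
      G (u, v) = ENNReal.ofReal (b u v ^ p / |u - v| ^ e₀) :=
    fun u v hu hv huv hd => sewKernel_add_swap hu hv huv hd
  have hb0 : ∀ u v, 0 ≤ b u v := fun u v => ha0 _ _
  have hbtri : ∀ u v t, u ∈ Icc 0 T → t ∈ Icc 0 T → (u ≤ v ∧ v ≤ t ∨ t ≤ v ∧ v ≤ u) →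
      |u - t| ≤ T / 2 → b u t ≤ b u v + b v t + B * |u - t| ^ θ := by
    intro u v t hu ht h hd
    rcases h with ⟨h1, h2⟩ | ⟨h1, h2⟩
    · rw [abs_sub_comm, abs_of_nonneg (by linarith)] at hd ⊢
      rw [hb, symmExt_of_le (h1.trans h2), symmExt_of_le h1, symmExt_of_le h2]
      exact htri u v t hu.1 h1 h2 ht.2 hd
    · rw [abs_of_nonneg (by linarith)] at hd ⊢
      rw [hb, symmExt_comm a u t, symmExt_comm a u v, symmExt_comm a v t,
        symmExt_of_le (h1.trans h2), symmExt_of_le h1, symmExt_of_le h2]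
      have := htri t v u ht.1 h1 h2 hu.2 hd
      linarith
  have hmem : ∀ u t v, u ∈ Icc 0 T → t ∈ Icc 0 T → (u ≤ v ∧ v ≤ t ∨ t ≤ v ∧ v ≤ u) →
      v ∈ Icc 0 T := by
    rintro u t v hu ht (⟨h1, h2⟩ | ⟨h1, h2⟩)
    · exact ⟨hu.1.trans h1, h2.trans ht.2⟩
    · exact ⟨ht.1.trans h1, h2.trans hu.2⟩
  -- Averaging over an interval of length e/4 with three functions at once costs the factor 3/(e/4)
  -- = 12/e.
  set M := 12 * U with hM
  have hM0 : 0 < M := by positivity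
  set K₁ := max 1 (12 * M) with hK₁
  have hK₁1 : 1 ≤ K₁ := le_max_left _ _
  set lam : ℝ := (1 / 2) ^ θ with hlam
  have hlam1 : lam < 1 := Real.rpow_lt_one (by norm_num) (by norm_num) hθ
  have hlam0 : 0 < lam := Real.rpow_pos_of_pos (by norm_num) θ
  -- K₂ is the fixed point of K ↦ K₁ + B + λK, which describes one chaining step.
  set K₂ := (K₁ + B) / (1 - lam) with hK₂
  have h1lam : 0 < 1 - lam := by linarith
  have hK₂0 : 0 ≤ K₂ := div_nonneg (by linarith) h1lam.le
  have hK₂e : K₁ + B + K₂ * lam = K₂ := by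
    rw [hK₂]
    field_simp
    ring
  -- one-sided bound
  have side : ∀ t ∈ Icc 0 T, t ∉ N → ∀ J : ℝ, 0 < J → I t ≤ ENNReal.ofReal J →
      ∀ u ∈ Icc 0 T, u ∉ N → u ≠ t → |u - t| ≤ T / 2 →
      I u ≤ ENNReal.ofReal (M / |u - t|) → G (t, u) ≤ ENNReal.ofReal (12 * J / |u - t|) →
      b u t ≤ K₂ * |u - t| ^ θ := by
    intro t ht htN J hJ hIt
    set J₁ := max 1 (12 * J * T) with hJ₁
    have hJ₁1 : 1 ≤ J₁ := le_max_left _ _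
    -- The crude bound with J₁ depends on t through J, but it enters only at the last step of the
    -- chain. After n steps it carries the factor λ^n, so it disappears in the limit and K₂ is
    -- uniform in t.
    have ind : ∀ n : ℕ, ∀ u ∈ Icc 0 T, u ∉ N → u ≠ t → |u - t| ≤ T / 2 →
        I u ≤ ENNReal.ofReal (M / |u - t|) → G (t, u) ≤ ENNReal.ofReal (12 * J / |u - t|) →
        b u t ≤ K₂ * |u - t| ^ θ + J₁ * |u - t| ^ θ * lam ^ n := by
      intro n
      induction n with
      | zero =>
        intro u hu huN hut hd hIu hGu
        have he : 0 < |u - t| := abs_pos.2 (sub_ne_zero.2 hut)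
        have h1 : b t u ≤ J₁ * |u - t| ^ θ := by
          rw [hGb t u ht hu hut.symm (by rwa [abs_sub_comm]), abs_sub_comm t u] at hGu
          refine le_of_pow_div_le (M := 12 * J * |u - t|) hp he le_rfl (by positivity)
            (le_trans ?_ (le_max_right _ _)) hJ₁1 hθ (hGu.trans (le_of_eq ?_))
          · gcongr
            linarith
          · congr 1
            field_simp
        rw [hb, symmExt_comm]
        have : 0 ≤ K₂ * |u - t| ^ θ := by positivity
        simp only [pow_zero, mul_one]
        rw [← hb]
        linarith
      | succ n ih =>
        intro u hu huN hut hd hIu hGu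
        have he : 0 < |u - t| := abs_pos.2 (sub_ne_zero.2 hut)
        set e := |u - t| with hedef
        -- the points between `u` and `t` at distance between `e/4` and `e/2` from `t`
        obtain ⟨E, hE, hEm⟩ : ∃ E : Set ℝ, volume E = ENNReal.ofReal (e / 4) ∧ ∀ v ∈ E,
            (u ≤ v ∧ v ≤ t ∨ t ≤ v ∧ v ≤ u) ∧ e / 4 ≤ |v - t| ∧ |v - t| ≤ e / 2 ∧
              e / 2 ≤ |u - v| ∧ |u - v| ≤ e := by
          rcases lt_or_gt_of_ne hut with h | h
          · have hee : e = t - u := by rw [hedef, abs_of_neg (by linarith)]; ring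
            refine ⟨Icc (t - e / 2) (t - e / 4), by rw [Real.volume_Icc]; congr 1; ring, ?_⟩
            intro v hv
            have h1 := hv.1
            have h2 := hv.2
            rw [abs_of_nonpos (show v - t ≤ 0 by linarith),
              abs_of_nonpos (show u - v ≤ 0 by linarith)]
            refine ⟨Or.inl ⟨by linarith, by linarith⟩, by linarith, by linarith, by linarith,
              by linarith⟩
          · have hee : e = u - t := by rw [hedef, abs_of_pos (by linarith)]
            refine ⟨Icc (t + e / 4) (t + e / 2), by rw [Real.volume_Icc]; congr 1; ring, ?_⟩
            intro v hv
            have h1 := hv.1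
            have h2 := hv.2
            rw [abs_of_nonneg (show 0 ≤ v - t by linarith),
              abs_of_nonneg (show 0 ≤ u - v by linarith)]
            refine ⟨Or.inr ⟨by linarith, by linarith⟩, by linarith, by linarith, by linarith,
              by linarith⟩
        -- The point v satisfies I(v) ≤ M/e, G(u,v) ≤ 12M/e² and G(t,v) ≤ 12J/e. The second bound
        -- controls the jump from u to v. As |v - t| ≤ e, the other two are the induction hypotheses
        -- at v.
        obtain ⟨v, ⟨hvE, hvN⟩, q1, q2, q3⟩ := exists_le_three_averages hN0 hE (by positivity)
          hIm (hNot u huN).2 (hNot t htN).2 hU0 (div_pos hM0 he) hJ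
          ((setLIntegral_le_lintegral _ _).trans hIi) ((setLIntegral_le_lintegral _ _).trans hIu)
          ((setLIntegral_le_lintegral _ _).trans hIt)
        obtain ⟨hbet, d1, d2, d3, d4⟩ := hEm v hvE
        have hv := hmem u t v hu ht hbet
        have hvt : v ≠ t := by
          intro h
          rw [h, sub_self, abs_zero] at d1
          linarith
        have huv : u ≠ v := by
          intro h
          rw [h, sub_self, abs_zero] at d3
          linarith
        have hvt0 : 0 < |v - t| := by linarith
        have s1 : b u v ≤ K₁ * e ^ θ := by
          rw [hGb u v hu hv huv (d4.trans hd)] at q2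
          refine le_of_pow_div_le (M := 12 * M) hp (by linarith) d4 (by positivity)
            (le_max_right _ _) hK₁1 hθ (q2.trans (le_of_eq ?_))
          congr 1
          field_simp
          ring
        have s2 := ih v hv hvN hvt (by linarith) (q1.trans (ENNReal.ofReal_le_ofReal (by
            rw [div_le_div_iff₀ (by positivity) hvt0, hM]
            nlinarith)))
          (q3.trans (ENNReal.ofReal_le_ofReal (by
            rw [div_le_div_iff₀ (by positivity) hvt0]
            nlinarith)))
        have s3 := hbtri u v t hu ht hbet hd
        have s4 : |v - t| ^ θ ≤ lam * e ^ θ := by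
          rw [hlam, ← Real.mul_rpow (by norm_num) he.le]
          exact Real.rpow_le_rpow (abs_nonneg _) (by linarith) hθ.le
        have hlamn : 0 ≤ lam ^ n := by positivity
        calc b u t ≤ b u v + b v t + B * e ^ θ := s3
          _ ≤ K₁ * e ^ θ + (K₂ * (lam * e ^ θ) + J₁ * (lam * e ^ θ) * lam ^ n) + B * e ^ θ := by
              have t1 : K₂ * |v - t| ^ θ ≤ K₂ * (lam * e ^ θ) := by gcongr
              have t2 : J₁ * |v - t| ^ θ * lam ^ n ≤ J₁ * (lam * e ^ θ) * lam ^ n := by gcongr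
              linarith
          _ = (K₁ + B + K₂ * lam) * e ^ θ + J₁ * e ^ θ * lam ^ (n + 1) := by ring
          _ = _ := by rw [hK₂e]
    intro u hu huN hut hd hIu hGu
    have hlim : Tendsto (fun n : ℕ => K₂ * |u - t| ^ θ + J₁ * |u - t| ^ θ * lam ^ n) atTop
        (𝓝 (K₂ * |u - t| ^ θ + J₁ * |u - t| ^ θ * 0)) :=
      ((tendsto_pow_atTop_nhds_zero_of_lt_one hlam0.le hlam1).const_mul _).const_add _
    rw [mul_zero, add_zero] at hlim
    exact ge_of_tendsto' hlim fun n => ind n u hu huN hut hd hIu hGu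
  refine ⟨2 * K₂ + B, by positivity, N, hN0, ?_⟩
  intro s hs hsN t ht htN hst hd
  have hd0 : 0 < t - s := by linarith
  obtain ⟨Js, hJs0, hJs⟩ : ∃ J : ℝ, 0 < J ∧ I s ≤ ENNReal.ofReal J :=
    ⟨(I s).toReal + 1, by positivity, by
      rw [ENNReal.ofReal_add ENNReal.toReal_nonneg zero_le_one,
        ENNReal.ofReal_toReal (hNot s hsN).1.ne]
      exact le_self_add⟩
  obtain ⟨Jt, hJt0, hJt⟩ : ∃ J : ℝ, 0 < J ∧ I t ≤ ENNReal.ofReal J :=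
    ⟨(I t).toReal + 1, by positivity, by
      rw [ENNReal.ofReal_add ENNReal.toReal_nonneg zero_le_one,
        ENNReal.ofReal_toReal (hNot t htN).1.ne]
      exact le_self_add⟩
  -- A point in the middle third is at distance comparable to t - s from both ends, so that the
  -- one-sided bound applies from s and from t.
  have hE : volume (Icc (s + (t - s) / 3) (s + 2 * (t - s) / 3)) =
      ENNReal.ofReal ((t - s) / 3) := by
    rw [Real.volume_Icc]
    congr 1
    ring
  obtain ⟨u, ⟨huE, huN⟩, q1, q2, q3⟩ := exists_le_three_averages hN0 hE (by positivity)
    hIm (hNot s hsN).2 (hNot t htN).2 hU0 hJs0 hJt0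
    ((setLIntegral_le_lintegral _ _).trans hIi) ((setLIntegral_le_lintegral _ _).trans hJs)
    ((setLIntegral_le_lintegral _ _).trans hJt)
  have hu1 := huE.1
  have hu2 := huE.2
  have hsu : s < u := by linarith
  have hut : u < t := by linarith
  have hu : u ∈ Icc 0 T := ⟨hs.1.trans hsu.le, hut.le.trans ht.2⟩
  have a1 : |u - s| = u - s := abs_of_pos (by linarith)
  have a2 : |u - t| = t - u := by rw [abs_of_neg (by linarith)]; ring
  have b1 := side s hs hsN Js hJs0 hJs u hu huN hsu.ne' (by rw [a1]; linarith)
    (q1.trans (ENNReal.ofReal_le_ofReal (by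
      rw [a1, div_le_div_iff₀ (by positivity) (by linarith), hM]; nlinarith)))
    (q2.trans (ENNReal.ofReal_le_ofReal (by
      rw [a1, div_le_div_iff₀ (by positivity) (by linarith)]; nlinarith)))
  have b2 := side t ht htN Jt hJt0 hJt u hu huN hut.ne (by rw [a2]; linarith)
    (q1.trans (ENNReal.ofReal_le_ofReal (by
      rw [a2, div_le_div_iff₀ (by positivity) (by linarith), hM]; nlinarith)))
    (q3.trans (ENNReal.ofReal_le_ofReal (by
      rw [a2, div_le_div_iff₀ (by positivity) (by linarith)]; nlinarith)))
  rw [a1, hb, symmExt_comm, symmExt_of_le hsu.le] at b1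
  rw [a2, hb, symmExt_of_le hut.le] at b2
  have c1 : (u - s) ^ θ ≤ (t - s) ^ θ := Real.rpow_le_rpow (by linarith) (by linarith) hθ.le
  have c2 : (t - u) ^ θ ≤ (t - s) ^ θ := Real.rpow_le_rpow (by linarith) (by linarith) hθ.le
  have c3 := htri s u t hs.1 hsu.le hut.le ht.2 hd
  have c4 := mul_le_mul_of_nonneg_left c1 hK₂0
  have c5 := mul_le_mul_of_nonneg_left c2 hK₂0
  linarith

/-! ### Smooth coefficients -/

section Coefficients

variable {E U W : Type*} [NormedAddCommGroup E] [NormedSpace ℝ E] [NormedAddCommGroup U]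
  [NormedSpace ℝ U] [NormedAddCommGroup W] [NormedSpace ℝ W]

set_option linter.unusedSectionVars false

/-- Bounds for a function, its first differences and its second differences. -/
structure SmoothBound (C : ℝ) (G : E → W) : Prop where
  nonneg : 0 ≤ C
  bdd : ∀ x, ‖G x‖ ≤ C
  lip : ∀ x y, ‖G x - G y‖ ≤ C * ‖x - y‖
  second : ∀ a b c d, ‖G a - G b - G c + G d‖ ≤
    C * (‖a - b - c + d‖ + (‖a - b‖ + ‖c - d‖) * (‖a - c‖ + ‖b - d‖))

lemma SmoothBound.mono {C C' : ℝ} {G : E → W} (h : SmoothBound C G) (hC : C ≤ C') :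
    SmoothBound C' G where
  nonneg := h.nonneg.trans hC
  bdd x := (h.bdd x).trans hC
  lip x y := (h.lip x y).trans (by gcongr)
  second a b c d := (h.second a b c d).trans (by gcongr)

lemma SmoothBound.continuous {C : ℝ} {G : E → W}
    (h : SmoothBound C G) : Continuous G :=
  (LipschitzWith.of_dist_le_mul (K := ⟨C, h.nonneg⟩) fun x y => by
    rw [dist_eq_norm, dist_eq_norm]
    exact h.lip x y).continuous

/-- The second difference is compared with that of the parallelogram b, d, b + (a-b), d + (a-b),
where the mean value inequality applies to x ↦ G(b+x) - G(d+x). The remaining vertex c misses the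
parallelogram by exactly a - b - c + d. -/
lemma smoothBound_of_fderiv {C : ℝ} {G : E → W} (hG : ContDiff ℝ 2 G) (h0 : ∀ x, ‖G x‖ ≤ C)
    (h1 : ∀ x, ‖fderiv ℝ G x‖ ≤ C) (h2 : ∀ x, ‖fderiv ℝ (fderiv ℝ G) x‖ ≤ C) :
    SmoothBound C G := by
  have hC : 0 ≤ C := (norm_nonneg _).trans (h0 0)
  have hd : Differentiable ℝ G := hG.differentiable (by norm_num)
  have hd' : Differentiable ℝ (fderiv ℝ G) :=
    (hG.fderiv_right (m := 1) (by norm_num)).differentiable (by norm_num)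
  have lip : ∀ x y, ‖G x - G y‖ ≤ C * ‖x - y‖ := fun x y =>
    Convex.norm_image_sub_le_of_norm_fderiv_le (𝕜 := ℝ) (s := univ) (fun z _ => hd z)
      (fun z _ => h1 z) convex_univ (mem_univ y) (mem_univ x)
  have lip' : ∀ x y, ‖fderiv ℝ G x - fderiv ℝ G y‖ ≤ C * ‖x - y‖ := fun x y =>
    Convex.norm_image_sub_le_of_norm_fderiv_le (𝕜 := ℝ) (s := univ) (fun z _ => hd' z)
      (fun z _ => h2 z) convex_univ (mem_univ y) (mem_univ x)
  refine ⟨hC, h0, lip, fun a b c d => ?_⟩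
  have key : ‖(G (b + (a - b)) - G (d + (a - b))) - (G (b + 0) - G (d + 0))‖ ≤
      C * ‖b - d‖ * ‖(a - b) - 0‖ := by
    refine Convex.norm_image_sub_le_of_norm_hasFDerivWithin_le (𝕜 := ℝ) (s := univ)
      (f := fun x => G (b + x) - G (d + x))
      (f' := fun x => fderiv ℝ G (b + x) - fderiv ℝ G (d + x)) (fun x _ => ?_) (fun x _ => ?_)
      convex_univ (mem_univ _) (mem_univ _)
    · have e1 := (hasFDerivAt_comp_add_left b).2 (hd (b + x)).hasFDerivAt
      have e2 := (hasFDerivAt_comp_add_left d).2 (hd (d + x)).hasFDerivAt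
      exact (e1.sub e2).hasFDerivWithinAt
    · refine (lip' _ _).trans (le_of_eq ?_)
      congr 2
      abel
  rw [add_sub_cancel, add_zero, add_zero, sub_zero] at key
  have h3 := lip (d + (a - b)) c
  have e : G a - G b - G c + G d =
      ((G a - G (d + (a - b))) - (G b - G d)) + (G (d + (a - b)) - G c) := by abel
  have e' : d + (a - b) - c = a - b - c + d := by abel
  rw [e'] at h3
  rw [e]
  refine (norm_add_le _ _).trans ((add_le_add key h3).trans ?_)
  have p1 := norm_nonneg (a - b)
  have p2 := norm_nonneg (c - d)
  have p3 := norm_nonneg (a - c)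
  have p4 := norm_nonneg (b - d)
  have : ‖b - d‖ * ‖a - b‖ ≤ (‖a - b‖ + ‖c - d‖) * (‖a - c‖ + ‖b - d‖) := by nlinarith
  nlinarith

/-- A product rule for second differences. Its purpose is the coefficient Df·f, whose factors are
both bounded in this sense when f has three bounded derivatives. -/
lemma SmoothBound.comp_clm {C : ℝ} {G : E → E →L[ℝ] W} {H : E → U →L[ℝ] E}
    (hG : SmoothBound C G) (hH : SmoothBound C H) :
    SmoothBound (4 * C * C) fun x => (G x).comp (H x) := by
  have hC := hG.nonneg
  have op : ∀ (A : E →L[ℝ] W) (B : U →L[ℝ] E), ‖A.comp B‖ ≤ ‖A‖ * ‖B‖ :=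
    fun A B => A.opNorm_comp_le B
  refine ⟨by positivity, fun x => ?_, fun x y => ?_, fun a b c d => ?_⟩
  · calc ‖(G x).comp (H x)‖ ≤ ‖G x‖ * ‖H x‖ := op _ _
      _ ≤ C * C := mul_le_mul (hG.bdd x) (hH.bdd x) (norm_nonneg _) hC
      _ ≤ _ := by nlinarith
  · have e : (G x).comp (H x) - (G y).comp (H y) =
        (G x - G y).comp (H x) + (G y).comp (H x - H y) := by
      ext v; simp
    rw [e]
    have t1 : ‖(G x - G y).comp (H x)‖ ≤ (C * ‖x - y‖) * C := (op _ _).trans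
      (mul_le_mul (hG.lip x y) (hH.bdd x) (norm_nonneg _) (by positivity))
    have t2 : ‖(G y).comp (H x - H y)‖ ≤ C * (C * ‖x - y‖) := (op _ _).trans
      (mul_le_mul (hG.bdd y) (hH.lip x y) (norm_nonneg _) (by positivity))
    refine (norm_add_le _ _).trans ((add_le_add t1 t2).trans ?_)
    have : 0 ≤ C * C * ‖x - y‖ := by positivity
    nlinarith
  · have e : (G a).comp (H a) - (G b).comp (H b) - (G c).comp (H c) + (G d).comp (H d) =
        (G a - G b - G c + G d).comp (H a) + (G c - G d).comp (H a - H c) +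
        ((G b).comp (H a - H b - H c + H d) + (G b - G d).comp (H c - H d)) := by
      ext v
      simp
      abel
    rw [e]
    set X := ‖a - b - c + d‖ + (‖a - b‖ + ‖c - d‖) * (‖a - c‖ + ‖b - d‖) with hX
    have p1 := norm_nonneg (a - b)
    have p2 := norm_nonneg (c - d)
    have p3 := norm_nonneg (a - c)
    have p4 := norm_nonneg (b - d)
    have p5 := norm_nonneg (a - b - c + d)
    have hX0 : 0 ≤ X := by positivity
    have t1 : ‖(G a - G b - G c + G d).comp (H a)‖ ≤ C * X * C := (op _ _).trans
      (mul_le_mul (hG.second a b c d) (hH.bdd a) (norm_nonneg _) (by positivity))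
    have t2 : ‖(G c - G d).comp (H a - H c)‖ ≤ (C * ‖c - d‖) * (C * ‖a - c‖) := (op _ _).trans
      (mul_le_mul (hG.lip c d) (hH.lip a c) (norm_nonneg _) (by positivity))
    have t3 : ‖(G b).comp (H a - H b - H c + H d)‖ ≤ C * (C * X) := (op _ _).trans
      (mul_le_mul (hG.bdd b) (hH.second a b c d) (norm_nonneg _) (by positivity))
    have t4 : ‖(G b - G d).comp (H c - H d)‖ ≤ (C * ‖b - d‖) * (C * ‖c - d‖) := (op _ _).trans
      (mul_le_mul (hG.lip b d) (hH.lip c d) (norm_nonneg _) (by positivity))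
    have q1 : ‖c - d‖ * ‖a - c‖ ≤ X := by nlinarith
    have q2 : ‖b - d‖ * ‖c - d‖ ≤ X := by nlinarith
    have hCC : 0 ≤ C * C := by positivity
    have r1 := mul_le_mul_of_nonneg_left q1 hCC
    have r2 := mul_le_mul_of_nonneg_left q2 hCC
    refine (norm_add_le _ _).trans ((add_le_add ((norm_add_le _ _).trans (add_le_add t1 t2))
      ((norm_add_le _ _).trans (add_le_add t3 t4))).trans ?_)
    linarith

/-- The coefficient `Df(y) f(y)` of the second-order term. -/
def secondCoeff (f : E → U →L[ℝ] E) (y : E) : U →L[ℝ] U →L[ℝ] E :=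
  (fderiv ℝ f y).comp (f y)

/-- Bounds on the coefficient of a rough differential equation. -/
structure CoeffBound (C : ℝ) (f : E → U →L[ℝ] E) : Prop where
  diff : Differentiable ℝ f
  coeff : SmoothBound C f
  deriv : SmoothBound C (fderiv ℝ f)
  second : SmoothBound C (secondCoeff f)

lemma smoothBound_of_iteratedFDeriv {C : ℝ} {G : E → W} (hG : ContDiff ℝ 2 G)
    (h : ∀ k ≤ 2, ∀ x, ‖iteratedFDeriv ℝ k G x‖ ≤ C) : SmoothBound C G := by
  refine smoothBound_of_fderiv hG (fun x => ?_) (fun x => ?_) (fun x => ?_)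
  · simpa using h 0 (by norm_num) x
  · simpa using h 1 (by norm_num) x
  · have := h 2 le_rfl x
    rwa [← norm_iteratedFDeriv_fderiv, norm_iteratedFDeriv_one] at this

lemma IsCb3.coeffBound {f : E → U →L[ℝ] E} (hf : IsCb3 f) : ∃ C, CoeffBound C f := by
  obtain ⟨hc, hb⟩ := hf
  obtain ⟨C, hC⟩ : ∃ C, ∀ k ≤ 3, ∀ x, ‖iteratedFDeriv ℝ k f x‖ ≤ C := by
    choose! c hc using hb
    refine ⟨∑ k ∈ Finset.range 4, |c k|, fun k hk x => (hc k hk x).trans ?_⟩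
    exact (le_abs_self _).trans (Finset.single_le_sum (f := fun k => |c k|)
      (fun i _ => abs_nonneg _) (Finset.mem_range.2 (by omega)))
  have b1 : SmoothBound C f := smoothBound_of_iteratedFDeriv (hc.of_le (by norm_num))
    fun k hk x => hC k (by omega) x
  have b2 : SmoothBound C (fderiv ℝ f) :=
    smoothBound_of_iteratedFDeriv (hc.fderiv_right (m := 2) (by norm_num)) fun k hk x => by
      rw [norm_iteratedFDeriv_fderiv]
      exact hC (k + 1) (by omega) x
  have hC0 := b1.nonneg
  refine ⟨C + 4 * C * C, hc.differentiable (by norm_num), b1.mono (by nlinarith),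
    b2.mono (by nlinarith), (b2.comp_clm b1).mono (by linarith)⟩

/-- The first-order Taylor remainder. -/
def taylorRem (f : E → W) (y z : E) : W := f z - f y - fderiv ℝ f y (z - y)

/-- The bound is linear in the distance of the two pairs and has one further factor of the
increments, as the comparison of two solutions requires. It is the mean value inequality for θ ↦
f(y+θv) - f(y'+θv') - θ(Df(y)v - Df(y')v') on [0,1]. -/
lemma norm_taylorRem_sub_le {C : ℝ} {f : E → W} (hd : Differentiable ℝ f)
    (h : SmoothBound C (fderiv ℝ f)) (y z y' z' : E) :
    ‖taylorRem f y z - taylorRem f y' z'‖ ≤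
      C * ((‖z - y‖ + ‖z' - y'‖) * ((2 * ‖z - y - (z' - y')‖) +
        (‖z - y‖ + ‖z' - y'‖) * (2 * ‖y - y'‖ + ‖z - y - (z' - y')‖))) := by
  set v := z - y with hv
  set v' := z' - y' with hv'
  have hC := h.nonneg
  have hder : ∀ θ : ℝ, HasDerivAt (fun θ : ℝ => f (y + θ • v) - f (y' + θ • v') -
      θ • (fderiv ℝ f y v - fderiv ℝ f y' v'))
      (fderiv ℝ f (y + θ • v) v - fderiv ℝ f (y' + θ • v') v' -
        (fderiv ℝ f y v - fderiv ℝ f y' v')) θ := by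
    intro θ
    have e : ∀ (x w : E), HasDerivAt (fun θ : ℝ => f (x + θ • w)) (fderiv ℝ f (x + θ • w) w) θ := by
      intro x w
      have l : HasDerivAt (fun θ : ℝ => x + θ • w) w θ := by
        simpa using ((hasDerivAt_id θ).smul_const w).const_add x
      exact (hd (x + θ • w)).hasFDerivAt.comp_hasDerivAt θ l
    have l2 : HasDerivAt (fun θ : ℝ => θ • (fderiv ℝ f y v - fderiv ℝ f y' v'))
        (fderiv ℝ f y v - fderiv ℝ f y' v') θ := by
      simpa using (hasDerivAt_id θ).smul_const (fderiv ℝ f y v - fderiv ℝ f y' v')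
    exact ((e y v).sub (e y' v')).sub l2
  have main := norm_image_sub_le_of_norm_deriv_le_segment_01'
    (fun θ _ => (hder θ).hasDerivWithinAt)
    (C := C * ((‖v‖ + ‖v'‖) * ((2 * ‖v - v'‖) +
        (‖v‖ + ‖v'‖) * (2 * ‖y - y'‖ + ‖v - v'‖)))) ?_
  · have e : taylorRem f y z - taylorRem f y' z' =
        f (y + (1 : ℝ) • v) - f (y' + (1 : ℝ) • v') -
          (1 : ℝ) • (fderiv ℝ f y v - fderiv ℝ f y' v') -
        (f (y + (0 : ℝ) • v) - f (y' + (0 : ℝ) • v') -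
          (0 : ℝ) • (fderiv ℝ f y v - fderiv ℝ f y' v')) := by
      simp only [one_smul, zero_smul, add_zero, sub_zero, taylorRem, ← hv, ← hv']
      rw [hv, hv', add_sub_cancel, add_sub_cancel]
      abel
    rw [e]
    exact main
  intro θ hθ
  have hθ0 := hθ.1
  have hθ1 := hθ.2.le
  have e : fderiv ℝ f (y + θ • v) v - fderiv ℝ f (y' + θ • v') v' -
        (fderiv ℝ f y v - fderiv ℝ f y' v') =
      (fderiv ℝ f (y + θ • v) - fderiv ℝ f y - fderiv ℝ f (y' + θ • v') + fderiv ℝ f y') v +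
        (fderiv ℝ f (y' + θ • v') - fderiv ℝ f y') (v - v') := by
    simp only [sub_apply, add_apply, map_sub]
    abel
  rw [e]
  have s1 := h.second (y + θ • v) y (y' + θ • v') y'
  have s2 := h.lip (y' + θ • v') y'
  have n1 : ‖y + θ • v - y‖ ≤ ‖v‖ := by
    rw [add_sub_cancel_left, norm_smul, Real.norm_of_nonneg hθ0]
    exact mul_le_of_le_one_left (norm_nonneg _) hθ1
  have n2 : ‖y' + θ • v' - y'‖ ≤ ‖v'‖ := by
    rw [add_sub_cancel_left, norm_smul, Real.norm_of_nonneg hθ0]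
    exact mul_le_of_le_one_left (norm_nonneg _) hθ1
  have nθ : ‖θ • (v - v')‖ ≤ ‖v - v'‖ := by
    rw [norm_smul, Real.norm_of_nonneg hθ0]
    exact mul_le_of_le_one_left (norm_nonneg _) hθ1
  have n3 : ‖y + θ • v - y - (y' + θ • v') + y'‖ ≤ ‖v - v'‖ := by
    have : y + θ • v - y - (y' + θ • v') + y' = θ • (v - v') := by
      clear_value v v'
      rw [smul_sub]
      abel
    rw [this]
    exact nθ
  have n4 : ‖y + θ • v - (y' + θ • v')‖ ≤ ‖y - y'‖ + ‖v - v'‖ := by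
    have : y + θ • v - (y' + θ • v') = (y - y') + θ • (v - v') := by
      clear_value v v'
      rw [smul_sub]
      abel
    rw [this]
    exact (norm_add_le _ _).trans (by linarith)
  have p1 := norm_nonneg v
  have p2 := norm_nonneg v'
  have p3 := norm_nonneg (v - v')
  have p4 := norm_nonneg (y - y')
  have b1 : ‖fderiv ℝ f (y + θ • v) - fderiv ℝ f y - fderiv ℝ f (y' + θ • v') + fderiv ℝ f y'‖ ≤
      C * (‖v - v'‖ + (‖v‖ + ‖v'‖) * (2 * ‖y - y'‖ + ‖v - v'‖)) := by
    have n5 : ‖y + θ • v - (y' + θ • v')‖ + ‖y - y'‖ ≤ 2 * ‖y - y'‖ + ‖v - v'‖ := by linarith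
    exact s1.trans (mul_le_mul_of_nonneg_left (add_le_add n3 (mul_le_mul (add_le_add n1 n2) n5
      (by positivity) (by positivity))) hC)
  have b2 : ‖fderiv ℝ f (y' + θ • v') - fderiv ℝ f y'‖ ≤ C * ‖v'‖ := s2.trans (by gcongr)
  refine (norm_add_le _ _).trans ((add_le_add
    ((ContinuousLinearMap.le_opNorm _ _).trans (mul_le_mul_of_nonneg_right b1 p1))
    ((ContinuousLinearMap.le_opNorm _ _).trans (mul_le_mul_of_nonneg_right b2 p3))).trans ?_)
  have h5 : 0 ≤ C * ‖v - v'‖ * ‖v‖ := by positivity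
  have h6 : 0 ≤ C * ‖v - v'‖ * ‖v'‖ := by positivity
  have h7 : 0 ≤ C * ((‖v‖ + ‖v'‖) * (2 * ‖y - y'‖ + ‖v - v'‖)) * ‖v'‖ := by positivity
  nlinarith

lemma norm_taylorRem_le {C : ℝ} {f : E → W} (hd : Differentiable ℝ f)
    (h : SmoothBound C (fderiv ℝ f)) (y z : E) : ‖taylorRem f y z‖ ≤ C * ‖z - y‖ ^ 2 := by
  have hder : ∀ x ∈ segment ℝ y z,
      HasFDerivWithinAt (fun x => f x - fderiv ℝ f y x) (fderiv ℝ f x - fderiv ℝ f y)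
        (segment ℝ y z) x := fun x _ =>
    ((hd x).hasFDerivAt.sub (fderiv ℝ f y).hasFDerivAt).hasFDerivWithinAt
  have := Convex.norm_image_sub_le_of_norm_hasFDerivWithin_le (C := C * ‖z - y‖) hder
    (fun x hx => (h.lip x y).trans (mul_le_mul_of_nonneg_left
      (norm_sub_le_of_mem_segment hx) h.nonneg))
    (convex_segment y z) (left_mem_segment ℝ y z) (right_mem_segment ℝ y z)
  have e : taylorRem f y z = f z - fderiv ℝ f y z - (f y - fderiv ℝ f y y) := by
    simp only [taylorRem, map_sub]
    abel
  rw [e]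
  refine this.trans (le_of_eq ?_)
  ring

end Coefficients

/-! ### Rough differential equations in Hölder spaces -/

/-- The contraction factor `2^{1-3θ}` of the sewing lemma. -/
def sewFactor (θ : ℝ) : ℝ := 2 * ((1 / 2) ^ θ) ^ 3

lemma sewFactor_pos (θ : ℝ) : 0 < sewFactor θ := by
  unfold sewFactor
  positivity

lemma cube_rpow {x θ : ℝ} (hx : 0 ≤ x) : (x ^ θ) ^ 3 = x ^ (3 * θ) := by
  rw [← Real.rpow_natCast, ← Real.rpow_mul hx, mul_comm]
  norm_num

lemma sewFactor_lt_one {θ : ℝ} (hθ : 1 / 3 < θ) : sewFactor θ < 1 := by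
  unfold sewFactor
  rw [cube_rpow (by norm_num)]
  have : (1 / 2 : ℝ) ^ (3 * θ) < (1 / 2) ^ (1 : ℝ) :=
    Real.rpow_lt_rpow_of_exponent_gt (by norm_num) (by norm_num) (by linarith)
  rw [Real.rpow_one] at this
  linarith

/-- Halving the interval replaces a bound with constant K by one with constant D + κK, where κ < 1.
The a priori constant is thus forgotten in the limit. -/
lemma norm_le_of_sewing {V : Type*} [NormedAddCommGroup V] {a b θ K D : ℝ} (hθ : 1 / 3 < θ)
    (hD : 0 ≤ D) {N : ℝ → ℝ → V}
    (hN : ∀ s t, a ≤ s → s ≤ t → t ≤ b → ‖N s t‖ ≤ K * ((t - s) ^ θ) ^ 3)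
    (hδ : ∀ s u t, a ≤ s → s ≤ u → u ≤ t → t ≤ b →
      ‖N s t - N s u - N u t‖ ≤ D * ((t - s) ^ θ) ^ 3)
    {s t : ℝ} (hs : a ≤ s) (hst : s ≤ t) (ht : t ≤ b) :
    ‖N s t‖ ≤ D / (1 - sewFactor θ) * ((t - s) ^ θ) ^ 3 := by
  have h1 : 0 < 1 - sewFactor θ := by linarith [sewFactor_lt_one hθ]
  set κ := sewFactor θ with hκ
  have ind : ∀ n : ℕ, ∀ s t, a ≤ s → s ≤ t → t ≤ b →
      ‖N s t‖ ≤ (κ ^ n * |K| + D / (1 - κ)) * ((t - s) ^ θ) ^ 3 := by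
    intro n
    induction n with
    | zero =>
      intro s t hs hst ht
      refine (hN s t hs hst ht).trans ?_
      have : 0 ≤ D / (1 - κ) := div_nonneg hD h1.le
      have := le_abs_self K
      gcongr
      simp only [pow_zero, one_mul]
      linarith
    | succ n ih =>
      intro s t hs hst ht
      set u := (s + t) / 2 with hu
      have hsu : s ≤ u := by rw [hu]; linarith
      have hut : u ≤ t := by rw [hu]; linarith
      have e1 : u - s = 1 / 2 * (t - s) := by rw [hu]; ring
      have e2 : t - u = 1 / 2 * (t - s) := by rw [hu]; ring
      have i1 := ih s u hs hsu (hut.trans ht)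
      have i2 := ih u t (hs.trans hsu) hut ht
      rw [e1, Real.mul_rpow (by norm_num) (by linarith), mul_pow] at i1
      rw [e2, Real.mul_rpow (by norm_num) (by linarith), mul_pow] at i2
      have e : N s t = (N s t - N s u - N u t) + N s u + N u t := by abel
      rw [e]
      refine (norm_add₃_le).trans ((add_le_add (add_le_add (hδ s u t hs hsu hut ht) i1)
        i2).trans (le_of_eq ?_))
      have e3 : D / (1 - κ) = D + κ * (D / (1 - κ)) := by
        field_simp
        ring
      rw [pow_succ κ n]
      calc _ = (D + κ * (κ ^ n * |K| + D / (1 - κ))) * ((t - s) ^ θ) ^ 3 := by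
            rw [hκ]
            unfold sewFactor
            ring
        _ = (κ ^ n * κ * |K| + (D + κ * (D / (1 - κ)))) * ((t - s) ^ θ) ^ 3 := by ring
        _ = _ := by rw [← e3]
  have hlim : Tendsto (fun n : ℕ => (κ ^ n * |K| + D / (1 - κ)) * ((t - s) ^ θ) ^ 3) atTop
      (𝓝 ((0 * |K| + D / (1 - κ)) * ((t - s) ^ θ) ^ 3)) :=
    (((tendsto_pow_atTop_nhds_zero_of_lt_one (sewFactor_pos θ).le
      (sewFactor_lt_one hθ)).mul_const _).add_const _).mul_const _
  rw [zero_mul, zero_add] at hlim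
  exact ge_of_tendsto' hlim fun n => ind n s t hs hst ht

section Davie

set_option maxSynthPendingDepth 3

variable {E U : Type*} [NormedAddCommGroup E] [NormedSpace ℝ E] [NormedAddCommGroup U]
  [NormedSpace ℝ U]

/-- A rough path of Hölder regularity `θ`, whose second level acts on bilinear maps. -/
structure RoughBound (T θ A : ℝ) (X : ℝ → U)
    (XX : ℝ → ℝ → (U →L[ℝ] U →L[ℝ] E) →L[ℝ] E) : Prop where
  nonneg : 0 ≤ A
  path : ∀ s t, 0 ≤ s → s ≤ t → t ≤ T → ‖X t - X s‖ ≤ A * (t - s) ^ θ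
  area : ∀ s t, 0 ≤ s → s ≤ t → t ≤ T → ‖XX s t‖ ≤ A * ((t - s) ^ θ) ^ 2
  chen : ∀ s u t, 0 ≤ s → s ≤ u → u ≤ t → t ≤ T → ∀ B,
    XX s t B = XX s u B + XX u t B + B (X u - X s) (X t - X u)

/-- One step of the second-order Euler scheme. -/
def davieStep (f : E → U →L[ℝ] E) (X : ℝ → U) (XX : ℝ → ℝ → (U →L[ℝ] U →L[ℝ] E) →L[ℝ] E)
    (s t : ℝ) (y : E) : E :=
  y + f y (X t - X s) + XX s t (secondCoeff f y)

/-- The failure of additivity of the local error of the second-order Euler scheme. -/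
def davieDefect (f : E → U →L[ℝ] E) (X : ℝ → U) (XX : ℝ → ℝ → (U →L[ℝ] U →L[ℝ] E) →L[ℝ] E)
    (s u t : ℝ) (y z : E) : E :=
  (f z - f y - secondCoeff f y (X u - X s)) (X t - X u) +
    XX u t (secondCoeff f z - secondCoeff f y)

/-- The local error of the second-order Euler scheme is of order `|t-s|^{3θ}` along `Y`. -/
def IsDavie (T θ L : ℝ) (f : E → U →L[ℝ] E) (X : ℝ → U)
    (XX : ℝ → ℝ → (U →L[ℝ] U →L[ℝ] E) →L[ℝ] E) (Y : ℝ → E) : Prop :=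
  ∀ s t, 0 ≤ s → s ≤ t → t ≤ T → ‖Y t - davieStep f X XX s t (Y s)‖ ≤ L * ((t - s) ^ θ) ^ 3

variable {T θ A C : ℝ} {f : E → U →L[ℝ] E} {X : ℝ → U}
  {XX : ℝ → ℝ → (U →L[ℝ] U →L[ℝ] E) →L[ℝ] E}

/-- Chen's relation cancels the product of increments that the second level produces, so the local
error is additive up to a defect of third order. -/
lemma sub_davieStep (hX : RoughBound T θ A X XX) {s u t : ℝ} (hs : 0 ≤ s) (hsu : s ≤ u)
    (hut : u ≤ t) (ht : t ≤ T) (x y z : E) :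
    z - davieStep f X XX s t x = (y - davieStep f X XX s u x) + (z - davieStep f X XX u t y) +
      davieDefect f X XX s u t x y := by
  have h := hX.chen s u t hs hsu hut ht (secondCoeff f x)
  have e : X t - X s = (X u - X s) + (X t - X u) := by abel
  simp only [davieStep, davieDefect, h, sub_apply, map_sub, e, map_add]
  abel

/-- Exhibits the expression as second order: a Taylor remainder, quadratic in z - y, and the
derivative applied to the first-order remainder of the path. -/
lemma coeff_sub_eq (s u : ℝ) (y z : E) :
    f z - f y - secondCoeff f y (X u - X s) =
      taylorRem f y z + fderiv ℝ f y (z - y - f y (X u - X s)) := by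
  have : secondCoeff f y (X u - X s) = fderiv ℝ f y (f y (X u - X s)) := rfl
  rw [this, taylorRem, map_sub (fderiv ℝ f y) (z - y)]
  abel

lemma norm_davieDefect_le (hf : CoeffBound C f) {s u t η δ ρ : ℝ} {y z : E} (hA : 0 ≤ A)
    (h1 : ‖X t - X u‖ ≤ A * η) (h2 : ‖XX u t‖ ≤ A * η ^ 2) (h3 : ‖z - y‖ ≤ δ)
    (h4 : ‖z - y - f y (X u - X s)‖ ≤ ρ) :
    ‖davieDefect f X XX s u t y z‖ ≤
      (C * δ ^ 2 + C * ρ) * (A * η) + A * η ^ 2 * (C * δ) := by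
  have hC := hf.coeff.nonneg
  have hδ := (norm_nonneg _).trans h3
  have hρ := (norm_nonneg _).trans h4
  unfold davieDefect
  refine (norm_add_le _ _).trans (add_le_add ?_ ?_)
  · refine (ContinuousLinearMap.le_opNorm _ _).trans
      (mul_le_mul ?_ h1 (norm_nonneg _) (by positivity))
    rw [coeff_sub_eq]
    refine (norm_add_le _ _).trans (add_le_add ?_ ?_)
    · exact (norm_taylorRem_le hf.diff hf.deriv y z).trans (by gcongr)
    · exact (ContinuousLinearMap.le_opNorm _ _).trans
        (mul_le_mul (hf.deriv.bdd y) h4 (norm_nonneg _) hC)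
  · refine (ContinuousLinearMap.le_opNorm _ _).trans
      (mul_le_mul h2 ?_ (norm_nonneg _) (by positivity))
    exact (hf.second.lip z y).trans (by gcongr)

lemma norm_rem_le (hX : RoughBound T θ A X XX) (hf : CoeffBound C f) {s t L : ℝ} (hs : 0 ≤ s)
    (hst : s ≤ t) (ht : t ≤ T) {y z : E}
    (h : ‖z - davieStep f X XX s t y‖ ≤ L * ((t - s) ^ θ) ^ 3) :
    ‖z - y - f y (X t - X s)‖ ≤ (A * C + L * (t - s) ^ θ) * ((t - s) ^ θ) ^ 2 := by
  have e : z - y - f y (X t - X s) =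
      XX s t (secondCoeff f y) + (z - davieStep f X XX s t y) := by
    simp only [davieStep]
    abel
  have h2 : ‖XX s t (secondCoeff f y)‖ ≤ A * ((t - s) ^ θ) ^ 2 * C :=
    (ContinuousLinearMap.le_opNorm _ _).trans (mul_le_mul (hX.area s t hs hst ht)
      (hf.second.bdd y) (norm_nonneg _) (mul_nonneg hX.nonneg (by positivity)))
  rw [e]
  refine (norm_add_le _ _).trans ((add_le_add h2 h).trans (le_of_eq ?_))
  ring

lemma norm_sub_le_of_rem (hX : RoughBound T θ A X XX) (hf : CoeffBound C f) {s t ρ : ℝ}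
    (hs : 0 ≤ s) (hst : s ≤ t) (ht : t ≤ T) {y z : E}
    (h : ‖z - y - f y (X t - X s)‖ ≤ ρ * ((t - s) ^ θ) ^ 2) :
    ‖z - y‖ ≤ (C * A + ρ * (t - s) ^ θ) * (t - s) ^ θ := by
  have hC := hf.coeff.nonneg
  have e : z - y = f y (X t - X s) + (z - y - f y (X t - X s)) := by abel
  have h2 : ‖f y (X t - X s)‖ ≤ C * (A * (t - s) ^ θ) :=
    (ContinuousLinearMap.le_opNorm _ _).trans (mul_le_mul (hf.coeff.bdd y)
      (hX.path s t hs hst ht) (norm_nonneg _) hC)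
  rw [e]
  refine (norm_add_le _ _).trans ((add_le_add h2 h).trans (le_of_eq ?_))
  ring

lemma rpow_sub_le {θ a b c d : ℝ} (hθ : 0 ≤ θ) (h : 0 ≤ b - a) (hac : c ≤ a) (hbd : b ≤ d) :
    (b - a) ^ θ ≤ (d - c) ^ θ :=
  Real.rpow_le_rpow h (by linarith) hθ

/-! #### Uniqueness -/

lemma IsDavie.norm_rem_le (hX : RoughBound T θ A X XX) (hf : CoeffBound C f) (hθ : 0 ≤ θ)
    {L : ℝ} (hL : 0 ≤ L)
    {Y : ℝ → E} (hY : IsDavie T θ L f X XX Y) {s t : ℝ} (hs : 0 ≤ s) (hst : s ≤ t) (ht : t ≤ T) :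
    ‖Y t - Y s - f (Y s) (X t - X s)‖ ≤ (A * C + L * T ^ θ) * ((t - s) ^ θ) ^ 2 := by
  refine (BesovOrlicz.norm_rem_le hX hf hs hst ht (hY s t hs hst ht)).trans ?_
  have : (t - s) ^ θ ≤ T ^ θ := Real.rpow_le_rpow (by linarith) (by linarith) hθ
  gcongr

lemma IsDavie.norm_sub_le (hX : RoughBound T θ A X XX) (hf : CoeffBound C f) (hθ : 0 ≤ θ)
    {L : ℝ} (hL : 0 ≤ L)
    {Y : ℝ → E} (hY : IsDavie T θ L f X XX Y) {s t : ℝ} (hs : 0 ≤ s) (hst : s ≤ t) (ht : t ≤ T) :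
    ‖Y t - Y s‖ ≤ (C * A + (A * C + L * T ^ θ) * T ^ θ) * (t - s) ^ θ := by
  refine (norm_sub_le_of_rem hX hf hs hst ht (hY.norm_rem_le hX hf hθ hL hs hst ht)).trans ?_
  have hC := hf.coeff.nonneg
  have hA := hX.nonneg
  have hT : 0 ≤ T := by linarith
  have : (t - s) ^ θ ≤ T ^ θ := Real.rpow_le_rpow (by linarith) (by linarith) hθ
  gcongr

/-- Every term on the right carries one of the differences D, e, ρ between the two solutions. -/
lemma norm_davieDefect_sub_le (hf : CoeffBound C f) {s u t η σ D e ρ ρ' : ℝ} {y z y' z' : E}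
    (hA : 0 ≤ A)
    (h1 : ‖X t - X u‖ ≤ A * η) (h2 : ‖XX u t‖ ≤ A * η ^ 2)
    (hz : ‖z - y‖ ≤ σ) (hz' : ‖z' - y'‖ ≤ σ) (hD : ‖y - y'‖ ≤ D)
    (he : ‖z - y - (z' - y')‖ ≤ e)
    (hr : ‖z - y - f y (X u - X s) - (z' - y' - f y' (X u - X s))‖ ≤ ρ)
    (hr' : ‖z' - y' - f y' (X u - X s)‖ ≤ ρ') :
    ‖davieDefect f X XX s u t y z - davieDefect f X XX s u t y' z'‖ ≤
      (C * (2 * σ * (2 * e + 2 * σ * (2 * D + e))) + (C * ρ + C * D * ρ')) * (A * η) +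
        A * η ^ 2 * (C * (e + 2 * σ * (2 * D + e))) := by
  have hC := hf.coeff.nonneg
  have hσ := (norm_nonneg _).trans hz
  have hD0 := (norm_nonneg _).trans hD
  have he0 := (norm_nonneg _).trans he
  have hρ := (norm_nonneg _).trans hr
  have hρ' := (norm_nonneg _).trans hr'
  have id : davieDefect f X XX s u t y z - davieDefect f X XX s u t y' z' =
      ((taylorRem f y z - taylorRem f y' z') +
        (fderiv ℝ f y (z - y - f y (X u - X s) - (z' - y' - f y' (X u - X s))) +
          (fderiv ℝ f y - fderiv ℝ f y') (z' - y' - f y' (X u - X s)))) (X t - X u) +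
      XX u t (secondCoeff f z - secondCoeff f y - secondCoeff f z' + secondCoeff f y') := by
    unfold davieDefect
    rw [coeff_sub_eq, coeff_sub_eq]
    simp only [sub_apply, add_apply, map_sub, map_add]
    abel
  rw [id]
  refine (norm_add_le _ _).trans (add_le_add ?_ ?_)
  · refine (ContinuousLinearMap.le_opNorm _ _).trans
      (mul_le_mul ?_ h1 (norm_nonneg _) (by positivity))
    refine (norm_add_le _ _).trans (add_le_add ?_ ((norm_add_le _ _).trans (add_le_add ?_ ?_)))
    · refine (norm_taylorRem_sub_le hf.diff hf.deriv y z y' z').trans ?_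
      have : ‖z - y‖ + ‖z' - y'‖ ≤ 2 * σ := by linarith
      gcongr
    · exact (ContinuousLinearMap.le_opNorm _ _).trans
        (mul_le_mul (hf.deriv.bdd y) hr (norm_nonneg _) hC)
    · exact (ContinuousLinearMap.le_opNorm _ _).trans
        (mul_le_mul ((hf.deriv.lip y y').trans (by gcongr)) hr' (norm_nonneg _) (by positivity))
  · refine (ContinuousLinearMap.le_opNorm _ _).trans
      (mul_le_mul h2 ?_ (norm_nonneg _) (by positivity))
    refine (hf.second.second z y z' y').trans ?_
    have e1 : z - y - z' + y' = z - y - (z' - y') := by abel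
    have e2 : z - z' = (z - y - (z' - y')) + (y - y') := by abel
    have n2 : ‖z - z'‖ + ‖y - y'‖ ≤ 2 * D + e := by
      have : ‖z - z'‖ ≤ e + D := by
        rw [e2]
        exact (norm_add_le _ _).trans (add_le_add he hD)
      linarith
    have n1 : ‖z - y‖ + ‖z' - y'‖ ≤ 2 * σ := by linarith
    rw [e1]
    gcongr

set_option maxHeartbeats 1000000 in
/-- Two solutions that agree at `a` agree on a short interval starting at `a`. -/
lemma exists_davie_local_unique (hT : 0 < T) (hθ : 1 / 3 < θ) (hX : RoughBound T θ A X XX)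
    (hf : CoeffBound C f) {L : ℝ} (hL : 0 ≤ L) {Y Z : ℝ → E} (hY : IsDavie T θ L f X XX Y)
    (hZ : IsDavie T θ L f X XX Z) :
    ∃ ρ : ℝ, 0 < ρ ∧ ∀ a b, 0 ≤ a → a ≤ b → b ≤ T → (b - a) ^ θ ≤ ρ → Y a = Z a →
      ∀ t ∈ Icc a b, Y t = Z t := by
  have hθ0 : 0 ≤ θ := by linarith
  have hC := hf.coeff.nonneg
  have hA := hX.nonneg
  set c₁ := C * A + (A * C + L * T ^ θ) * T ^ θ with hc₁
  set c₂ := A * C + L * T ^ θ with hc₂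
  have hTθ : 0 ≤ T ^ θ := Real.rpow_nonneg hT.le θ
  have hc₂0 : 0 ≤ c₂ := by positivity
  have hc₁0 : 0 ≤ c₁ := by positivity
  set c₃ := 2 * C * A + 1 with hc₃
  have hc₃0 : 0 ≤ c₃ := by positivity
  set c₄ := (C * (2 * c₁ * (2 * c₃ + 2 * c₁ * (2 + c₃))) + (C * c₃ + C * c₂)) * A +
    A * (C * (c₃ + 2 * c₁ * (2 + c₃))) with hc₄
  have hc₄0 : 0 ≤ c₄ := by positivity
  have hκ : 0 < 1 - sewFactor θ := by linarith [sewFactor_lt_one hθ]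
  -- Chosen so that the sewing lemma, applied to a defect of size c₄ ρ K, returns a constant at most
  -- K/2.
  set ρ₀ := min 1 ((1 - sewFactor θ) / (2 * (c₄ + 1))) with hρ₀
  have hρ₀0 : 0 < ρ₀ := lt_min one_pos (by positivity)
  refine ⟨ρ₀, hρ₀0, fun a b ha hab hbT hba heq => ?_⟩
  set ρ := (b - a) ^ θ with hρ
  have hρ1 : ρ ≤ 1 := hba.trans (min_le_left _ _)
  have hρ0 : 0 ≤ ρ := Real.rpow_nonneg (by linarith) θ
  have hρκ : c₄ * ρ / (1 - sewFactor θ) ≤ 1 / 2 := by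
    have : ρ ≤ (1 - sewFactor θ) / (2 * (c₄ + 1)) := hba.trans (min_le_right _ _)
    rw [le_div_iff₀ (by positivity)] at this
    rw [div_le_iff₀ hκ]
    linarith
  set N : ℝ → ℝ → E := fun s t =>
    (Y t - davieStep f X XX s t (Y s)) - (Z t - davieStep f X XX s t (Z s)) with hN
  -- A bound with constant K on the difference N of the local errors improves to K/2. Since Y and Z
  -- agree at a, N(a, s) is Y_s - Z_s itself, so K controls the distance of the solutions as well as
  -- that of their remainders. Every difference in the defect then has a factor Kρ.
  have step : ∀ K : ℝ, 0 ≤ K →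
      (∀ s t, a ≤ s → s ≤ t → t ≤ b → ‖N s t‖ ≤ K * ((t - s) ^ θ) ^ 3) →
      ∀ s t, a ≤ s → s ≤ t → t ≤ b → ‖N s t‖ ≤ K / 2 * ((t - s) ^ θ) ^ 3 := by
    intro K hK hNK
    have hδ : ∀ s u t, a ≤ s → s ≤ u → u ≤ t → t ≤ b →
        ‖N s t - N s u - N u t‖ ≤ c₄ * ρ * K * ((t - s) ^ θ) ^ 3 := by
      intro s u t hs hsu hut ht
      have hs0 : 0 ≤ s := ha.trans hs
      have hu0 : 0 ≤ u := hs0.trans hsu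
      have htT : t ≤ T := ht.trans hbT
      have huT : u ≤ T := hut.trans htT
      set η := (t - s) ^ θ with hη
      have hη0 : 0 ≤ η := Real.rpow_nonneg (by linarith) θ
      have hηρ : η ≤ ρ := rpow_sub_le hθ0 (by linarith) hs ht
      have hsuη : (u - s) ^ θ ≤ η := rpow_sub_le hθ0 (by linarith) le_rfl hut
      have hutη : (t - u) ^ θ ≤ η := rpow_sub_le hθ0 (by linarith) hsu le_rfl
      have hsu0 : 0 ≤ (u - s) ^ θ := Real.rpow_nonneg (by linarith) θ
      have hut0 : 0 ≤ (t - u) ^ θ := Real.rpow_nonneg (by linarith) θ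
      have hdiff : ‖Y s - Z s‖ ≤ K * ρ ^ 3 := by
        have h := hNK a s le_rfl hs (hsu.trans (hut.trans ht))
        have e : N a s = Y s - Z s := by
          simp only [hN, heq]
          abel
        rw [e] at h
        refine h.trans ?_
        have : (s - a) ^ θ ≤ ρ := rpow_sub_le hθ0 (by linarith) le_rfl (by linarith)
        have : 0 ≤ (s - a) ^ θ := Real.rpow_nonneg (by linarith) θ
        gcongr
      have hNsu : ‖N s u‖ ≤ K * η ^ 3 :=
        (hNK s u hs hsu (hut.trans ht)).trans (by gcongr)
      have x1 : ‖X u - X s‖ ≤ A * η := (hX.path s u hs0 hsu huT).trans (by gcongr)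
      have x2 : ‖XX s u‖ ≤ A * η ^ 2 := (hX.area s u hs0 hsu huT).trans (by gcongr)
      have x3 : ‖X t - X u‖ ≤ A * η := (hX.path u t hu0 hut htT).trans (by gcongr)
      have x4 : ‖XX u t‖ ≤ A * η ^ 2 := (hX.area u t hu0 hut htT).trans (by gcongr)
      have y1 : ‖Y u - Y s‖ ≤ c₁ * η := (hY.norm_sub_le hX hf hθ0 hL hs0 hsu huT).trans (by gcongr)
      have z1 : ‖Z u - Z s‖ ≤ c₁ * η := (hZ.norm_sub_le hX hf hθ0 hL hs0 hsu huT).trans (by gcongr)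
      have z2 : ‖Z u - Z s - f (Z s) (X u - X s)‖ ≤ c₂ * η ^ 2 :=
        (hZ.norm_rem_le hX hf hθ0 hL hs0 hsu huT).trans (by gcongr)
      have hXXd : ‖XX s u (secondCoeff f (Y s) - secondCoeff f (Z s))‖ ≤
          A * η ^ 2 * (C * (K * ρ ^ 3)) :=
        (ContinuousLinearMap.le_opNorm _ _).trans (mul_le_mul x2
          ((hf.second.lip _ _).trans (by gcongr)) (norm_nonneg _) (by positivity))
      have r1 : ‖Y u - Y s - f (Y s) (X u - X s) - (Z u - Z s - f (Z s) (X u - X s))‖ ≤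
          c₃ * K * ρ * η ^ 2 := by
        have e : Y u - Y s - f (Y s) (X u - X s) - (Z u - Z s - f (Z s) (X u - X s)) =
            XX s u (secondCoeff f (Y s) - secondCoeff f (Z s)) + N s u := by
          simp only [hN, davieStep, map_sub]
          abel
        rw [e]
        refine (norm_add_le _ _).trans ((add_le_add hXXd hNsu).trans ?_)
        have q1 : ρ ^ 3 ≤ ρ := pow_le_of_le_one hρ0 hρ1 (by norm_num)
        have q2 : A * η ^ 2 * (C * (K * ρ ^ 3)) ≤ A * η ^ 2 * (C * (K * ρ)) := by gcongr
        have q3 : K * η ^ 3 ≤ K * (ρ * η ^ 2) := by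
          rw [pow_succ' η 2]
          gcongr
        have q4 : 0 ≤ A * C * (K * ρ * η ^ 2) := by positivity
        rw [hc₃]
        linarith
      have d1 : ‖Y u - Y s - (Z u - Z s)‖ ≤ c₃ * K * ρ * η := by
        have e : Y u - Y s - (Z u - Z s) = (f (Y s) - f (Z s)) (X u - X s) +
            XX s u (secondCoeff f (Y s) - secondCoeff f (Z s)) + N s u := by
          simp only [hN, davieStep, map_sub, sub_apply]
          abel
        have g1 : ‖(f (Y s) - f (Z s)) (X u - X s)‖ ≤ C * (K * ρ ^ 3) * (A * η) :=
          (ContinuousLinearMap.le_opNorm _ _).trans (mul_le_mul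
            ((hf.coeff.lip _ _).trans (by gcongr)) x1 (norm_nonneg _) (by positivity))
        rw [e]
        refine norm_add₃_le.trans ((add_le_add (add_le_add g1 hXXd) hNsu).trans ?_)
        have q1 : ρ ^ 3 ≤ ρ := pow_le_of_le_one hρ0 hρ1 (by norm_num)
        have hη1 : η ≤ 1 := hηρ.trans hρ1
        have q5 : η ^ 2 ≤ η := pow_le_of_le_one hη0 hη1 (by norm_num)
        have q2 : A * η ^ 2 * (C * (K * ρ ^ 3)) ≤ A * η * (C * (K * ρ)) := by gcongr
        have q6 : C * (K * ρ ^ 3) * (A * η) ≤ C * (K * ρ) * (A * η) := by gcongr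
        have q3 : K * η ^ 3 ≤ K * (ρ * η) := by
          have : η ^ 3 ≤ ρ * η := by
            calc η ^ 3 = η * η ^ 2 := by ring
              _ ≤ ρ * η := by gcongr
          gcongr
        rw [hc₃]
        linarith
      have hdiff' : ‖Y s - Z s‖ ≤ K * ρ := hdiff.trans (by
        gcongr
        exact pow_le_of_le_one hρ0 hρ1 (by norm_num))
      have hdef := norm_davieDefect_sub_le (X := X) (XX := XX) (s := s) hf hA x3 x4 y1 z1
        hdiff' d1 r1 z2
      have e : N s t - N s u - N u t =
          davieDefect f X XX s u t (Y s) (Y u) - davieDefect f X XX s u t (Z s) (Z u) := by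
        have e1 := sub_davieStep (f := f) hX hs0 hsu hut htT (Y s) (Y u) (Y t)
        have e2 := sub_davieStep (f := f) hX hs0 hsu hut htT (Z s) (Z u) (Z t)
        simp only [hN, e1, e2]
        abel
      rw [e]
      refine hdef.trans ?_
      have hη1 : η ≤ 1 := hηρ.trans hρ1
      have m1 : 2 * (K * ρ) + c₃ * K * ρ * η ≤ (2 + c₃) * (K * ρ) := by
        have : c₃ * K * ρ * η ≤ c₃ * K * ρ * 1 := by gcongr
        linarith
      calc _ ≤ (C * (2 * (c₁ * η) * (2 * (c₃ * K * ρ * η) + 2 * (c₁ * η) * ((2 + c₃) * (K * ρ)))) +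
              (C * (c₃ * K * ρ * η ^ 2) + C * (K * ρ) * (c₂ * η ^ 2))) * (A * η) +
            A * η ^ 2 * (C * (c₃ * K * ρ * η + 2 * (c₁ * η) * ((2 + c₃) * (K * ρ)))) := by gcongr
        _ = c₄ * ρ * K * η ^ 3 := by
            rw [hc₄]
            ring
    intro s t hs hst ht
    refine (norm_le_of_sewing hθ (by positivity) hNK hδ hs hst ht).trans ?_
    have : c₄ * ρ * K / (1 - sewFactor θ) ≤ K / 2 := by
      calc c₄ * ρ * K / (1 - sewFactor θ) = c₄ * ρ / (1 - sewFactor θ) * K := by ring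
        _ ≤ 1 / 2 * K := by gcongr
        _ = K / 2 := by ring
    have : 0 ≤ ((t - s) ^ θ) ^ 3 := pow_nonneg (Real.rpow_nonneg (by linarith) θ) 3
    gcongr
  have iter : ∀ n : ℕ, ∀ s t, a ≤ s → s ≤ t → t ≤ b →
      ‖N s t‖ ≤ 2 * L / 2 ^ n * ((t - s) ^ θ) ^ 3 := by
    intro n
    induction n with
    | zero =>
      intro s t hs hst ht
      refine (norm_sub_le _ _).trans ((add_le_add (hY s t (ha.trans hs) hst (ht.trans hbT))
        (hZ s t (ha.trans hs) hst (ht.trans hbT))).trans (le_of_eq ?_))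
      ring
    | succ n ih =>
      intro s t hs hst ht
      have := step (2 * L / 2 ^ n) (by positivity) ih s t hs hst ht
      rwa [pow_succ, ← div_div]
  intro t ht
  have hzero : ‖N a t‖ ≤ 0 := by
    have hlim : Tendsto (fun n : ℕ => 2 * L / 2 ^ n * ((t - a) ^ θ) ^ 3) atTop
        (𝓝 (0 * ((t - a) ^ θ) ^ 3)) := by
      refine Tendsto.mul_const _ ?_
      exact tendsto_const_nhds.div_atTop (tendsto_pow_atTop_atTop_of_one_lt one_lt_two)
    rw [zero_mul] at hlim
    exact ge_of_tendsto' hlim fun n => iter n a t le_rfl ht.1 ht.2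
  have e : N a t = Y t - Z t := by
    simp only [hN, heq]
    abel
  rw [e] at hzero
  exact sub_eq_zero.1 (norm_le_zero_iff.1 hzero)

/-- The local result allows intervals of a fixed length, so finitely many of them cover [0,T]. -/
theorem IsDavie.eqOn (hT : 0 < T) (hθ : 1 / 3 < θ) (hX : RoughBound T θ A X XX)
    (hf : CoeffBound C f) {L L' : ℝ} {Y Z : ℝ → E} (hY : IsDavie T θ L f X XX Y)
    (hZ : IsDavie T θ L' f X XX Z) (h0 : Y 0 = Z 0) : EqOn Y Z (Icc 0 T) := by
  have up : ∀ {L : ℝ} {Y : ℝ → E}, IsDavie T θ L f X XX Y → ∀ L'', L ≤ L'' →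
      IsDavie T θ L'' f X XX Y := fun h L'' hL s t hs hst ht => by
    have : 0 ≤ ((t - s) ^ θ) ^ 3 := pow_nonneg (Real.rpow_nonneg (by linarith) θ) 3
    exact (h s t hs hst ht).trans (by gcongr)
  obtain ⟨ρ, hρ, hloc⟩ := exists_davie_local_unique hT hθ hX hf (L := max 0 (max L L'))
    (le_max_left _ _) (up hY _ ((le_max_left _ _).trans (le_max_right _ _)))
    (up hZ _ ((le_max_right _ _).trans (le_max_right _ _)))
  have hθ0 : 0 < θ := by linarith
  set h := ρ ^ (1 / θ) with hh
  have hh0 : 0 < h := Real.rpow_pos_of_pos hρ _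
  have hhρ : h ^ θ = ρ := by
    rw [hh, ← Real.rpow_mul hρ.le, one_div_mul_cancel hθ0.ne', Real.rpow_one]
  have ind : ∀ n : ℕ, ∀ t ∈ Icc 0 T, t ≤ n * h → Y t = Z t := by
    intro n
    induction n with
    | zero =>
      intro t ht htn
      have : t = 0 := le_antisymm (by simpa using htn) ht.1
      rw [this, h0]
    | succ n ih =>
      intro t ht htn
      push_cast at htn
      rcases le_total t (n * h) with hle | hle
      · exact ih t ht hle
      · have ha : (0 : ℝ) ≤ n * h := by positivity
        exact hloc (n * h) t ha hle ht.2 (by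
          rw [← hhρ]
          exact Real.rpow_le_rpow (by linarith) (by linarith) hθ0.le)
          (ih _ ⟨ha, hle.trans ht.2⟩ le_rfl) t ⟨hle, le_rfl⟩
  intro t ht
  obtain ⟨n, hn⟩ := exists_nat_ge (t / h)
  exact ind n t ht (by rwa [div_le_iff₀ hh0] at hn)

end Davie

/-! #### Existence -/

section DavieExistence

set_option maxSynthPendingDepth 3

variable {E U : Type*} [NormedAddCommGroup E] [NormedSpace ℝ E] [NormedAddCommGroup U]
  [NormedSpace ℝ U]

/-- The second-order Euler scheme with step size `τ`. -/
def eulerScheme (f : E → U →L[ℝ] E) (X : ℝ → U) (XX : ℝ → ℝ → (U →L[ℝ] U →L[ℝ] E) →L[ℝ] E)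
    (τ : ℝ) (y : E) : ℕ → E
  | 0 => y
  | i + 1 => davieStep f X XX (i * τ) ((i + 1 : ℕ) * τ) (eulerScheme f X XX τ y i)

/-- A number of steps cannot always be halved exactly. Two parts of at most two thirds each suffice
for a contraction factor below 1. -/
lemma add_cube_rpow_le {x y z θ : ℝ} (hθ : 1 / 3 < θ) (hx : 0 ≤ x) (hy : 0 ≤ y) (hz : x + y = z)
    (hx2 : x ≤ 2 / 3 * z) (hy2 : y ≤ 2 / 3 * z) :
    (x ^ θ) ^ 3 + (y ^ θ) ^ 3 ≤ (2 / 3) ^ (3 * θ - 1) * (z ^ θ) ^ 3 := by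
  have hz0 : 0 ≤ z := by linarith
  have h0 : 0 ≤ 3 * θ - 1 := by linarith
  rw [cube_rpow hx, cube_rpow hy, cube_rpow hz0]
  have e : ∀ w : ℝ, 0 ≤ w → w ^ (3 * θ) = w ^ (3 * θ - 1) * w := fun w hw => by
    conv_lhs => rw [show 3 * θ = (3 * θ - 1) + 1 by ring,
      Real.rpow_add_of_nonneg hw h0 zero_le_one, Real.rpow_one]
  have b : ∀ w : ℝ, 0 ≤ w → w ≤ 2 / 3 * z →
      w ^ (3 * θ - 1) ≤ (2 / 3) ^ (3 * θ - 1) * z ^ (3 * θ - 1) := fun w hw hwz => by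
    rw [← Real.mul_rpow (by norm_num) hz0]
    exact Real.rpow_le_rpow hw hwz h0
  calc x ^ (3 * θ) + y ^ (3 * θ) = x ^ (3 * θ - 1) * x + y ^ (3 * θ - 1) * y := by
        rw [e x hx, e y hy]
    _ ≤ (2 / 3) ^ (3 * θ - 1) * z ^ (3 * θ - 1) * x +
          (2 / 3) ^ (3 * θ - 1) * z ^ (3 * θ - 1) * y :=
        add_le_add (mul_le_mul_of_nonneg_right (b x hx hx2) hx)
          (mul_le_mul_of_nonneg_right (b y hy hy2) hy)
    _ = _ := by rw [e z hz0, ← hz]; ring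

variable {T θ A C : ℝ} {f : E → U →L[ℝ] E} {X : ℝ → U}
  {XX : ℝ → ℝ → (U →L[ℝ] U →L[ℝ] E) →L[ℝ] E}

lemma davieStep_self (hX : RoughBound T θ A X XX) (hθ : 0 < θ) {s : ℝ} (hs : 0 ≤ s) (hsT : s ≤ T)
    (y : E) : davieStep f X XX s s y = y := by
  have h := hX.area s s hs le_rfl hsT
  rw [sub_self, Real.zero_rpow hθ.ne'] at h
  have h0 : XX s s = 0 := norm_le_zero_iff.1 (by simpa using h)
  simp [davieStep, h0]

set_option maxHeartbeats 1000000 in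
-- A discrete sewing argument by strong induction on the number d of steps. The local error vanishes
-- for d ≤ 1, and for larger d it is split at a middle index. The constants do not depend on the
-- step size.
lemma exists_eulerScheme_bound (hθ : 1 / 3 < θ) (hX : RoughBound T θ A X XX)
    (hf : CoeffBound C f) :
    ∃ L h₀ c : ℝ, 0 ≤ L ∧ 0 < h₀ ∧ 0 ≤ c ∧ ∀ (τ : ℝ), 0 < τ → ∀ n : ℕ, n * τ ≤ T → ∀ y : E,
      ∀ d i : ℕ, i + d ≤ n → d * τ ≤ h₀ →
      ‖eulerScheme f X XX τ y (i + d) - davieStep f X XX (i * τ) ((i + d : ℕ) * τ)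
          (eulerScheme f X XX τ y i)‖ ≤ L * ((d * τ) ^ θ) ^ 3 ∧
      ‖eulerScheme f X XX τ y (i + d) - eulerScheme f X XX τ y i‖ ≤ c := by
  have hθ0 : 0 < θ := by linarith
  have hC := hf.coeff.nonneg
  have hA := hX.nonneg
  set κ : ℝ := (2 / 3) ^ (3 * θ - 1) with hκ
  have hκ1 : κ < 1 := Real.rpow_lt_one (by norm_num) (by norm_num) (by linarith)
  set c₁ := 2 * (A * C) + 1 with hc₁
  set c₀ := (C * c₁ ^ 2 + C * c₁) * A + A * (C * c₁) with hc₀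
  have hc₁0 : 0 ≤ c₁ := by positivity
  have hc₀0 : 0 ≤ c₀ := by positivity
  set L := c₀ / (1 - κ) with hL
  have hL0 : 0 ≤ L := div_nonneg hc₀0 (by linarith)
  have hLe : L * κ + c₀ = L := by
    rw [hL]
    have : 1 - κ ≠ 0 := by linarith
    field_simp
    ring
  -- On intervals of length at most h₀ the factor L(dτ)^θ is at most 1. Therefore c₁ can be fixed
  -- before L, and the choice of L through c₀ and c₁ is not circular.
  set η₀ : ℝ := 1 / (L + 1) with hη₀
  have hη₀0 : 0 < η₀ := by positivity
  have hη₀1 : η₀ ≤ 1 := by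
    rw [hη₀, div_le_one (by positivity)]
    linarith
  have hLη : L * η₀ ≤ 1 := by
    rw [hη₀, mul_one_div, div_le_one (by positivity)]
    linarith
  set h₀ := η₀ ^ (1 / θ) with hh₀
  have hh₀0 : 0 < h₀ := Real.rpow_pos_of_pos hη₀0 _
  have hh₀η : h₀ ^ θ = η₀ := by
    rw [hh₀, ← Real.rpow_mul hη₀0.le, one_div_mul_cancel hθ0.ne', Real.rpow_one]
  refine ⟨L, h₀, c₁, hL0, hh₀0, hc₁0, fun τ hτ n hn y => ?_⟩
  set Y := eulerScheme f X XX τ y with hY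
  have cons : ∀ d i : ℕ, i + d ≤ n → d * τ ≤ h₀ →
      ‖Y (i + d) - davieStep f X XX (i * τ) ((i + d : ℕ) * τ) (Y i)‖ ≤ L * ((d * τ) ^ θ) ^ 3 →
      ‖Y (i + d) - Y i - f (Y i) (X ((i + d : ℕ) * τ) - X (i * τ))‖ ≤
        c₁ * ((d * τ) ^ θ) ^ 2 ∧ ‖Y (i + d) - Y i‖ ≤ c₁ * (d * τ) ^ θ := by
    intro d i hdn hdh hN
    have e : ((i + d : ℕ) : ℝ) * τ - i * τ = d * τ := by push_cast; ring
    have hs : (0 : ℝ) ≤ i * τ := by positivity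
    have hdτ : (0 : ℝ) ≤ d * τ := by positivity
    have hst : (i : ℝ) * τ ≤ (i + d : ℕ) * τ := by linarith
    have ht : ((i + d : ℕ) : ℝ) * τ ≤ T := by
      refine le_trans ?_ hn
      gcongr
    have hη : (d * τ) ^ θ ≤ η₀ := by
      rw [← hh₀η]
      exact Real.rpow_le_rpow hdτ hdh hθ0.le
    have hη0 : 0 ≤ (d * τ) ^ θ := Real.rpow_nonneg hdτ θ
    have hLη' : L * (d * τ) ^ θ ≤ 1 := (mul_le_mul_of_nonneg_left hη hL0).trans hLη
    rw [← e] at hN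
    have r := norm_rem_le hX hf hs hst ht hN
    rw [e] at r
    have r' : ‖Y (i + d) - Y i - f (Y i) (X ((i + d : ℕ) * τ) - X (i * τ))‖ ≤
        (A * C + 1) * ((d * τ) ^ θ) ^ 2 := r.trans (by gcongr)
    refine ⟨r'.trans ?_, ?_⟩
    · have : 0 ≤ A * C := by positivity
      gcongr
      rw [hc₁]
      linarith
    · have r'' := r'
      rw [← e] at r''
      have q := norm_sub_le_of_rem hX hf hs hst ht r''
      rw [e] at q
      refine q.trans ?_
      have h1 : (A * C + 1) * (d * τ) ^ θ ≤ (A * C + 1) * 1 := by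
        gcongr
        exact hη.trans hη₀1
      gcongr
      rw [hc₁]
      linarith
  have main : ∀ d i : ℕ, i + d ≤ n → d * τ ≤ h₀ →
      ‖Y (i + d) - davieStep f X XX (i * τ) ((i + d : ℕ) * τ) (Y i)‖ ≤
        L * ((d * τ) ^ θ) ^ 3 := by
    intro d
    induction d using Nat.strong_induction_on with
    | _ d ih =>
    intro i hdn hdh
    have hdτ : (0 : ℝ) ≤ d * τ := by positivity
    have hRHS : 0 ≤ L * ((d * τ) ^ θ) ^ 3 :=
      mul_nonneg hL0 (pow_nonneg (Real.rpow_nonneg hdτ θ) 3)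
    rcases lt_or_ge d 2 with hd2 | hd2
    · interval_cases d
      · simp only [add_zero]
        have : (i : ℝ) * τ ≤ T := by
          refine le_trans ?_ hn
          have : (i : ℝ) ≤ n := by exact_mod_cast (by omega : i ≤ n)
          gcongr
        rw [davieStep_self hX hθ0 (by positivity) this]
        simpa using hRHS
      · have : Y (i + 1) = davieStep f X XX (i * τ) ((i + 1 : ℕ) * τ) (Y i) := by
          rw [hY, eulerScheme]
        rw [this, sub_self, norm_zero]
        exact hRHS
    -- The worst case of the bound 2d/3 is d = 3, split as 1 + 2.
    · obtain ⟨k, l, hkl, hk0, hl0, hk, hl⟩ : ∃ k l : ℕ, k + l = d ∧ 0 < k ∧ 0 < l ∧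
          3 * k ≤ 2 * d ∧ 3 * l ≤ 2 * d :=
        ⟨d / 2, d - d / 2, by omega, by omega, by omega, by omega, by omega⟩
      have hkd : (k : ℝ) + l = d := by exact_mod_cast hkl
      have hk' : (3 : ℝ) * k ≤ 2 * d := by exact_mod_cast hk
      have hl' : (3 : ℝ) * l ≤ 2 * d := by exact_mod_cast hl
      have hkτ : (k : ℝ) * τ ≤ d * τ := by gcongr; linarith [(Nat.cast_nonneg l : (0 : ℝ) ≤ l)]
      have hlτ : (l : ℝ) * τ ≤ d * τ := by gcongr; linarith [(Nat.cast_nonneg k : (0 : ℝ) ≤ k)]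
      have i1 := ih k (by omega) i (by omega) (hkτ.trans hdh)
      have i2 := ih l (by omega) (i + k) (by omega) (hlτ.trans hdh)
      have eidx : i + k + l = i + d := by omega
      rw [eidx] at i2
      obtain ⟨c1, c2⟩ := cons k i (by omega) (hkτ.trans hdh) i1
      set η := (d * τ) ^ θ with hη
      have hη0 : 0 ≤ η := Real.rpow_nonneg hdτ θ
      have hkη : (k * τ) ^ θ ≤ η := Real.rpow_le_rpow (by positivity) hkτ hθ0.le
      have hlη : (l * τ) ^ θ ≤ η := Real.rpow_le_rpow (by positivity) hlτ hθ0.le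
      have hkη0 : 0 ≤ (k * τ) ^ θ := Real.rpow_nonneg (by positivity) θ
      have hlη0 : 0 ≤ (l * τ) ^ θ := Real.rpow_nonneg (by positivity) θ
      have hs : (0 : ℝ) ≤ i * τ := by positivity
      have hsu : (i : ℝ) * τ ≤ (i + k : ℕ) * τ := by gcongr; omega
      have hut : ((i + k : ℕ) : ℝ) * τ ≤ (i + d : ℕ) * τ := by gcongr; omega
      have ht : ((i + d : ℕ) : ℝ) * τ ≤ T := by
        refine le_trans ?_ hn
        gcongr
      have e2 : ((i + d : ℕ) : ℝ) * τ - (i + k : ℕ) * τ = l * τ := by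
        push_cast
        rw [← hkd]
        ring
      have x1 := hX.path _ _ (hs.trans hsu) hut ht
      have x2 := hX.area _ _ (hs.trans hsu) hut ht
      rw [e2] at x1 x2
      have hdef := norm_davieDefect_le (X := X) (XX := XX) (s := i * τ) hf hA
        (x1.trans (mul_le_mul_of_nonneg_left hlη hA))
        (x2.trans (mul_le_mul_of_nonneg_left (pow_le_pow_left₀ hlη0 hlη 2) hA))
        (c2.trans (mul_le_mul_of_nonneg_left hkη hc₁0))
        (c1.trans (mul_le_mul_of_nonneg_left (pow_le_pow_left₀ hkη0 hkη 2) hc₁0))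
      have hdec := sub_davieStep (f := f) hX hs hsu hut ht (Y i) (Y (i + k)) (Y (i + d))
      rw [hdec]
      refine norm_add₃_le.trans ((add_le_add (add_le_add i1 i2) hdef).trans ?_)
      have hsplit := add_cube_rpow_le hθ (x := k * τ) (y := l * τ) (z := d * τ) (by positivity)
        (by positivity) (by rw [← hkd]; ring) (by nlinarith) (by nlinarith)
      rw [← hη, ← hκ] at hsplit
      calc _ = L * (((k * τ) ^ θ) ^ 3 + ((l * τ) ^ θ) ^ 3) + c₀ * η ^ 3 := by
            rw [hc₀]
            ring
        _ ≤ L * (κ * η ^ 3) + c₀ * η ^ 3 := by gcongr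
        _ = (L * κ + c₀) * η ^ 3 := by ring
        _ = _ := by rw [hLe]
  intro d i hdn hdh
  refine ⟨main d i hdn hdh, ((cons d i hdn hdh (main d i hdn hdh)).2).trans ?_⟩
  have hη : (d * τ) ^ θ ≤ η₀ := by
    rw [← hh₀η]
    exact Real.rpow_le_rpow (by positivity) hdh hθ0.le
  calc c₁ * (d * τ) ^ θ ≤ c₁ * 1 := by
        gcongr
        exact hη.trans hη₀1
    _ = c₁ := mul_one _

set_option maxHeartbeats 1000000 in
-- Euler schemes of vanishing step size stay in a fixed ball and converge pointwise along an
-- ultrafilter. Uniform local error bounds survive this limit, so neither equicontinuity nor a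
-- subsequence is needed.
theorem exists_isDavie [ProperSpace E] (hT : 0 < T) (hθ : 1 / 3 < θ) (hX : RoughBound T θ A X XX)
    (hf : CoeffBound C f) (hXc : ContinuousOn X (Icc 0 T))
    (hXXc : ContinuousOn (fun z : ℝ × ℝ => XX z.1 z.2) (simplex T)) (y : E) :
    ∃ (L : ℝ) (Y : ℝ → E), 0 ≤ L ∧ Y 0 = y ∧ IsDavie T θ L f X XX Y := by
  have hθ0 : 0 < θ := by linarith
  have hC := hf.coeff.nonneg
  have hA := hX.nonneg
  obtain ⟨L, h₀, c, hL, hh₀, hc, hbound⟩ := exists_eulerScheme_bound hθ hX hf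
  obtain ⟨Q, hQ⟩ := exists_nat_ge (T / h₀)
  have hQ0 : 0 < (Q : ℝ) := lt_of_lt_of_le (by positivity) hQ
  have hTQ : T / Q ≤ h₀ := by
    rw [div_le_iff₀ hh₀] at hQ
    rw [div_le_iff₀ hQ0]
    linarith
  set τ : ℕ → ℝ := fun k => T / (Q * (k + 1)) with hτdef
  have hτ0 : ∀ k, 0 < τ k := fun k => by
    simp only [hτdef]
    positivity
  set n : ℕ → ℕ := fun k => Q * (k + 1) with hndef
  have hnτ : ∀ k, n k * τ k = T := fun k => by
    simp only [hndef, hτdef]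
    push_cast
    field_simp
  set Y : ℕ → ℕ → E := fun k => eulerScheme f X XX (τ k) y with hYdef
  set R : ℝ := Q * c with hR
  have hR0 : 0 ≤ R := by positivity
  have hbd : ∀ k i, i ≤ n k → ‖Y k i - y‖ ≤ R := by
    intro k
    -- The interval [0,T] consists of Q blocks of length T/Q ≤ h₀, each of k + 1 steps. Within a
    -- block the scheme moves by at most c.
    have ind : ∀ q : ℕ, q ≤ Q → ∀ i, i ≤ q * (k + 1) → ‖Y k i - y‖ ≤ q * c := by
      intro q
      induction q with
      | zero =>
        intro _ i hi
        have : i = 0 := by omega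
        subst this
        simp [hYdef, eulerScheme]
      | succ q ih =>
        intro hq i hi
        have hqc : (q : ℝ) * c ≤ (q + 1 : ℕ) * c := by
          push_cast
          nlinarith
        rcases le_total i (q * (k + 1)) with hle | hle
        · exact (ih (by omega) i hle).trans hqc
        · obtain ⟨d, rfl⟩ := Nat.exists_eq_add_of_le hle
          have hd : d ≤ k + 1 := by
            rw [Nat.succ_mul] at hi
            omega
          have hdτ : d * τ k ≤ h₀ := by
            refine le_trans ?_ hTQ
            have : (d : ℝ) ≤ k + 1 := by exact_mod_cast hd
            calc (d : ℝ) * τ k ≤ (k + 1) * τ k := mul_le_mul_of_nonneg_right this (hτ0 k).le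
              _ = T / Q := by
                  simp only [hτdef]
                  field_simp
          have h1 := (hbound (τ k) (hτ0 k) (n k) (hnτ k).le y d (q * (k + 1))
            (hi.trans (Nat.mul_le_mul_right _ hq)) hdτ).2
          have h2 := ih (by omega) (q * (k + 1)) le_rfl
          have e : Y k (q * (k + 1) + d) - y =
              (Y k (q * (k + 1) + d) - Y k (q * (k + 1))) + (Y k (q * (k + 1)) - y) := by abel
          rw [e]
          refine (norm_add_le _ _).trans ((add_le_add h1 h2).trans (le_of_eq ?_))
          push_cast
          ring
    intro i hi
    exact ind Q le_rfl i hi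
  set idx : ℕ → ℝ → ℕ := fun k t => ⌊t / τ k⌋₊ with hidx
  set p : ℕ → ℝ → ℝ := fun k t => idx k t * τ k with hpdef
  have hidxn : ∀ k t, t ≤ T → idx k t ≤ n k := fun k t ht => by
    refine Nat.floor_le_of_le ?_
    rw [div_le_iff₀ (hτ0 k), hnτ]
    exact ht
  have hp_le : ∀ k t, 0 ≤ t → p k t ≤ t := fun k t ht => by
    have := Nat.floor_le (div_nonneg ht (hτ0 k).le)
    rwa [le_div_iff₀ (hτ0 k)] at this
  have hp_gt : ∀ k t, t - τ k ≤ p k t := fun k t => by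
    have := (Nat.lt_floor_add_one (t / τ k)).le
    rw [div_le_iff₀ (hτ0 k)] at this
    simp only [hpdef, hidx]
    linarith
  have hp0 : ∀ k t, 0 ≤ p k t := fun k t => mul_nonneg (Nat.cast_nonneg _) (hτ0 k).le
  have hp_mono : ∀ k s t, s ≤ t → idx k s ≤ idx k t := fun k s t hst =>
    Nat.floor_le_floor (div_le_div_of_nonneg_right hst (hτ0 k).le)
  have hp_mono' : ∀ k s t, s ≤ t → p k s ≤ p k t := fun k s t hst =>
    mul_le_mul_of_nonneg_right (by exact_mod_cast hp_mono k s t hst) (hτ0 k).le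
  have hτlim : Tendsto τ atTop (𝓝 0) := by
    refine tendsto_const_nhds.div_atTop ?_
    exact Tendsto.const_mul_atTop hQ0
      (tendsto_atTop_add_const_right _ _ tendsto_natCast_atTop_atTop)
  have hplim : ∀ t, 0 ≤ t → Tendsto (fun k => p k t) atTop (𝓝 t) := fun t ht => by
    refine tendsto_of_tendsto_of_tendsto_of_le_of_le (g := fun k => t - τ k) (h := fun _ => t)
      ?_ tendsto_const_nhds (fun k => hp_gt k t) (fun k => hp_le k t ht)
    simpa using tendsto_const_nhds.sub hτlim
  have hlim : ∀ t, t ≤ T → ∃ z ∈ Metric.closedBall y R,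
      Tendsto (fun k => Y k (idx k t)) (hyperfilter ℕ) (𝓝 z) := by
    intro t ht
    have hcomp := isCompact_closedBall y R
    refine hcomp.ultrafilter_le_nhds ((hyperfilter ℕ).map fun k => Y k (idx k t)) ?_
    rw [le_principal_iff, Ultrafilter.mem_coe, Ultrafilter.mem_map]
    refine univ_mem' fun k => ?_
    rw [mem_preimage, mem_closedBall_iff_norm]
    exact hbd k _ (hidxn k t ht)
  choose! Z hZmem hZlim using hlim
  have hfil : (hyperfilter ℕ : Filter ℕ) ≤ atTop := Nat.hyperfilter_le_atTop
  have hfc : Continuous f := hf.coeff.continuous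
  have hsc : Continuous (secondCoeff f) := hf.second.continuous
  -- The strict inequality t - s < h₀ passes to the grid points below s and t for almost all k along
  -- the ultrafilter, where the discrete bound applies.
  have hloc : ∀ s t, 0 ≤ s → s ≤ t → t ≤ T → t - s < h₀ →
      ‖Z t - davieStep f X XX s t (Z s)‖ ≤ L * ((t - s) ^ θ) ^ 3 := by
    intro s t hs hst ht hd
    have ht0 := hs.trans hst
    have hsT := hst.trans ht
    have ps := (hplim s hs).mono_left hfil
    have pt := (hplim t ht0).mono_left hfil
    have hXlim : ∀ r, 0 ≤ r → r ≤ T →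
        Tendsto (fun k => X (p k r)) (hyperfilter ℕ) (𝓝 (X r)) := by
      intro r hr hrT
      refine (hXc r ⟨hr, hrT⟩).tendsto.comp ?_
      exact tendsto_nhdsWithin_iff.2 ⟨(hplim r hr).mono_left hfil,
        Eventually.of_forall fun k => ⟨hp0 k r, (hp_le k r hr).trans hrT⟩⟩
    have hXXlim : Tendsto (fun k => XX (p k s) (p k t)) (hyperfilter ℕ) (𝓝 (XX s t)) := by
      have h1 : Tendsto (fun k => (p k s, p k t)) (hyperfilter ℕ) (𝓝[simplex T] (s, t)) := by
        refine tendsto_nhdsWithin_iff.2 ⟨ps.prodMk_nhds pt, Eventually.of_forall fun k => ?_⟩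
        exact ⟨hp0 k s, hp_mono' k s t hst, (hp_le k t ht0).trans ht⟩
      exact (hXXc (s, t) ⟨hs, hst, ht⟩).tendsto.comp h1
    have hstep : Tendsto (fun k => davieStep f X XX (p k s) (p k t) (Y k (idx k s)))
        (hyperfilter ℕ) (𝓝 (davieStep f X XX s t (Z s))) := by
      unfold davieStep
      have z := hZlim s hsT
      refine (z.add ?_).add ?_
      · exact (isBoundedBilinearMap_apply.continuous.tendsto (f (Z s), X t - X s)).comp
          (((hfc.tendsto _).comp z).prodMk_nhds ((hXlim t ht0 ht).sub (hXlim s hs hsT)))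
      · exact (isBoundedBilinearMap_apply.continuous.tendsto (XX s t, secondCoeff f (Z s))).comp
          (hXXlim.prodMk_nhds ((hsc.tendsto _).comp z))
    have hRlim : Tendsto (fun k => L * ((p k t - p k s) ^ θ) ^ 3) (hyperfilter ℕ)
        (𝓝 (L * ((t - s) ^ θ) ^ 3)) :=
      (((pt.sub ps).rpow_const (Or.inr hθ0.le)).pow 3).const_mul L
    refine le_of_tendsto_of_tendsto ((hZlim t ht).sub hstep).norm hRlim ?_
    have hev : ∀ᶠ k in (hyperfilter ℕ : Filter ℕ), p k t - p k s < h₀ :=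
      (pt.sub ps).eventually_lt_const hd
    filter_upwards [hev] with k hk
    obtain ⟨d, hd⟩ := Nat.exists_eq_add_of_le (hp_mono k s t hst)
    have e : p k t - p k s = d * τ k := by
      simp only [hpdef, hd]
      push_cast
      ring
    have := (hbound (τ k) (hτ0 k) (n k) (hnτ k).le y d (idx k s)
      (hd ▸ hidxn k t ht) (by rw [← e]; exact hk.le)).1
    rw [← hd] at this
    rw [e]
    exact this
  -- The second summand serves the pairs with t - s ≥ h₀, where the local error is bounded by the
  -- crude constant in the numerator.
  refine ⟨L + (2 * R + C * (A * T ^ θ) + A * (T ^ θ) ^ 2 * C) / (h₀ ^ θ) ^ 3, Z, ?_, ?_, ?_⟩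
  · positivity
  · have h := hZlim 0 hT.le
    have e : ∀ k, Y k (idx k 0) = y := fun k => by
      simp [hidx, hYdef, eulerScheme]
    simp only [e] at h
    exact tendsto_nhds_unique h tendsto_const_nhds
  · intro s t hs hst ht
    have hη0 : 0 ≤ ((t - s) ^ θ) ^ 3 := pow_nonneg (Real.rpow_nonneg (by linarith) θ) 3
    have hTθ : 0 ≤ T ^ θ := Real.rpow_nonneg hT.le θ
    have hh₀θ : 0 < (h₀ ^ θ) ^ 3 := pow_pos (Real.rpow_pos_of_pos hh₀ θ) 3
    set M := 2 * R + C * (A * T ^ θ) + A * (T ^ θ) ^ 2 * C with hM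
    have hM0 : 0 ≤ M := by positivity
    rcases lt_or_ge (t - s) h₀ with hd | hd
    · refine (hloc s t hs hst ht hd).trans ?_
      gcongr
      have : 0 ≤ M / (h₀ ^ θ) ^ 3 := by positivity
      linarith
    · have hηT : (t - s) ^ θ ≤ T ^ θ := Real.rpow_le_rpow (by linarith) (by linarith) hθ0.le
      have b1 : ‖Z t - Z s‖ ≤ 2 * R := by
        have h1 := hZmem t ht
        have h2 := hZmem s (hst.trans ht)
        rw [mem_closedBall_iff_norm] at h1 h2
        have e : Z t - Z s = (Z t - y) - (Z s - y) := by abel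
        rw [e]
        exact (norm_sub_le _ _).trans (by linarith)
      have b2 : ‖f (Z s) (X t - X s)‖ ≤ C * (A * T ^ θ) :=
        (ContinuousLinearMap.le_opNorm _ _).trans (mul_le_mul (hf.coeff.bdd _)
          ((hX.path s t hs hst ht).trans (by gcongr)) (norm_nonneg _) hC)
      have b3 : ‖XX s t (secondCoeff f (Z s))‖ ≤ A * (T ^ θ) ^ 2 * C :=
        (ContinuousLinearMap.le_opNorm _ _).trans (mul_le_mul
          ((hX.area s t hs hst ht).trans (by gcongr)) (hf.second.bdd _) (norm_nonneg _)
          (by positivity))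
      have e : Z t - davieStep f X XX s t (Z s) =
          Z t - Z s + -(f (Z s) (X t - X s)) + -(XX s t (secondCoeff f (Z s))) := by
        unfold davieStep
        abel
      have hMb : ‖Z t - davieStep f X XX s t (Z s)‖ ≤ M := by
        rw [e]
        refine norm_add₃_le.trans ?_
        rw [norm_neg, norm_neg]
        linarith
      have hge : (h₀ ^ θ) ^ 3 ≤ ((t - s) ^ θ) ^ 3 :=
        pow_le_pow_left₀ (Real.rpow_nonneg hh₀.le θ) (Real.rpow_le_rpow hh₀.le hd hθ0.le) 3
      calc ‖Z t - davieStep f X XX s t (Z s)‖ ≤ M := hMb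
        _ = M / (h₀ ^ θ) ^ 3 * (h₀ ^ θ) ^ 3 := by field_simp
        _ ≤ M / (h₀ ^ θ) ^ 3 * ((t - s) ^ θ) ^ 3 := by gcongr
        _ ≤ _ := by
            gcongr
            linarith

end DavieExistence

/-! ### Moduli of continuity of two-parameter functions -/

section Modulus

variable {V W : Type*} [NormedAddCommGroup V] [NormedAddCommGroup W]

lemma monotone_modulus₂ (T b : ℝ) (A : ℝ → ℝ → V) : Monotone (modulus₂ T b A) := fun _ _ h =>
  biSup_mono fun _ hx => ⟨hx.1, hx.2.trans h⟩

lemma measurable_modulus₂ (T b : ℝ) (A : ℝ → ℝ → V) : Measurable (modulus₂ T b A) :=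
  (monotone_modulus₂ T b A).measurable

lemma luxNorm_le_modulus₂ (T b : ℝ) (A : ℝ → ℝ → V) {h τ : ℝ} (h0 : 0 ≤ h) (hτ : h ≤ τ) :
    luxNorm b (Icc 0 (T - h)) (fun r => ‖A r (r + h)‖) ≤ modulus₂ T b A τ :=
  le_iSup₂ (f := fun h (_ : h ∈ Icc (0 : ℝ) τ) =>
    luxNorm b (Icc 0 (T - h)) fun r => ‖A r (r + h)‖) h ⟨h0, hτ⟩

lemma modulus₂_le {T b : ℝ} {A : ℝ → ℝ → V} {τ : ℝ} {c : ℝ≥0∞}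
    (h : ∀ h, 0 ≤ h → h ≤ τ → luxNorm b (Icc 0 (T - h)) (fun r => ‖A r (r + h)‖) ≤ c) :
    modulus₂ T b A τ ≤ c :=
  iSup₂_le fun x hx => h x hx.1 hx.2

lemma modulus₂_congr {T b : ℝ} (hb : 0 < b) {A B : ℝ → ℝ → V}
    (h : ∀ h ∈ Icc (0 : ℝ) T, ∀ᵐ r ∂volume.restrict (Icc 0 (T - h)), A r (r + h) = B r (r + h))
    {τ : ℝ} (hτ : τ ≤ T) : modulus₂ T b A τ = modulus₂ T b B τ := by
  refine le_antisymm (modulus₂_le fun x h0 hx => ?_) (modulus₂_le fun x h0 hx => ?_)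
  · refine le_trans (luxNorm_mono hb le_rfl ?_) (luxNorm_le_modulus₂ T b B h0 hx)
    filter_upwards [h x ⟨h0, hx.trans hτ⟩] with r hr
    rw [hr]
  · refine le_trans (luxNorm_mono hb le_rfl ?_) (luxNorm_le_modulus₂ T b A h0 hx)
    filter_upwards [h x ⟨h0, hx.trans hτ⟩] with r hr
    rw [hr]

/-- The norm depends only on the a.e. classes of the sections. This permits passing from the second
level to its continuous version. -/
lemma besovNorm₂_congr {T a b : ℝ} {q : ℝ≥0∞} (hb : 0 < b) {A B : ℝ → ℝ → V}
    (h : ∀ h ∈ Icc (0 : ℝ) T, ∀ᵐ r ∂volume.restrict (Icc 0 (T - h)), A r (r + h) = B r (r + h)) :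
    besovNorm₂ T a b q A = besovNorm₂ T a b q B := by
  refine eLpNorm_congr_ae ?_
  filter_upwards [ae_logMeasure T] with τ hτ
  rw [modulus₂_congr hb h hτ.2]

lemma ae_restrict_simplex_section {T h : ℝ} (hh : h ∈ Icc 0 T) :
    ∀ᵐ r ∂volume.restrict (Icc 0 (T - h)), 0 ≤ r ∧ r ≤ r + h ∧ r + h ≤ T := by
  filter_upwards [ae_restrict_mem measurableSet_Icc] with r hr
  exact ⟨hr.1, by linarith [hh.1], by linarith [hr.2]⟩

lemma exists_modulus₂_le_of_bound {b T : ℝ} (hb : 0 < b) (hT : 0 ≤ T) :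
    ∃ C : ℝ, 0 < C ∧ ∀ (A : ℝ → ℝ → V) (M τ : ℝ), 0 ≤ M → τ ≤ T →
      (∀ s t, 0 ≤ s → s ≤ t → t ≤ T → t - s ≤ τ → ‖A s t‖ ≤ M) →
      modulus₂ T b A τ ≤ ENNReal.ofReal (C * M) := by
  obtain ⟨C, hC, h⟩ := exists_luxNorm_le_of_bound hb hT
  refine ⟨C, hC, fun A M τ hM hτ hA => modulus₂_le fun x hx0 hxτ => ?_⟩
  refine h _ (Icc_subset_Icc le_rfl (by linarith)) _ M hM ?_
  filter_upwards [ae_restrict_simplex_section ⟨hx0, hxτ.trans hτ⟩] with r hr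
  rw [abs_norm]
  exact hA _ _ hr.1 hr.2.1 hr.2.2 (by linarith)

/-- Domination of moduli up to a term of higher order. -/
lemma LogMem.modulus₂_of_le {T a b κ C : ℝ} {q : ℝ≥0∞} (hT : 0 ≤ T) (hb : 0 < b) (hq : q ≠ 0)
    (hC : 0 ≤ C) (ha : a < κ) (hκ : 0 ≤ κ) {A : ℝ → ℝ → V} {B : ℝ → ℝ → W}
    (hB : LogMem T a q (modulus₂ T b B))
    (hm : ∀ h ∈ Icc (0 : ℝ) T,
      AEStronglyMeasurable (fun r => B r (r + h)) (volume.restrict (Icc 0 (T - h))))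
    (h : ∀ s t, 0 ≤ s → s ≤ t → t ≤ T → ‖A s t‖ ≤ C * ‖B s t‖ + C * (t - s) ^ κ) :
    LogMem T a q (modulus₂ T b A) := by
  obtain ⟨C', hC', hbd⟩ := exists_luxNorm_le_of_bound hb hT
  have h1 : LogMem T a q fun τ => ENNReal.ofReal C * modulus₂ T b B τ +
      ENNReal.ofReal (C' * C) * ENNReal.ofReal (τ ^ κ) :=
    (hB.const_mul (measurable_modulus₂ _ _ _) ENNReal.ofReal_ne_top).add
      ((logMem_rpow hq ha hT).const_mul (by fun_prop) ENNReal.ofReal_ne_top)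
      ((measurable_modulus₂ _ _ _).const_mul _) (by fun_prop)
  refine h1.mono fun τ hτ => modulus₂_le fun x hx0 hxτ => ?_
  have hx : x ∈ Icc 0 T := ⟨hx0, hxτ.trans hτ.2⟩
  refine (luxNorm_add_le hb (f := fun r => C * ‖B r (r + x)‖) (g := fun _ => C * x ^ κ)
    ((hm x hx).norm.aemeasurable.const_mul C) ?_).trans (add_le_add ?_ ?_)
  · filter_upwards [ae_restrict_simplex_section hx] with r hr
    have := h _ _ hr.1 hr.2.1 hr.2.2
    rw [add_sub_cancel_left] at this
    have hp : 0 ≤ x ^ κ := Real.rpow_nonneg hx0 κ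
    rwa [abs_norm, abs_of_nonneg (by positivity), abs_of_nonneg (by positivity)]
  · refine (luxNorm_le_mul hb hC (g := fun r => ‖B r (r + x)‖) (ae_of_all _ fun r => ?_)).trans
      (by gcongr; exact luxNorm_le_modulus₂ T b B hx0 hxτ)
    rw [abs_mul, abs_of_nonneg hC]
  · have hp : 0 ≤ x ^ κ := Real.rpow_nonneg hx0 κ
    refine (hbd _ (Icc_subset_Icc le_rfl (by linarith)) _ (C * x ^ κ) (by positivity)
      (ae_of_all _ fun r => ?_)).trans ?_
    · rw [abs_of_nonneg (by positivity)]
    · rw [← ENNReal.ofReal_mul (by positivity), mul_assoc]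
      refine ENNReal.ofReal_le_ofReal ?_
      have := Real.rpow_le_rpow hx0 hxτ hκ
      gcongr

lemma exists_luxNorm_mul_le' {b b₁ b₂ : ℝ} (h₁ : 0 < b₁) (h₂ : 0 < b₂) (hb : 0 < b)
    (hbb : 1 / b = 1 / b₁ + 1 / b₂) {T : ℝ} (hT : 0 ≤ T) :
    ∃ C : ℝ, 0 < C ∧ ∀ (D : Set ℝ), D ⊆ Icc 0 T → ∀ F f g : ℝ → ℝ,
      AEMeasurable f (volume.restrict D) →
      (∀ᵐ r ∂volume.restrict D, |F r| ≤ |f r| * |g r|) →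
      luxNorm b₁ D f ≠ ∞ → luxNorm b₂ D g ≠ ∞ →
      luxNorm b D F ≤ ENNReal.ofReal C * (luxNorm b₁ D f * luxNorm b₂ D g) := by
  obtain ⟨C, hC, h⟩ := exists_luxNorm_mul_le h₁ h₂ hb hbb hT
  refine ⟨C, hC, fun D hD F f g hf hF hft hgt => ?_⟩
  refine (h D hD F f g _ _ ENNReal.toReal_nonneg ENNReal.toReal_nonneg hf hF
    (ENNReal.ofReal_toReal hft).ge (ENNReal.ofReal_toReal hgt).ge).trans ?_
  rw [ENNReal.ofReal_mul hC.le, ENNReal.ofReal_mul ENNReal.toReal_nonneg,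
    ENNReal.ofReal_toReal hft, ENNReal.ofReal_toReal hgt]

lemma isCompact_simplex (T : ℝ) : IsCompact (simplex T) := by
  refine (isCompact_Icc.prod isCompact_Icc).of_isClosed_subset (s := Icc 0 T ×ˢ Icc 0 T) ?_ ?_
  · have e : simplex T = {p : ℝ × ℝ | 0 ≤ p.1} ∩ ({p | p.1 ≤ p.2} ∩ {p | p.2 ≤ T}) := rfl
    rw [e]
    exact (isClosed_le continuous_const continuous_fst).inter
      ((isClosed_le continuous_fst continuous_snd).inter
        (isClosed_le continuous_snd continuous_const))
  · rintro ⟨s, t⟩ ⟨h1, h2, h3⟩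
    exact ⟨⟨h1, h2.trans h3⟩, ⟨h1.trans h2, h3⟩⟩

lemma exists_bound_of_continuousOn_simplex {T : ℝ} {A : ℝ → ℝ → V}
    (hc : ContinuousOn (fun z : ℝ × ℝ => A z.1 z.2) (simplex T)) :
    ∃ M : ℝ, 0 ≤ M ∧ ∀ s t, 0 ≤ s → s ≤ t → t ≤ T → ‖A s t‖ ≤ M := by
  obtain ⟨M, hM⟩ := (isCompact_simplex T).exists_bound_of_continuousOn hc
  exact ⟨|M|, abs_nonneg _, fun s t h1 h2 h3 =>
    (hM (s, t) ⟨h1, h2, h3⟩).trans (le_abs_self _)⟩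

/-- A two-parameter function in a Besov-Orlicz space which is almost subadditive has a Hölder
bound of every smaller exponent, outside a null set. -/
lemma exists_ae_holder_of_logMem {T γ θ b B : ℝ} {q : ℝ≥0∞} (hT : 0 < T) (hb : 0 < b)
    (hq : q ≠ 0) (hθ : 0 < θ) (hγ : θ < γ) (hB : 0 ≤ B) {A : ℝ → ℝ → V}
    (hm : AEStronglyMeasurable (fun z : ℝ × ℝ => A z.1 z.2) (volume.restrict (simplex T)))
    (hA : LogMem T γ q (modulus₂ T b A))
    (htri : ∀ s u t, 0 ≤ s → s ≤ u → u ≤ t → t ≤ T →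
      ‖A s t‖ ≤ ‖A s u‖ + ‖A u t‖ + B * (t - s) ^ θ) :
    ∃ K : ℝ, 0 ≤ K ∧ ∃ N : Set ℝ, volume N = 0 ∧ ∀ s ∈ Icc 0 T, s ∉ N → ∀ t ∈ Icc 0 T, t ∉ N →
      s < t → t - s ≤ T / 2 → ‖A s t‖ ≤ K * (t - s) ^ θ := by
  obtain ⟨K, hK, hsup⟩ := hA.sup_bound (by linarith) hq (monotone_modulus₂ T b A)
  -- With (γ - θ)p ≥ 2 the moment bound h^{γp} is at most a constant times h^{θp+2}, as the chaining
  -- argument requires.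
  set p := ⌈2 / (γ - θ)⌉₊ + 1 with hp
  have hp0 : (0 : ℝ) ≤ (γ - θ) * p - 2 := by
    have h1 := Nat.le_ceil (2 / (γ - θ))
    have h2 : 2 / (γ - θ) ≤ p := by rw [hp]; push_cast; linarith
    rw [div_le_iff₀ (by linarith)] at h2
    linarith
  obtain ⟨C, hC, hpow⟩ := exists_lintegral_pow_le hb hT.le p
  refine exists_ae_holder (p := p) (C := C * (2 * K) ^ p * T ^ ((γ - θ) * p - 2)) hT hθ
    (by omega) (fun s t => norm_nonneg _) (by positivity) hB hm.norm.aemeasurable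
    (fun h h0 hh => ?_) (fun s u t h1 h2 h3 h4 _ => htri s u t h1 h2 h3 h4)
  have hhγ : 0 < h ^ γ := Real.rpow_pos_of_pos h0 γ
  have h1 : luxNorm b (Icc 0 (T - h)) (fun r => ‖A r (r + h)‖) <
      ENNReal.ofReal (2 * K * h ^ γ) := by
    refine (luxNorm_le_modulus₂ T b A h0.le le_rfl).trans_lt ((hsup h h0 hh).trans_lt ?_)
    refine (ENNReal.ofReal_lt_ofReal_iff (by positivity)).2 ?_
    nlinarith [mul_pos hK hhγ]
  have h2 := hpow _ (Icc_subset_Icc le_rfl (by linarith)) _ _ (by positivity) h1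
  simp only [abs_norm] at h2
  refine h2.trans (ENNReal.ofReal_le_ofReal ?_)
  have e : (h ^ γ) ^ p = h ^ (θ * p + 2) * h ^ ((γ - θ) * p - 2) := by
    rw [← Real.rpow_natCast, ← Real.rpow_mul h0.le, ← Real.rpow_add h0]
    congr 1
    ring
  have h3 : h ^ ((γ - θ) * p - 2) ≤ T ^ ((γ - θ) * p - 2) :=
    Real.rpow_le_rpow h0.le (by linarith) hp0
  rw [mul_pow, e]
  calc C * ((2 * K) ^ p * (h ^ (θ * p + 2) * h ^ ((γ - θ) * p - 2)))
      = C * (2 * K) ^ p * h ^ ((γ - θ) * p - 2) * h ^ (θ * p + 2) := by ring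
    _ ≤ C * (2 * K) ^ p * T ^ ((γ - θ) * p - 2) * h ^ (θ * p + 2) := by gcongr

lemma dense_compl_of_volume_eq_zero {N : Set ℝ} (hN : volume N = 0) : Dense Nᶜ :=
  Measure.dense_of_ae (μ := volume) (compl_mem_ae_iff.2 hN)

/-- The pair (s,t) is a limit of pairs off N taken from (s,m) × (m,t), with m the midpoint. Such
pairs stay ordered and keep their distance below T/2. -/
lemma le_mul_rpow_of_dense {T θ K : ℝ} {N : Set ℝ} (hN : volume N = 0) {A : ℝ → ℝ → V}
    (hθ : 0 ≤ θ) (hc : ContinuousOn (fun z : ℝ × ℝ => A z.1 z.2) (simplex T))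
    (h : ∀ s ∈ Icc 0 T, s ∉ N → ∀ t ∈ Icc 0 T, t ∉ N →
      s < t → t - s ≤ T / 2 → ‖A s t‖ ≤ K * (t - s) ^ θ)
    {s t : ℝ} (hs : 0 ≤ s) (hst : s < t) (ht : t ≤ T) (hd : t - s ≤ T / 2) :
    ‖A s t‖ ≤ K * (t - s) ^ θ := by
  set m := (s + t) / 2 with hm
  have hsm : s < m := by rw [hm]; linarith
  have hmt : m < t := by rw [hm]; linarith
  have hdense := dense_compl_of_volume_eq_zero hN
  have cl : ∀ x y : ℝ, x < y → Icc x y ⊆ closure (Ioo x y ∩ Nᶜ) := fun x y hxy => by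
    rw [← closure_Ioo hxy.ne]
    exact closure_minimal (hdense.open_subset_closure_inter isOpen_Ioo) isClosed_closure
  set D : Set (ℝ × ℝ) := (Ioo s m ∩ Nᶜ) ×ˢ (Ioo m t ∩ Nᶜ) with hD
  have hmem : (s, t) ∈ closure D := by
    rw [hD, closure_prod_eq]
    exact ⟨cl s m hsm ⟨le_rfl, hsm.le⟩, cl m t hmt ⟨hmt.le, le_rfl⟩⟩
  have hsub : D ⊆ simplex T := by
    rintro ⟨x, y⟩ ⟨hx, hy⟩
    exact ⟨by linarith [hx.1.1], by linarith [hx.1.2, hy.1.1], by linarith [hy.1.2]⟩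
  have hg : ContinuousWithinAt (fun z : ℝ × ℝ => K * (z.2 - z.1) ^ θ) D (s, t) := by
    refine ContinuousAt.continuousWithinAt (Continuous.continuousAt ?_)
    exact continuous_const.mul ((continuous_snd.sub continuous_fst).rpow_const fun _ => Or.inr hθ)
  refine ContinuousWithinAt.closure_le hmem (((hc (s, t) ⟨hs, hst.le, ht⟩).mono hsub).norm) hg ?_
  rintro ⟨x, y⟩ ⟨hx, hy⟩
  refine h x ⟨by linarith [hx.1.1], by linarith [hx.1.2]⟩ hx.2 y
    ⟨by linarith [hy.1.1], by linarith [hy.1.2]⟩ hy.2 (by linarith [hx.1.2, hy.1.1])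
    (by linarith [hx.1.1, hy.1.2])

/-- Continuity removes the exceptional set, and pairs at distance more than T/2 are covered by the
supremum over the compact simplex. -/
lemma exists_holder_of_logMem {T γ θ b B : ℝ} {q : ℝ≥0∞} (hT : 0 < T) (hb : 0 < b)
    (hq : q ≠ 0) (hθ : 0 < θ) (hγ : θ < γ) (hB : 0 ≤ B) {A : ℝ → ℝ → V}
    (hc : ContinuousOn (fun z : ℝ × ℝ => A z.1 z.2) (simplex T))
    (h0 : ∀ s, A s s = 0)
    (hm : AEStronglyMeasurable (fun z : ℝ × ℝ => A z.1 z.2) (volume.restrict (simplex T)))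
    (hA : LogMem T γ q (modulus₂ T b A))
    (htri : ∀ s u t, 0 ≤ s → s ≤ u → u ≤ t → t ≤ T →
      ‖A s t‖ ≤ ‖A s u‖ + ‖A u t‖ + B * (t - s) ^ θ) :
    ∃ K : ℝ, 0 ≤ K ∧ ∀ s t, 0 ≤ s → s ≤ t → t ≤ T → ‖A s t‖ ≤ K * (t - s) ^ θ := by
  obtain ⟨K, hK, N, hN, h⟩ := exists_ae_holder_of_logMem hT hb hq hθ hγ hB hm hA htri
  obtain ⟨M, hM, hbd⟩ := exists_bound_of_continuousOn_simplex hc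
  have hTθ : 0 < (T / 2) ^ θ := Real.rpow_pos_of_pos (by linarith) θ
  refine ⟨K + M / (T / 2) ^ θ, by positivity, fun s t hs hst ht => ?_⟩
  have hp : 0 ≤ (t - s) ^ θ := Real.rpow_nonneg (by linarith) θ
  rcases hst.eq_or_lt with rfl | hlt
  · rw [h0, norm_zero]
    positivity
  rcases le_or_gt (t - s) (T / 2) with hd | hd
  · refine (le_mul_rpow_of_dense hN hθ.le hc h hs hlt ht hd).trans ?_
    have : 0 ≤ M / (T / 2) ^ θ := by positivity
    gcongr
    linarith
  · refine (hbd s t hs hst ht).trans ?_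
    have h1 : (T / 2) ^ θ ≤ (t - s) ^ θ := Real.rpow_le_rpow (by linarith) hd.le hθ.le
    calc M = M / (T / 2) ^ θ * (T / 2) ^ θ := by field_simp
      _ ≤ M / (T / 2) ^ θ * (t - s) ^ θ := by gcongr
      _ ≤ (K + M / (T / 2) ^ θ) * (t - s) ^ θ := by
          gcongr
          linarith

end Modulus

/-! ### Continuous versions of rough paths -/

section Area

variable {n : ℕ}

/-- The matrix `a bᵀ`. -/
def tensor (a b : EuclideanSpace ℝ (Fin n)) : EuclideanSpace ℝ (Fin n × Fin n) :=
  WithLp.toLp 2 fun p => a p.1 * b p.2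

@[simp]
lemma tensor_apply (a b : EuclideanSpace ℝ (Fin n)) (p : Fin n × Fin n) :
    tensor a b p = a p.1 * b p.2 := rfl

lemma tensor_sub_left (a a' b : EuclideanSpace ℝ (Fin n)) :
    tensor (a - a') b = tensor a b - tensor a' b := by
  ext p
  simp [sub_mul]

lemma tensor_sub_right (a b b' : EuclideanSpace ℝ (Fin n)) :
    tensor a (b - b') = tensor a b - tensor a b' := by
  ext p
  simp [mul_sub]

lemma norm_tensor (a b : EuclideanSpace ℝ (Fin n)) : ‖tensor a b‖ = ‖a‖ * ‖b‖ := by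
  rw [EuclideanSpace.norm_eq, EuclideanSpace.norm_eq, EuclideanSpace.norm_eq,
    ← Real.sqrt_mul (Finset.sum_nonneg fun _ _ => sq_nonneg _), Fintype.sum_prod_type,
    Finset.sum_mul_sum]
  simp [mul_pow]

lemma continuous_tensor :
    Continuous fun z : EuclideanSpace ℝ (Fin n) × EuclideanSpace ℝ (Fin n) => tensor z.1 z.2 := by
  unfold tensor
  fun_prop

lemma continuousOn_incr {V : Type*} [NormedAddCommGroup V] {T : ℝ} {X : ℝ → V}
    (hX : ContinuousOn X (Icc 0 T)) :
    ContinuousOn (fun z : ℝ × ℝ => incr X z.1 z.2) (simplex T) :=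
  (hX.comp continuousOn_snd fun _ hz => ⟨hz.1.trans hz.2.1, hz.2.2⟩).sub
    (hX.comp continuousOn_fst fun _ hz => ⟨hz.1, hz.2.1.trans hz.2.2⟩)

lemma measurableSet_simplex (T : ℝ) : MeasurableSet (simplex T) :=
  (isCompact_simplex T).measurableSet

lemma measurable₂_of_continuousOn {V : Type*} [NormedAddCommGroup V] {T : ℝ} {A : ℝ → ℝ → V}
    (hA : ContinuousOn (fun z : ℝ × ℝ => A z.1 z.2) (simplex T)) : Measurable₂ T A := by
  refine ⟨hA.aestronglyMeasurable (measurableSet_simplex T), fun h hh => ?_⟩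
  refine ContinuousOn.aestronglyMeasurable ?_ measurableSet_Icc
  refine hA.comp (f := fun r => (r, r + h)) (by fun_prop) fun r hr => ?_
  exact ⟨hr.1, by linarith [hh.1], by linarith [hr.2]⟩

lemma MemBesov.exists_holder {V : Type*} [NormedAddCommGroup V] {T α β θ : ℝ} {q : ℝ≥0∞}
    {X : ℝ → V} (hX : MemBesov T α β q X) (hT : 0 < T) (hβ : 0 < β) (hq : q ≠ 0) (hθ : 0 < θ)
    (hα : θ < α) :
    ∃ K : ℝ, 0 ≤ K ∧ ∀ s t, 0 ≤ s → s ≤ t → t ≤ T → ‖X t - X s‖ ≤ K * (t - s) ^ θ := by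
  have hc := continuousOn_incr hX.1
  refine exists_holder_of_logMem (A := incr X) (B := 0) hT hβ hq hθ hα le_rfl hc
    (fun s => sub_self _) (measurable₂_of_continuousOn hc).1 hX.2.2 fun s u t _ _ _ _ => ?_
  have e : incr X s t = incr X s u + incr X u t := by
    unfold incr
    abel
  rw [e, zero_mul, add_zero]
  exact norm_add_le _ _

lemma rpow_mul_rpow_le {s u t θ : ℝ} (hθ : 0 ≤ θ) (hsu : s ≤ u) (hut : u ≤ t) :
    (u - s) ^ θ * (t - u) ^ θ ≤ (t - s) ^ (2 * θ) := by
  have e : (t - s) ^ (2 * θ) = (t - s) ^ θ * (t - s) ^ θ := by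
    rw [two_mul, Real.rpow_add_of_nonneg (by linarith) hθ hθ]
  rw [e]
  exact mul_le_mul (Real.rpow_le_rpow (by linarith) (by linarith) hθ)
    (Real.rpow_le_rpow (by linarith) (by linarith) hθ) (Real.rpow_nonneg (by linarith) _)
    (Real.rpow_nonneg (by linarith) _)

lemma norm_le_of_chen {X : ℝ → EuclideanSpace ℝ (Fin n)}
    {XX : ℝ → ℝ → EuclideanSpace ℝ (Fin n × Fin n)} {s u t T θ A : ℝ} (hθ : 0 ≤ θ) (hA : 0 ≤ A)
    (hX : ∀ s t, 0 ≤ s → s ≤ t → t ≤ T → ‖X t - X s‖ ≤ A * (t - s) ^ θ)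
    (h : XX s t = XX s u + XX u t + tensor (X u - X s) (X t - X u))
    (hs : 0 ≤ s) (hsu : s ≤ u) (hut : u ≤ t) (ht : t ≤ T) :
    ‖XX s t‖ ≤ ‖XX s u‖ + ‖XX u t‖ + A * A * (t - s) ^ (2 * θ) := by
  rw [h]
  refine norm_add₃_le.trans ?_
  gcongr
  rw [norm_tensor]
  calc ‖X u - X s‖ * ‖X t - X u‖ ≤ (A * (u - s) ^ θ) * (A * (t - u) ^ θ) :=
        mul_le_mul (hX s u hs hsu (hut.trans ht)) (hX u t (hs.trans hsu) hut ht) (norm_nonneg _)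
          (mul_nonneg hA (Real.rpow_nonneg (by linarith) _))
    _ = A * A * ((u - s) ^ θ * (t - u) ^ θ) := by ring
    _ ≤ _ := by
        gcongr
        exact rpow_mul_rpow_le hθ hsu hut

/-- Near x the values of G on S form a Cauchy filter. This is how the path underlying the second
level is extended across a null set. -/
lemma exists_tendsto_of_holder {V : Type*} [NormedAddCommGroup V] [CompleteSpace V] {S : Set ℝ}
    {G : ℝ → V} {K θ δ : ℝ} (hθ : 0 < θ) (hδ : 0 < δ)
    (h : ∀ s ∈ S, ∀ t ∈ S, s ≤ t → t - s ≤ δ → ‖G t - G s‖ ≤ K * (t - s) ^ θ) {x : ℝ}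
    (hx : x ∈ closure S) : ∃ y, Tendsto G (𝓝[S] x) (𝓝 y) := by
  have hne : (𝓝[S] x).NeBot := mem_closure_iff_nhdsWithin_neBot.1 hx
  rw [← cauchy_map_iff_exists_tendsto, Metric.cauchy_iff]
  refine ⟨inferInstance, fun ε hε => ?_⟩
  have ht : Tendsto (fun r : ℝ => K * r ^ θ) (𝓝 0) (𝓝 0) := by
    have : Continuous fun r : ℝ => K * r ^ θ :=
      continuous_const.mul (continuous_id.rpow_const fun _ => Or.inr hθ.le)
    simpa [Real.zero_rpow hθ.ne'] using this.tendsto 0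
  obtain ⟨ρ, hρ, hρ'⟩ := Metric.eventually_nhds_iff.1 (ht.eventually_lt_const hε)
  set η := min δ ρ / 2 with hη
  have hη0 : 0 < η := by positivity
  have hη1 : 2 * η ≤ δ := by rw [hη]; linarith [min_le_left δ ρ]
  have hη2 : 2 * η ≤ ρ := by rw [hη]; linarith [min_le_right δ ρ]
  have key : ∀ s ∈ S, ∀ t ∈ S, s ≤ t → t - s < 2 * η → ‖G t - G s‖ < ε := by
    intro s hs t ht' hst hd
    refine (h s hs t ht' hst (by linarith)).trans_lt (hρ' ?_)
    rw [Real.dist_eq, sub_zero, abs_of_nonneg (by linarith)]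
    linarith
  refine ⟨G '' (S ∩ Ioo (x - η) (x + η)), ?_, ?_⟩
  · refine image_mem_map (inter_mem self_mem_nhdsWithin
      (mem_nhdsWithin_of_mem_nhds (Ioo_mem_nhds (by linarith) (by linarith))))
  · rintro _ ⟨s, ⟨hs, hs'⟩, rfl⟩ _ ⟨t, ⟨ht, ht'⟩, rfl⟩
    rcases le_total s t with hst | hst
    · rw [dist_comm, dist_eq_norm]
      exact key s hs t ht hst (by linarith [hs'.1, ht'.2])
    · rw [dist_eq_norm]
      exact key t ht s hs hst (by linarith [hs'.2, ht'.1])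

lemma ae_notMem_add {N : Set ℝ} (hN : volume N = 0) (c : ℝ) : ∀ᵐ r, r + c ∉ N :=
  (measurePreserving_add_right volume c).quasiMeasurePreserving.ae
    (measure_eq_zero_iff_ae_notMem.1 hN)

lemma ae_section_eq_of_null {V : Type*} {T : ℝ} {N : Set ℝ} (hN : volume N = 0)
    {A B : ℝ → ℝ → V}
    (h : ∀ s t, 0 ≤ s → s ≤ t → t ≤ T → s ∉ N → t ∉ N → A s t = B s t) {h' : ℝ}
    (hh : h' ∈ Icc 0 T) :
    ∀ᵐ r ∂volume.restrict (Icc 0 (T - h')), A r (r + h') = B r (r + h') := by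
  filter_upwards [ae_restrict_simplex_section hh,
    ae_restrict_of_ae (measure_eq_zero_iff_ae_notMem.1 hN),
    ae_restrict_of_ae (ae_notMem_add hN h')] with r h1 h2 h3
  exact h _ _ h1.1 h1.2.1 h1.2.2 h2 h3

lemma Measurable₂.congr_null {V : Type*} [NormedAddCommGroup V] {T : ℝ} {N : Set ℝ}
    (hN : volume N = 0) {A B : ℝ → ℝ → V}
    (h : ∀ s t, 0 ≤ s → s ≤ t → t ≤ T → s ∉ N → t ∉ N → A s t = B s t) (hA : Measurable₂ T A) :
    Measurable₂ T B := by
  have hae := measure_eq_zero_iff_ae_notMem.1 hN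
  refine ⟨hA.1.congr ?_, fun x hx => (hA.2 x hx).congr (ae_section_eq_of_null hN h hx)⟩
  have h1 : ∀ᵐ z : ℝ × ℝ, z.1 ∉ N := Measure.quasiMeasurePreserving_fst.ae hae
  have h2 : ∀ᵐ z : ℝ × ℝ, z.2 ∉ N := Measure.quasiMeasurePreserving_snd.ae hae
  filter_upwards [ae_restrict_of_ae h1, ae_restrict_of_ae h2,
    ae_restrict_mem (measurableSet_simplex T)] with z h1 h2 h3
  exact h _ _ h3.1 h3.2.1 h3.2.2 h1 h2

/-- For fixed h, almost every r has both r and r + h outside N. -/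
lemma MemBesov₂.congr_null {V : Type*} [NormedAddCommGroup V] {T a b : ℝ} {q : ℝ≥0∞} {N : Set ℝ}
    (hb : 0 < b) (hN : volume N = 0) {A B : ℝ → ℝ → V}
    (h : ∀ s t, 0 ≤ s → s ≤ t → t ≤ T → s ∉ N → t ∉ N → A s t = B s t)
    (hA : MemBesov₂ T a b q A) : MemBesov₂ T a b q B :=
  ⟨hA.1.congr_null hN h,
    (besovNorm₂_congr hb fun _ hx => ae_section_eq_of_null hN h hx) ▸ hA.2⟩

/-- A Besov-Orlicz rough path with a continuous second level, with Hölder bounds of exponent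
`θ`. -/
structure IsContRoughPath (T α β : ℝ) (q : ℝ≥0∞) (θ A : ℝ) (X : ℝ → EuclideanSpace ℝ (Fin n))
    (XX : ℝ → ℝ → EuclideanSpace ℝ (Fin n × Fin n)) : Prop where
  path : MemBesov T α β q X
  area : MemBesov₂ T (2 * α) (β / 2) (q / 2) XX
  cont : ContinuousOn (fun z : ℝ × ℝ => XX z.1 z.2) (simplex T)
  diag : ∀ s, XX s s = 0
  chen : ∀ s u t, XX s t = XX s u + XX u t + tensor (X u - X s) (X t - X u)
  nonneg : 0 ≤ A
  path_le : ∀ s t, 0 ≤ s → s ≤ t → t ≤ T → ‖X t - X s‖ ≤ A * (t - s) ^ θ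
  area_le : ∀ s t, 0 ≤ s → s ≤ t → t ≤ T → ‖XX s t‖ ≤ A * (t - s) ^ (2 * θ)

/-- The second level of a rough path has a continuous version. -/
theorem IsRoughPath.exists_continuous_version {T α β θ : ℝ} {q : ℝ≥0∞}
    {X : ℝ → EuclideanSpace ℝ (Fin n)} {XX : ℝ → ℝ → EuclideanSpace ℝ (Fin n × Fin n)}
    (hX : IsRoughPath T α β q X XX) (hT : 0 < T) (hβ : 0 < β) (hq : q ≠ 0) (hθ : 0 < θ)
    (hα : θ < α) :
    ∃ (XX' : ℝ → ℝ → EuclideanSpace ℝ (Fin n × Fin n)) (N : Set ℝ) (A : ℝ), volume N = 0 ∧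
      (∀ s t, 0 ≤ s → s ≤ t → t ≤ T → s ∉ N → t ∉ N → XX s t = XX' s t) ∧
      IsContRoughPath T α β q θ A X XX' := by
  obtain ⟨A, hA, hXh⟩ := hX.path.exists_holder hT hβ hq hθ hα
  have hq2 : q / 2 ≠ 0 := (ENNReal.div_pos hq ENNReal.ofNat_ne_top).ne'
  have chen : ∀ s u t, 0 ≤ s → s ≤ u → u ≤ t → t ≤ T →
      XX s t = XX s u + XX u t + tensor (X u - X s) (X t - X u) := by
    intro s u t hs hsu hut ht
    ext ⟨i, j⟩
    have := hX.chen s u t hs hsu hut ht i j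
    simp only [PiLp.add_apply, tensor_apply, PiLp.sub_apply]
    linarith
  obtain ⟨K, hK, N, hN, hKN⟩ := exists_ae_holder_of_logMem (θ := 2 * θ) (B := A * A) hT
    (half_pos hβ) hq2 (by linarith) (by linarith) (mul_nonneg hA hA) hX.area.1.1 hX.area.2
    fun s u t hs hsu hut ht => norm_le_of_chen hθ.le hA hXh (chen s u t hs hsu hut ht) hs hsu hut ht
  set S := Icc 0 T ∩ Nᶜ with hS
  -- By Chen's relation the one-parameter path t ↦ 𝕏_{0,t} determines 𝕏 together with X. It is
  -- Hölder continuous on the complement of N, even if 0 itself belongs to N, because only 𝕏_{s,t}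
  -- with s, t outside N enters its increments.
  set G : ℝ → EuclideanSpace ℝ (Fin n × Fin n) := fun t => XX 0 t with hG
  have hGsub : ∀ s t, 0 ≤ s → s ≤ t → t ≤ T →
      G t - G s = XX s t + tensor (X s - X 0) (X t - X s) := by
    intro s t hs hst ht
    simp only [hG]
    rw [chen 0 s t le_rfl hs hst ht]
    abel
  have hTθ : 0 ≤ T ^ θ := Real.rpow_nonneg hT.le θ
  have hGh : ∀ s ∈ S, ∀ t ∈ S, s ≤ t → t - s ≤ T / 2 →
      ‖G t - G s‖ ≤ (K * T ^ θ + A * T ^ θ * A) * (t - s) ^ θ := by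
    intro s hs t ht hst hd
    have h0 : 0 ≤ (t - s) ^ θ := Real.rpow_nonneg (by linarith) _
    rcases hst.eq_or_lt with rfl | hlt
    · simp only [sub_self, norm_zero]
      rw [sub_self] at h0
      positivity
    rw [hGsub s t hs.1.1 hst ht.1.2]
    refine (norm_add_le _ _).trans ?_
    have h1 := hKN s hs.1 hs.2 t ht.1 ht.2 hlt hd
    have h2 : ‖X s - X 0‖ ≤ A * T ^ θ := by
      refine (hXh 0 s le_rfl hs.1.1 hs.1.2).trans ?_
      have := Real.rpow_le_rpow (by linarith [hs.1.1]) (by linarith [hs.1.2] : s - 0 ≤ T) hθ.le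
      gcongr
    have h3 := hXh s t hs.1.1 hst ht.1.2
    have h4 : (t - s) ^ (2 * θ) ≤ T ^ θ * (t - s) ^ θ := by
      rw [two_mul, Real.rpow_add_of_nonneg (by linarith) hθ.le hθ.le]
      have := Real.rpow_le_rpow (by linarith) (by linarith [hs.1.1, ht.1.2] : t - s ≤ T) hθ.le
      gcongr
    rw [norm_tensor, add_mul]
    refine add_le_add (h1.trans ?_) ?_
    · rw [mul_assoc]
      gcongr
    · calc ‖X s - X 0‖ * ‖X t - X s‖ ≤ (A * T ^ θ) * (A * (t - s) ^ θ) :=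
            mul_le_mul h2 h3 (norm_nonneg _) (by positivity)
        _ = _ := by ring
  have hcl : Icc 0 T ⊆ closure S := by
    rw [hS, ← closure_Ioo hT.ne]
    refine closure_minimal (((dense_compl_of_volume_eq_zero hN).open_subset_closure_inter
      isOpen_Ioo).trans (closure_mono ?_)) isClosed_closure
    exact inter_subset_inter_left _ Ioo_subset_Icc_self
      |>.trans (by rw [closure_Ioo hT.ne])
  have hlim : ∀ x ∈ Icc 0 T, ∃ y, Tendsto G (𝓝[S] x) (𝓝 y) := fun x hx =>
    exists_tendsto_of_holder hθ (half_pos hT) hGh (hcl hx)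
  have hcont : ContinuousOn (extendFrom S G) (Icc 0 T) := continuousOn_extendFrom hcl hlim
  have hext : ∀ x ∈ S, extendFrom S G x = G x := by
    intro x hx
    obtain ⟨y, hy⟩ := hlim x hx.1
    have h1 : y = G x := by
      have hp : pure x ≤ 𝓝[S] x := pure_le_nhdsWithin hx
      exact tendsto_nhds_unique (hy.mono_left hp) (tendsto_pure_nhds G x)
    rw [extendFrom_eq (hcl hx.1) hy, h1]
  set H := extendFrom S G with hH
  -- Rebuilding the second level from the extended path makes Chen's relation an algebraic identity
  -- for all triples of times.
  set XX' : ℝ → ℝ → EuclideanSpace ℝ (Fin n × Fin n) := fun s t =>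
    incr H s t - tensor (X s - X 0) (incr X s t) with hXX'
  have heq : ∀ s t, 0 ≤ s → s ≤ t → t ≤ T → s ∉ N → t ∉ N → XX s t = XX' s t := by
    intro s t hs hst ht hsN htN
    simp only [hXX', incr]
    rw [hext s ⟨⟨hs, hst.trans ht⟩, hsN⟩, hext t ⟨⟨hs.trans hst, ht⟩, htN⟩, hGsub s t hs hst ht]
    abel
  have hc : ContinuousOn (fun z : ℝ × ℝ => XX' z.1 z.2) (simplex T) := by
    refine (continuousOn_incr hcont).sub (continuous_tensor.comp_continuousOn
      (ContinuousOn.prodMk ?_ (continuousOn_incr hX.path.1)))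
    exact (hX.path.1.comp continuousOn_fst fun _ hz => ⟨hz.1, hz.2.1.trans hz.2.2⟩).sub
      continuousOn_const
  have h0 : ∀ s, XX' s s = 0 := fun s => by
    ext p
    simp [hXX', incr]
  have chen' : ∀ s u t, XX' s t = XX' s u + XX' u t + tensor (X u - X s) (X t - X u) := by
    intro s u t
    simp only [hXX', incr, tensor_sub_left, tensor_sub_right]
    abel
  have hmem := hX.area.congr_null (half_pos hβ) hN heq
  obtain ⟨K', hK', hh⟩ := exists_holder_of_logMem (θ := 2 * θ) (B := A * A) hT
    (half_pos hβ) hq2 (by linarith) (by linarith) (mul_nonneg hA hA) hc h0 hmem.1.1 hmem.2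
    fun s u t hs hsu hut ht => norm_le_of_chen hθ.le hA hXh (chen' s u t) hs hsu hut ht
  refine ⟨XX', N, A + K', hN, heq, hX.path, hmem, hc, h0, chen', by positivity,
    fun s t hs hst ht => (hXh s t hs hst ht).trans ?_,
    fun s t hs hst ht => (hh s t hs hst ht).trans ?_⟩
  · have := Real.rpow_nonneg (by linarith : 0 ≤ t - s) θ
    gcongr
    linarith
  · have := Real.rpow_nonneg (by linarith : 0 ≤ t - s) (2 * θ)
    gcongr
    linarith

lemma UnitPartition.pt_le_pt (π : UnitPartition) {i j : ℕ} (hij : j ≤ i) (hi : i ≤ π.N) :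
    π.pt j ≤ π.pt i := by
  induction i, hij using Nat.le_induction with
  | base => exact le_rfl
  | succ i _ ih => exact (ih (by omega)).trans (π.pt_lt i (by omega)).le

lemma UnitPartition.pt_nonneg (π : UnitPartition) {i : ℕ} (hi : i ≤ π.N) : 0 ≤ π.pt i :=
  π.pt_zero ▸ π.pt_le_pt (Nat.zero_le i) hi

lemma UnitPartition.pt_le_one (π : UnitPartition) {i : ℕ} (hi : i ≤ π.N) : π.pt i ≤ 1 :=
  π.pt_last ▸ π.pt_le_pt hi le_rfl

/-- For fixed h and a fixed partition, almost every r is such that no partition point of [r, r+h]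
lies in N, so the compensated sums agree for almost every r. -/
lemma IsRoughIntegral.congr_area {W : Type*} [NormedAddCommGroup W] [NormedSpace ℝ W]
    {T α β : ℝ} {q : ℝ≥0∞} {X : ℝ → EuclideanSpace ℝ (Fin n)}
    {XX XX' : ℝ → ℝ → EuclideanSpace ℝ (Fin n × Fin n)}
    {Z : ℝ → EuclideanSpace ℝ (Fin n) →L[ℝ] W}
    {Z' : ℝ → EuclideanSpace ℝ (Fin n) →L[ℝ] EuclideanSpace ℝ (Fin n) →L[ℝ] W} {I : ℝ → W}
    (hβ : 0 < β) {N : Set ℝ} (hN : volume N = 0)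
    (h : ∀ s t, 0 ≤ s → s ≤ t → t ≤ T → s ∉ N → t ∉ N → XX s t = XX' s t)
    (hI : IsRoughIntegral T α β q X XX Z Z' I) : IsRoughIntegral T α β q X XX' Z Z' I where
  continuousOn := hI.continuousOn
  zero := hI.zero
  approx := by
    refine hI.approx.congr_null (by positivity) hN fun s t h1 h2 h3 h4 h5 => ?_
    simp only [localApprox, h s t h1 h2 h3 h4 h5]
  tendsto_sum r hr hr' π hπ := by
    refine (hI.tendsto_sum r hr hr' π hπ).congr fun k => ?_
    refine besovNorm₂_congr (by positivity) fun x hx => ?_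
    have hae : ∀ᵐ r, ∀ i, r + (π k).pt i * x ∉ N := ae_all_iff.2 fun i => ae_notMem_add hN _
    filter_upwards [ae_restrict_simplex_section hx, ae_restrict_of_ae hae] with r h1 h2
    congr 1
    refine Finset.sum_congr rfl fun i hi => ?_
    have hi' := Finset.mem_range.1 hi
    have e1 := (π k).pt_nonneg hi'.le
    have e2 := (π k).pt_lt i hi'
    have e3 := (π k).pt_le_one hi'
    have hx0 := hx.1
    simp only [localApprox, add_sub_cancel_left]
    rw [h _ _ (by nlinarith) (by nlinarith) (by nlinarith) (h2 i) (h2 (i + 1))]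

lemma IsSolution.congr_area {m : ℕ} {T α β : ℝ} {q : ℝ≥0∞} {X : ℝ → EuclideanSpace ℝ (Fin n)}
    {XX XX' : ℝ → ℝ → EuclideanSpace ℝ (Fin n × Fin n)}
    {f : EuclideanSpace ℝ (Fin m) → EuclideanSpace ℝ (Fin n) →L[ℝ] EuclideanSpace ℝ (Fin m)}
    {y : EuclideanSpace ℝ (Fin m)} {Y : ℝ → EuclideanSpace ℝ (Fin m)}
    {Y' : ℝ → EuclideanSpace ℝ (Fin n) →L[ℝ] EuclideanSpace ℝ (Fin m)}
    (hβ : 0 < β) {N : Set ℝ} (hN : volume N = 0)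
    (h : ∀ s t, 0 ≤ s → s ≤ t → t ≤ T → s ∉ N → t ∉ N → XX s t = XX' s t)
    (hY : IsSolution T α β q X XX f y Y Y') : IsSolution T α β q X XX' f y Y Y' where
  controlled := hY.controlled
  deriv_eq := hY.deriv_eq
  eq := by
    obtain ⟨I, hI, hYI⟩ := hY.eq
    exact ⟨I, hI.congr_area hβ hN h, hYI⟩

end Area

/-! ### The second level as a functional on bilinear maps -/

section AreaAction

set_option maxSynthPendingDepth 3

variable {n : ℕ} {E : Type*} [NormedAddCommGroup E] [NormedSpace ℝ E]

/-- The linear functional `B ↦ ∑_{ij} B(e_i, e_j) x_{ij}` on bilinear maps. -/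
def areaAction (E : Type*) [NormedAddCommGroup E] [NormedSpace ℝ E]
    (x : EuclideanSpace ℝ (Fin n × Fin n)) :
    (EuclideanSpace ℝ (Fin n) →L[ℝ] EuclideanSpace ℝ (Fin n) →L[ℝ] E) →L[ℝ] E :=
  ∑ i : Fin n, ∑ j : Fin n, x (i, j) •
    (ContinuousLinearMap.apply ℝ E (EuclideanSpace.single j (1 : ℝ))).comp
      (ContinuousLinearMap.apply ℝ (EuclideanSpace ℝ (Fin n) →L[ℝ] E)
        (EuclideanSpace.single i (1 : ℝ)))

lemma areaAction_apply (x : EuclideanSpace ℝ (Fin n × Fin n))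
    (B : EuclideanSpace ℝ (Fin n) →L[ℝ] EuclideanSpace ℝ (Fin n) →L[ℝ] E) :
    areaAction E x B = ∑ i : Fin n, ∑ j : Fin n, x (i, j) •
      B (EuclideanSpace.single i 1) (EuclideanSpace.single j 1) := by
  simp [areaAction]

lemma areaAction_add (x x' : EuclideanSpace ℝ (Fin n × Fin n)) :
    areaAction E (x + x') = areaAction E x + areaAction E x' := by
  simp [areaAction, add_smul, Finset.sum_add_distrib]

/-- This converts the matrix form of Chen's relation into the form used for the Davie scheme. -/
lemma areaAction_tensor (a b : EuclideanSpace ℝ (Fin n))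
    (B : EuclideanSpace ℝ (Fin n) →L[ℝ] EuclideanSpace ℝ (Fin n) →L[ℝ] E) :
    areaAction E (tensor a b) B = B a b := by
  have h : ∀ a : EuclideanSpace ℝ (Fin n), a = ∑ i, a i • EuclideanSpace.single i (1 : ℝ) :=
    fun a => by
      conv_lhs => rw [← (EuclideanSpace.basisFun (Fin n) ℝ).sum_repr a]
      simp
  rw [areaAction_apply]
  conv_rhs => rw [h a, h b]
  simp only [map_sum, map_smul, sum_apply, smul_apply, Finset.smul_sum, smul_smul, tensor_apply]
  rw [Finset.sum_comm]
  simp only [mul_comm]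

lemma exists_norm_areaAction_le (n : ℕ) (E : Type*) [NormedAddCommGroup E] [NormedSpace ℝ E] :
    ∃ c : ℝ, 0 ≤ c ∧ ∀ x : EuclideanSpace ℝ (Fin n × Fin n), ‖areaAction E x‖ ≤ c * ‖x‖ := by
  refine ⟨∑ i : Fin n, ∑ j : Fin n,
    ‖(ContinuousLinearMap.apply ℝ E (EuclideanSpace.single j (1 : ℝ))).comp
      (ContinuousLinearMap.apply ℝ (EuclideanSpace ℝ (Fin n) →L[ℝ] E)
        (EuclideanSpace.single i (1 : ℝ)))‖, by positivity, fun x => ?_⟩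
  unfold areaAction
  rw [Finset.sum_mul]
  refine norm_sum_le_of_le _ fun i _ => ?_
  rw [Finset.sum_mul]
  refine norm_sum_le_of_le _ fun j _ => ?_
  rw [norm_smul, mul_comm]
  gcongr
  exact PiLp.norm_apply_le x (i, j)

lemma continuous_areaAction :
    Continuous (areaAction E : EuclideanSpace ℝ (Fin n × Fin n) → _) := by
  unfold areaAction
  fun_prop

lemma IsContRoughPath.exists_roughBound {T α β θ A : ℝ} {q : ℝ≥0∞}
    {X : ℝ → EuclideanSpace ℝ (Fin n)} {XX : ℝ → ℝ → EuclideanSpace ℝ (Fin n × Fin n)}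
    (hX : IsContRoughPath T α β q θ A X XX) (E : Type*) [NormedAddCommGroup E]
    [NormedSpace ℝ E] : ∃ A', RoughBound T θ A' X fun s t => areaAction E (XX s t) := by
  obtain ⟨c, hc, h⟩ := exists_norm_areaAction_le n E
  have hA := hX.nonneg
  refine ⟨A + c * A, by positivity, fun s t hs hst ht => ?_, fun s t hs hst ht => ?_,
    fun s u t _ _ _ _ B => ?_⟩
  · refine (hX.path_le s t hs hst ht).trans ?_
    have := Real.rpow_nonneg (by linarith : 0 ≤ t - s) θ
    gcongr
    nlinarith
  · have e : ((t - s) ^ θ) ^ 2 = (t - s) ^ (2 * θ) := by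
      rw [← Real.rpow_natCast, ← Real.rpow_mul (by linarith), mul_comm]
      norm_num
    have := Real.rpow_nonneg (by linarith : 0 ≤ t - s) (2 * θ)
    rw [e]
    calc ‖areaAction E (XX s t)‖ ≤ c * (A * (t - s) ^ (2 * θ)) :=
          (h _).trans (by gcongr; exact hX.area_le s t hs hst ht)
      _ = c * A * (t - s) ^ (2 * θ) := by ring
      _ ≤ (A + c * A) * (t - s) ^ (2 * θ) := by
          gcongr
          linarith
  · rw [hX.chen s u t, areaAction_add, areaAction_add, add_apply, add_apply, areaAction_tensor]

end AreaAction

/-! ### Sewing in Besov-Orlicz spaces -/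

section Sewing

variable {V : Type*} [NormedAddCommGroup V]

/-- The sewing lemma for moduli of continuity. -/
lemma logMem_modulus₂_of_sewing {T a b κ L : ℝ} {q : ℝ≥0∞} {N : ℝ → ℝ → V} {P : ℝ → ℝ≥0∞}
    (hT : 0 ≤ T) (hb : 0 < b) (hq : q ≠ 0) (ha : 1 < a) (hκ : 1 < κ) (hL : 0 ≤ L)
    (hc : ContinuousOn (fun z : ℝ × ℝ => N z.1 z.2) (simplex T))
    (hN : ∀ s t, 0 ≤ s → s ≤ t → t ≤ T → ‖N s t‖ ≤ L * (t - s) ^ κ)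
    (hP : Monotone P) (hPL : LogMem T a q P)
    (hstep : ∀ h, 0 ≤ h → 2 * h ≤ T → luxNorm b (Icc 0 (T - 2 * h))
      (fun r => ‖N r (r + 2 * h) - N r (r + h) - N (r + h) (r + 2 * h)‖) ≤ P h) :
    LogMem T a q (modulus₂ T b N) := by
  set ℓ : ℝ → ℝ≥0∞ := fun h => luxNorm b (Icc 0 (T - h)) fun r => ‖N r (r + h)‖ with hℓ
  -- One halving: the two half-interval sections have norm at most ℓ(h) each, the second after a
  -- translation by h.
  have hrec : ∀ h, 0 ≤ h → 2 * h ≤ T → ℓ (2 * h) ≤ 2 * ℓ h + P h := by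
    intro h h0 hh
    have h1 : luxNorm b (Icc 0 (T - 2 * h)) (fun r => ‖N r (r + h)‖) ≤ ℓ h :=
      luxNorm_mono hb (Icc_subset_Icc le_rfl (by linarith)) (ae_of_all _ fun _ => le_rfl)
    have h2 : luxNorm b (Icc 0 (T - 2 * h)) (fun r => ‖N (r + h) (r + 2 * h)‖) ≤ ℓ h := by
      have := luxNorm_shift_le (x := 0) (y := T - 2 * h) (c := h) (x' := 0) (y' := T - h)
        (g := fun r => ‖N r (r + h)‖) hb (by linarith) (by linarith)
      refine le_of_eq_of_le ?_ this
      congr 1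
      funext r
      congr 2
      ring
    calc ℓ (2 * h) ≤ luxNorm b (Icc 0 (T - 2 * h)) (fun r => ‖N r (r + h)‖) +
          luxNorm b (Icc 0 (T - 2 * h)) (fun r => ‖N (r + h) (r + 2 * h)‖ +
            ‖N r (r + 2 * h) - N r (r + h) - N (r + h) (r + 2 * h)‖) := by
          refine luxNorm_add_le hb (ContinuousOn.aemeasurable (ContinuousOn.norm
            (hc.comp (f := fun r => (r, r + h)) (by fun_prop) fun r hr => ⟨hr.1, by linarith,
              by linarith [hr.2]⟩)) measurableSet_Icc) (ae_of_all _ fun r => ?_)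
          rw [abs_norm, abs_norm, abs_of_nonneg (by positivity)]
          have e : N r (r + 2 * h) = N r (r + h) + N (r + h) (r + 2 * h) +
            (N r (r + 2 * h) - N r (r + h) - N (r + h) (r + 2 * h)) := by abel
          conv_lhs => rw [e]
          exact norm_add₃_le.trans (le_of_eq (add_assoc _ _ _))
      _ ≤ ℓ h + (luxNorm b (Icc 0 (T - 2 * h)) (fun r => ‖N (r + h) (r + 2 * h)‖) +
            luxNorm b (Icc 0 (T - 2 * h))
              (fun r => ‖N r (r + 2 * h) - N r (r + h) - N (r + h) (r + 2 * h)‖)) := by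
          refine add_le_add h1 (luxNorm_add_le hb ?_ (ae_of_all _ fun r => ?_))
          · refine ContinuousOn.aemeasurable (ContinuousOn.norm (hc.comp
              (f := fun r => (r + h, r + 2 * h)) (by fun_prop) fun r hr => ?_)) measurableSet_Icc
            exact ⟨by linarith [hr.1], by linarith, by linarith [hr.2]⟩
          · rw [abs_norm, abs_norm, abs_of_nonneg (by positivity)]
      _ ≤ ℓ h + (ℓ h + P h) := add_le_add le_rfl (add_le_add h2 (hstep h h0 hh))
      _ = 2 * ℓ h + P h := by ring
  set S : ℝ → ℝ≥0∞ := fun τ => ∑' k : ℕ, 2 ^ k * P ((1 / 2) ^ (k + 1) * τ) with hS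
  have hiter : ∀ (K : ℕ) h, 0 ≤ h → h ≤ T → ℓ h ≤ 2 ^ K * ℓ ((1 / 2) ^ K * h) +
      ∑ k ∈ Finset.range K, 2 ^ k * P ((1 / 2) ^ (k + 1) * h) := by
    intro K h h0 hh
    induction K with
    | zero => simp
    | succ K ih =>
      have hp1 : (1 / 2 : ℝ) ^ K ≤ 1 := pow_le_one₀ (by norm_num) (by norm_num)
      have e : (1 / 2 : ℝ) ^ K * h = 2 * ((1 / 2) ^ (K + 1) * h) := by rw [pow_succ]; ring
      have h1 := hrec ((1 / 2) ^ (K + 1) * h) (by positivity) (by rw [← e]; nlinarith)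
      rw [← e] at h1
      refine ih.trans ?_
      rw [Finset.sum_range_succ]
      calc 2 ^ K * ℓ ((1 / 2) ^ K * h) + ∑ k ∈ Finset.range K, 2 ^ k * P ((1 / 2) ^ (k + 1) * h)
          ≤ 2 ^ K * (2 * ℓ ((1 / 2) ^ (K + 1) * h) + P ((1 / 2) ^ (K + 1) * h)) +
            ∑ k ∈ Finset.range K, 2 ^ k * P ((1 / 2) ^ (k + 1) * h) := by gcongr
        _ = _ := by ring
  obtain ⟨c, hc0, hbd⟩ := exists_luxNorm_le_of_bound hb hT
  have hℓle : ∀ h, 0 ≤ h → h ≤ T → ℓ h ≤ ENNReal.ofReal (c * (L * h ^ κ)) := by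
    intro h h0 hh
    have hp := Real.rpow_nonneg h0 κ
    refine hbd _ (Icc_subset_Icc le_rfl (by linarith)) _ _ (by positivity) ?_
    filter_upwards [ae_restrict_simplex_section ⟨h0, hh⟩] with r hr
    rw [abs_norm]
    simpa using hN _ _ hr.1 hr.2.1 hr.2.2
  -- The a priori Hölder bound with κ > 1 sends 2^K ℓ(2^{-K}h) to 0, so only the dyadic series of P
  -- remains. The value of κ leaves no trace in the result, which is how the exponent a is reached
  -- from a weaker Hölder bound.
  have hfin : ∀ h, 0 ≤ h → h ≤ T → ℓ h ≤ S h := by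
    intro h h0 hh
    have hlim : Tendsto (fun K : ℕ => ENNReal.ofReal
        ((2 * (1 / 2 : ℝ) ^ κ) ^ K * (c * (L * h ^ κ))) + S h) atTop (𝓝 (0 + S h)) := by
      refine Tendsto.add_const (S h) ?_
      rw [← ENNReal.ofReal_zero, ← zero_mul (c * (L * h ^ κ))]
      refine ENNReal.tendsto_ofReal (Tendsto.mul_const _
        (tendsto_pow_atTop_nhds_zero_of_lt_one (by positivity) ?_))
      have : (1 / 2 : ℝ) ^ κ < (1 / 2) ^ (1 : ℝ) :=
        Real.rpow_lt_rpow_of_exponent_gt (by norm_num) (by norm_num) hκ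
      rw [Real.rpow_one] at this
      linarith
    rw [zero_add] at hlim
    refine ge_of_tendsto' hlim fun K => (hiter K h h0 hh).trans (add_le_add ?_ ?_)
    · have hp1 : (1 / 2 : ℝ) ^ K ≤ 1 := pow_le_one₀ (by norm_num) (by norm_num)
      refine (mul_le_mul_right (hℓle _ (by positivity) (by nlinarith)) _).trans (le_of_eq ?_)
      rw [show (2 : ℝ≥0∞) ^ K = ENNReal.ofReal (2 ^ K) by
        rw [ENNReal.ofReal_pow (by norm_num), ENNReal.ofReal_ofNat],
        ← ENNReal.ofReal_mul (by positivity)]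
      congr 1
      rw [Real.mul_rpow (by positivity) h0, mul_pow, ← Real.rpow_natCast (1 / 2) K,
        ← Real.rpow_mul (by norm_num), mul_comm (K : ℝ) κ, Real.rpow_mul (by norm_num),
        Real.rpow_natCast]
      ring
    · exact ENNReal.sum_le_tsum _
  refine (hPL.tsum_dyadic hT ha hq hP.measurable).mono fun τ hτ =>
    modulus₂_le fun h h0 hh => (hfin h h0 (hh.trans hτ.2)).trans ?_
  refine ENNReal.tsum_le_tsum fun k => ?_
  gcongr
  exact hP (by gcongr)

lemma UnitPartition.sum_incr (π : UnitPartition) (I : ℝ → V) (s t : ℝ) :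
    π.sum (incr I) s t = incr I s t := by
  unfold UnitPartition.sum incr
  rw [Finset.sum_range_sub (fun i => I (s + π.pt i * (t - s))), π.pt_zero, π.pt_last]
  congr 2 <;> ring

lemma UnitPartition.sum_sub (π : UnitPartition) (A B : ℝ → ℝ → V) (s t : ℝ) :
    π.sum (fun s t => A s t - B s t) s t = π.sum A s t - π.sum B s t :=
  Finset.sum_sub_distrib _ _

lemma UnitPartition.N_pos (π : UnitPartition) : 0 < π.N := by
  by_contra h
  have h0 : π.N = 0 := by omega
  have h1 := π.pt_last
  rw [h0, π.pt_zero] at h1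
  exact zero_ne_one h1

lemma UnitPartition.le_mesh (π : UnitPartition) {i : ℕ} (hi : i < π.N) :
    π.pt (i + 1) - π.pt i ≤ π.mesh :=
  le_ciSup (f := fun i : Fin π.N => π.pt (i + 1) - π.pt i) (Set.finite_range _).bddAbove ⟨i, hi⟩

lemma luxNorm_sum_le {b : ℝ} {D : Set ℝ} (hb : 0 < b) (n : ℕ) {g : ℕ → ℝ → ℝ}
    (hg : ∀ i < n, AEMeasurable (g i) (volume.restrict D)) :
    luxNorm b D (fun r => ∑ i ∈ Finset.range n, |g i r|) ≤
      ∑ i ∈ Finset.range n, luxNorm b D (g i) := by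
  induction n with
  | zero => simp [luxNorm_zero]
  | succ n ih =>
    rw [Finset.sum_range_succ]
    have hm : AEMeasurable (fun r => ∑ i ∈ Finset.range n, |g i r|) (volume.restrict D) :=
      Finset.aemeasurable_fun_sum _ fun i hi =>
        measurable_norm.comp_aemeasurable (hg i ((Finset.mem_range.1 hi).trans n.lt_succ_self))
    refine (luxNorm_add_le hb (f := fun r => ∑ i ∈ Finset.range n, |g i r|) (g := g n) hm
      (ae_of_all _ fun r => ?_)).trans (add_le_add (ih fun i hi => hg i (by omega)) le_rfl)
    have h0 : 0 ≤ ∑ i ∈ Finset.range n, |g i r| := Finset.sum_nonneg fun _ _ => abs_nonneg _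
    rw [Finset.sum_range_succ, abs_of_nonneg (by positivity), abs_of_nonneg h0]

/-- The i-th summand is a translate of a section of N of width (t_{i+1} - t_i)h, so its norm is
bounded by the modulus at that scale. -/
lemma modulus₂_partition_sum_le {T b : ℝ} (hb : 0 < b) {N : ℝ → ℝ → V}
    (hc : ContinuousOn (fun z : ℝ × ℝ => N z.1 z.2) (simplex T)) (π : UnitPartition) (τ : ℝ) :
    modulus₂ T b (π.sum N) τ ≤
      ∑ i ∈ Finset.range π.N, modulus₂ T b N ((π.pt (i + 1) - π.pt i) * τ) := by
  refine modulus₂_le fun h h0 hh => ?_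
  set g : ℕ → ℝ → ℝ := fun i r => ‖N (r + π.pt i * h) (r + π.pt (i + 1) * h)‖ with hg
  have hpts : ∀ i < π.N, 0 ≤ π.pt i * h ∧ π.pt i * h ≤ π.pt (i + 1) * h ∧
      π.pt (i + 1) * h ≤ h := fun i hi => by
    have e1 := π.pt_nonneg hi.le
    have e2 := π.pt_lt i hi
    have e3 := π.pt_le_one (Nat.succ_le_of_lt hi)
    refine ⟨by positivity, by gcongr, by nlinarith⟩
  have h1 : luxNorm b (Icc 0 (T - h)) (fun r => ‖π.sum N r (r + h)‖) ≤
      luxNorm b (Icc 0 (T - h)) fun r => ∑ i ∈ Finset.range π.N, |g i r| := by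
    refine luxNorm_mono hb le_rfl (ae_of_all _ fun r => ?_)
    rw [abs_norm, abs_of_nonneg (Finset.sum_nonneg fun _ _ => abs_nonneg _)]
    simp only [UnitPartition.sum, hg, abs_norm, add_sub_cancel_left]
    exact norm_sum_le _ _
  refine h1.trans ((luxNorm_sum_le hb π.N fun i hi => ?_).trans (Finset.sum_le_sum fun i hi => ?_))
  · obtain ⟨p1, p2, p3⟩ := hpts i hi
    refine ContinuousOn.aemeasurable (ContinuousOn.norm ?_) measurableSet_Icc
    refine hc.comp (f := fun r => (r + π.pt i * h, r + π.pt (i + 1) * h)) (by fun_prop)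
      fun r hr => ?_
    exact ⟨by linarith [hr.1], by linarith, by linarith [hr.2]⟩
  · obtain ⟨p1, p2, p3⟩ := hpts i (Finset.mem_range.1 hi)
    have hd : 0 ≤ π.pt (i + 1) - π.pt i := by linarith [π.pt_lt i (Finset.mem_range.1 hi)]
    set x := (π.pt (i + 1) - π.pt i) * h with hx
    have hx0 : 0 ≤ x := by positivity
    refine le_trans ?_ (luxNorm_le_modulus₂ T b N hx0 (by rw [hx]; gcongr))
    have := luxNorm_shift_le (x := 0) (y := T - h) (c := π.pt i * h) (x' := 0) (y' := T - x)
      (g := fun r => ‖N r (r + x)‖) hb (by linarith) (by rw [hx]; linarith)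
    refine le_of_eq_of_le ?_ this
    congr 1
    funext r
    simp only [hg]
    congr 2
    rw [hx]
    ring

/-- Finite quasi-norm bounds the modulus by Kτ^a for τ ≤ T/2, and the uniform bound on N takes care
of larger τ. Then `LogMem.of_le` applies. -/
lemma LogMem.modulus₂_of_exponent_le {T a b M : ℝ} {p r : ℝ≥0∞} (hT : 0 < T) (hb : 0 < b)
    (ha : 0 ≤ a) (hp : p ≠ 0) (hpr : p ≤ r) (hM : 0 ≤ M) {N : ℝ → ℝ → V}
    (hN : ∀ s t, 0 ≤ s → s ≤ t → t ≤ T → ‖N s t‖ ≤ M) (h : LogMem T a p (modulus₂ T b N)) :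
    LogMem T a r (modulus₂ T b N) := by
  obtain ⟨K, hK, hsup⟩ := h.sup_bound ha hp (monotone_modulus₂ T b N)
  obtain ⟨C, hC, hbd⟩ := exists_modulus₂_le_of_bound (V := V) hb hT.le
  refine h.of_le hp hpr (K := ENNReal.ofReal (K + C * M / (T / 2) ^ a)) ENNReal.ofReal_ne_top
    fun τ hτ => ?_
  have hτa : 0 < τ ^ a := Real.rpow_pos_of_pos hτ.1 a
  have hTa : 0 < (T / 2) ^ a := Real.rpow_pos_of_pos (half_pos hT) a
  refine ENNReal.div_le_of_le_mul ?_
  rw [← ENNReal.ofReal_mul (by positivity)]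
  rcases le_or_gt τ (T / 2) with h1 | h1
  · refine (hsup τ hτ.1 h1).trans (ENNReal.ofReal_le_ofReal ?_)
    gcongr
    have : 0 ≤ C * M / (T / 2) ^ a := by positivity
    linarith
  · refine (hbd N M τ hM hτ.2 fun s t h1 h2 h3 _ => hN s t h1 h2 h3).trans
      (ENNReal.ofReal_le_ofReal ?_)
    have h2 : (T / 2) ^ a ≤ τ ^ a := Real.rpow_le_rpow (by linarith) h1.le ha
    calc C * M = C * M / (T / 2) ^ a * (T / 2) ^ a := by field_simp
      _ ≤ C * M / (T / 2) ^ a * τ ^ a := by gcongr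
      _ ≤ _ := by
        gcongr
        linarith

/-- Partition sums of a two-parameter function of regularity `a > 1` vanish in the limit. -/
lemma tendsto_besovNorm₂_partition_sum {T a b : ℝ} {p r : ℝ≥0∞} (hT : 0 < T) (hb : 0 < b)
    (ha : 1 < a) (hp : p ≠ 0) (hpr : p ≤ r) (hr : ENNReal.ofReal (1 / a) < r)
    {N : ℝ → ℝ → V} (hc : ContinuousOn (fun z : ℝ × ℝ => N z.1 z.2) (simplex T))
    (h : LogMem T a p (modulus₂ T b N)) {π : ℕ → UnitPartition}
    (hπ : Tendsto (fun k => (π k).mesh) atTop (𝓝 0)) :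
    Tendsto (fun k => besovNorm₂ T a b r ((π k).sum N)) atTop (𝓝 0) := by
  obtain ⟨M, hM, hbd⟩ := exists_bound_of_continuousOn_simplex hc
  have hr' : besovNorm₂ T a b r N < ∞ :=
    h.modulus₂_of_exponent_le hT hb (by linarith) hp hpr hM hbd
  obtain ⟨ε, hε, hsum⟩ := exists_eLpNorm_sum_comp_mul_le hT.le ha hr
  have hle : ∀ k, besovNorm₂ T a b r ((π k).sum N) ≤
      ENNReal.ofReal ((π k).mesh ^ ε) * besovNorm₂ T a b r N := by
    intro k
    have hpos : ∀ i < (π k).N, 0 < (π k).pt (i + 1) - (π k).pt i := fun i hi =>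
      sub_pos.2 ((π k).pt_lt i hi)
    refine le_trans (eLpNorm_mono_enorm_ae ?_) (hsum (modulus₂ T b N) (measurable_modulus₂ T b N)
      (π k).N (fun i => (π k).pt (i + 1) - (π k).pt i) (π k).mesh (fun i hi => ?_) ?_ ?_)
    · refine ae_of_all _ fun τ => ?_
      simp only [enorm_eq_self]
      exact ENNReal.div_le_div_right (modulus₂_partition_sum_le hb hc (π k) τ) _
    · have hi' := Finset.mem_range.1 hi
      refine ⟨hpos i hi', (π k).le_mesh hi', ?_⟩
      linarith [(π k).pt_nonneg hi'.le, (π k).pt_le_one (Nat.succ_le_of_lt hi')]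
    · rw [Finset.sum_range_sub, (π k).pt_zero, (π k).pt_last, sub_zero]
    · exact (hpos 0 (π k).N_pos).trans_le ((π k).le_mesh (π k).N_pos)
  have hlim : Tendsto (fun k => ENNReal.ofReal ((π k).mesh ^ ε) * besovNorm₂ T a b r N) atTop
      (𝓝 (ENNReal.ofReal (0 ^ ε) * besovNorm₂ T a b r N)) :=
    ENNReal.Tendsto.mul_const (ENNReal.tendsto_ofReal (hπ.rpow_const (Or.inr hε.le)))
      (Or.inr hr'.ne)
  rw [Real.zero_rpow hε.ne', ENNReal.ofReal_zero, zero_mul] at hlim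
  exact tendsto_of_tendsto_of_tendsto_of_le_of_le tendsto_const_nhds hlim (fun _ => zero_le) hle

end Sewing

/-! ### Solutions in Hölder spaces are solutions in Besov-Orlicz spaces -/

section Products

variable {V W : Type*} [NormedAddCommGroup V] [NormedAddCommGroup W]

lemma modulus₂_ne_top {T b τ : ℝ} (hb : 0 < b) (hT : 0 ≤ T) (hτ : τ ≤ T) {A : ℝ → ℝ → V}
    (hA : ContinuousOn (fun z : ℝ × ℝ => A z.1 z.2) (simplex T)) : modulus₂ T b A τ ≠ ∞ := by
  obtain ⟨M, hM, hbd⟩ := exists_bound_of_continuousOn_simplex hA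
  obtain ⟨C, _, h⟩ := exists_modulus₂_le_of_bound (V := V) hb hT
  exact ((h A M τ hM hτ fun s t h1 h2 h3 _ => hbd s t h1 h2 h3).trans_lt ENNReal.ofReal_lt_top).ne

lemma luxNorm_section_le (T : ℝ) {b h : ℝ} (hb : 0 < b) (A : ℝ → ℝ → V) (h0 : 0 ≤ h) :
    luxNorm b (Icc 0 (T - 2 * h)) (fun r => ‖A r (r + h)‖) ≤ modulus₂ T b A h :=
  (luxNorm_mono hb (Icc_subset_Icc le_rfl (by linarith)) (ae_of_all _ fun _ => le_rfl)).trans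
    (luxNorm_le_modulus₂ T b A h0 le_rfl)

lemma luxNorm_section_shift_le (T : ℝ) {b h : ℝ} (hb : 0 < b) (A : ℝ → ℝ → V) (h0 : 0 ≤ h) :
    luxNorm b (Icc 0 (T - 2 * h)) (fun r => ‖A (r + h) (r + 2 * h)‖) ≤ modulus₂ T b A h := by
  have := luxNorm_shift_le (x := 0) (y := T - 2 * h) (c := h) (x' := 0) (y' := T - h)
    (g := fun r => ‖A r (r + h)‖) hb (by linarith) (by linarith)
  refine (le_of_eq_of_le ?_ this).trans (luxNorm_le_modulus₂ T b A h0 le_rfl)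
  congr 1
  funext r
  congr 2
  ring

/-- The defect of the local error is a sum of products of one factor on [r, r+h] and one on [r+h,
r+2h]. This is Hölder's inequality for such products. -/
lemma exists_luxNorm_section_mul_le {b b₁ b₂ : ℝ} (h₁ : 0 < b₁) (h₂ : 0 < b₂) (hb : 0 < b)
    (hbb : 1 / b = 1 / b₁ + 1 / b₂) {T : ℝ} (hT : 0 ≤ T) {A : ℝ → ℝ → V} {B : ℝ → ℝ → W}
    (hA : ContinuousOn (fun z : ℝ × ℝ => A z.1 z.2) (simplex T))
    (hB : ContinuousOn (fun z : ℝ × ℝ => B z.1 z.2) (simplex T)) :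
    ∃ C : ℝ, 0 < C ∧ ∀ h, 0 ≤ h → 2 * h ≤ T →
      luxNorm b (Icc 0 (T - 2 * h)) (fun r => ‖A r (r + h)‖ * ‖B (r + h) (r + 2 * h)‖) ≤
        ENNReal.ofReal C * (modulus₂ T b₁ A h * modulus₂ T b₂ B h) := by
  obtain ⟨C, hC, hmul⟩ := exists_luxNorm_mul_le' h₁ h₂ hb hbb hT
  refine ⟨C, hC, fun h h0 hh => ?_⟩
  have e1 := luxNorm_section_le T h₁ A h0
  have e2 := luxNorm_section_shift_le T h₂ B h0
  refine (hmul _ (Icc_subset_Icc le_rfl (by linarith)) _ (fun r => ‖A r (r + h)‖)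
    (fun r => ‖B (r + h) (r + 2 * h)‖) ?_ (ae_of_all _ fun r => ?_)
    (ne_top_of_le_ne_top (modulus₂_ne_top h₁ hT (by linarith) hA) e1)
    (ne_top_of_le_ne_top (modulus₂_ne_top h₂ hT (by linarith) hB) e2)).trans (by gcongr)
  · refine ContinuousOn.aemeasurable (ContinuousOn.norm (hA.comp
      (f := fun r => (r, r + h)) (by fun_prop) fun r hr => ?_)) measurableSet_Icc
    exact ⟨hr.1, by linarith, by linarith [hr.2]⟩
  · rw [abs_mul]

lemma exists_modulus₂_sq_le {b : ℝ} (hb : 0 < b) {T : ℝ} (hT : 0 ≤ T) {A : ℝ → ℝ → V}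
    (hA : ContinuousOn (fun z : ℝ × ℝ => A z.1 z.2) (simplex T)) :
    ∃ C : ℝ, 0 < C ∧ ∀ τ ≤ T, modulus₂ T (b / 2) (fun s t => ‖A s t‖ ^ 2) τ ≤
      ENNReal.ofReal C * (modulus₂ T b A τ * modulus₂ T b A τ) := by
  obtain ⟨C, hC, hmul⟩ := exists_luxNorm_mul_le' hb hb (half_pos hb)
    (by field_simp; norm_num) hT
  refine ⟨C, hC, fun τ hτ => modulus₂_le fun h h0 hh => ?_⟩
  have e := luxNorm_le_modulus₂ T b A h0 hh
  have hne := ne_top_of_le_ne_top (modulus₂_ne_top hb hT hτ hA) e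
  refine (hmul _ (Icc_subset_Icc le_rfl (by linarith)) _ (fun r => ‖A r (r + h)‖)
    (fun r => ‖A r (r + h)‖) ?_ (ae_of_all _ fun r => ?_) hne hne).trans (by gcongr)
  · exact ((measurable₂_of_continuousOn hA).2 h ⟨h0, hh.trans hτ⟩).norm.aemeasurable
  · rw [abs_norm, abs_norm, norm_pow, norm_norm, sq]

lemma memOrlicz_of_continuousOn {b T : ℝ} (hb : 0 < b) {g : ℝ → V}
    (hg : ContinuousOn g (Icc 0 T)) : MemOrlicz b (Icc 0 T) g := by
  refine ⟨hg.aestronglyMeasurable measurableSet_Icc, 1, one_pos, ?_⟩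
  obtain ⟨M, hM⟩ := isCompact_Icc.exists_bound_of_continuousOn hg
  have h : ∫⁻ r in Icc 0 T, ENNReal.ofReal (youngPhi b (‖g r‖ / 1)) ≤
      ∫⁻ _ in Icc 0 T, ENNReal.ofReal (youngPhi b |M|) := by
    refine setLIntegral_mono measurable_const fun r hr => ENNReal.ofReal_le_ofReal ?_
    rw [div_one]
    exact monotoneOn_youngPhi hb (norm_nonneg _) (mem_Ici.2 (abs_nonneg M))
      ((hM r hr).trans (le_abs_self _))
  refine h.trans_lt ?_
  rw [setLIntegral_const, Real.volume_Icc]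
  exact ENNReal.mul_lt_top ENNReal.ofReal_lt_top ENNReal.ofReal_lt_top

lemma continuousOn_of_holder {T K θ : ℝ} (hθ : 0 < θ) {Y : ℝ → V}
    (h : ∀ s t, 0 ≤ s → s ≤ t → t ≤ T → ‖Y t - Y s‖ ≤ K * (t - s) ^ θ) :
    ContinuousOn Y (Icc 0 T) := by
  intro x hx
  rw [ContinuousWithinAt, tendsto_iff_norm_sub_tendsto_zero]
  have hlim : Tendsto (fun t : ℝ => K * |t - x| ^ θ) (𝓝[Icc 0 T] x) (𝓝 0) := by
    have : Continuous fun t : ℝ => K * |t - x| ^ θ :=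
      continuous_const.mul ((continuous_id.sub continuous_const).abs.rpow_const
        fun _ => Or.inr hθ.le)
    have h1 := this.tendsto x
    simp only [sub_self, abs_zero, Real.zero_rpow hθ.ne', mul_zero] at h1
    exact h1.mono_left nhdsWithin_le_nhds
  refine squeeze_zero' (Eventually.of_forall fun _ => norm_nonneg _) ?_ hlim
  filter_upwards [self_mem_nhdsWithin] with t ht
  rcases le_total x t with hxt | hxt
  · rw [abs_of_nonneg (by linarith)]
    exact h x t hx.1 hxt ht.2
  · rw [abs_sub_comm, abs_of_nonneg (by linarith), norm_sub_rev]
    exact h t x ht.1 hxt hx.2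

end Products

/-! ### Besov–Orlicz regularity of solutions in the sense of Davie -/

section DavieSolution

set_option maxSynthPendingDepth 3

variable {n : ℕ} {E : Type*} [NormedAddCommGroup E] [NormedSpace ℝ E]
  {T α β θ A A' C L : ℝ} {q : ℝ≥0∞} {X : ℝ → EuclideanSpace ℝ (Fin n)}
  {XX : ℝ → ℝ → EuclideanSpace ℝ (Fin n × Fin n)}
  {f : E → EuclideanSpace ℝ (Fin n) →L[ℝ] E} {Y : ℝ → E}

lemma incr_sub_localApprox (f : E → EuclideanSpace ℝ (Fin n) →L[ℝ] E) (Y : ℝ → E) (s t : ℝ) :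
    incr Y s t - localApprox X XX (fun s => f (Y s))
        (fun s => (fderiv ℝ f (Y s)).comp (f (Y s))) s t =
      Y t - davieStep f X (fun s t => areaAction E (XX s t)) s t (Y s) := by
  simp only [localApprox, davieStep, areaAction_apply, incr, secondCoeff]
  abel

lemma continuousOn_comp_fst {V : Type*} [TopologicalSpace V] {g : ℝ → V}
    (hg : ContinuousOn g (Icc 0 T)) :
    ContinuousOn (fun z : ℝ × ℝ => g z.1) (simplex T) :=
  hg.comp continuousOn_fst fun _ hz => ⟨hz.1, hz.2.1.trans hz.2.2⟩

lemma continuousOn_comp_snd {V : Type*} [TopologicalSpace V] {g : ℝ → V}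
    (hg : ContinuousOn g (Icc 0 T)) :
    ContinuousOn (fun z : ℝ × ℝ => g z.2) (simplex T) :=
  hg.comp continuousOn_snd fun _ hz => ⟨hz.1.trans hz.2.1, hz.2.2⟩

lemma continuousOn_remainder {V W : Type*} [NormedAddCommGroup V] [NormedSpace ℝ V]
    [NormedAddCommGroup W] [NormedSpace ℝ W] {X : ℝ → V} {Y : ℝ → W} {Y' : ℝ → V →L[ℝ] W}
    (hX : ContinuousOn X (Icc 0 T)) (hY : ContinuousOn Y (Icc 0 T))
    (hY' : ContinuousOn Y' (Icc 0 T)) :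
    ContinuousOn (fun z : ℝ × ℝ => remainder X Y Y' z.1 z.2) (simplex T) :=
  (continuousOn_incr hY).sub ((continuousOn_comp_fst hY').clm_apply (continuousOn_incr hX))

lemma continuousOn_sub_davieStep (hX : IsContRoughPath T α β q θ A X XX) (hf : CoeffBound C f)
    (hY : ContinuousOn Y (Icc 0 T)) :
    ContinuousOn (fun z : ℝ × ℝ =>
      Y z.2 - davieStep f X (fun s t => areaAction E (XX s t)) z.1 z.2 (Y z.1)) (simplex T) := by
  have h1 := continuousOn_comp_fst hY
  unfold davieStep
  refine (continuousOn_comp_snd hY).sub ((h1.add ?_).add ?_)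
  · exact (hf.coeff.continuous.comp_continuousOn h1).clm_apply (continuousOn_incr hX.path.1)
  · exact (continuous_areaAction.comp_continuousOn hX.cont).clm_apply
      (hf.second.continuous.comp_continuousOn h1)

lemma memBesov_of_le {V W : Type*} [NormedAddCommGroup V] [NormedAddCommGroup W] {κ D : ℝ}
    (hT : 0 ≤ T) (hβ : 0 < β) (hq : q ≠ 0) (hκ : α < κ) (hκ0 : 0 ≤ κ) (hD : 0 ≤ D)
    {g : ℝ → V} {h : ℝ → W} (hg : ContinuousOn g (Icc 0 T)) (hh : MemBesov T α β q h)
    (hle : ∀ s t, 0 ≤ s → s ≤ t → t ≤ T → ‖g t - g s‖ ≤ D * ‖h t - h s‖ + D * (t - s) ^ κ) :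
    MemBesov T α β q g :=
  ⟨hg, memOrlicz_of_continuousOn hβ hg, LogMem.modulus₂_of_le hT hβ hq hD hκ hκ0
    (A := incr g) hh.2.2 (measurable₂_of_continuousOn (continuousOn_incr hh.1)).2 hle⟩

lemma sq_rpow {x θ : ℝ} (hx : 0 ≤ x) : (x ^ θ) ^ 2 = x ^ (2 * θ) := by
  rw [← Real.rpow_natCast, ← Real.rpow_mul hx, mul_comm]
  norm_num

lemma IsDavie.continuousOn (hR : RoughBound T θ A' X fun s t => areaAction E (XX s t))
    (hf : CoeffBound C f) (hθ : 0 < θ) (hL : 0 ≤ L)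
    (hY : IsDavie T θ L f X (fun s t => areaAction E (XX s t)) Y) : ContinuousOn Y (Icc 0 T) :=
  continuousOn_of_holder hθ fun _ _ hs hst ht => hY.norm_sub_le hR hf hθ.le hL hs hst ht

/-- The increments of Y are f(Y)δX up to a remainder of order 2θ, and 2θ > 2/3 > α, so Y inherits
the exact regularity of X. -/
lemma IsDavie.memBesov (hX : IsContRoughPath T α β q θ A X XX)
    (hR : RoughBound T θ A' X fun s t => areaAction E (XX s t)) (hf : CoeffBound C f)
    (hT : 0 < T) (hβ : 0 < β) (hq : q ≠ 0) (hθ : 1 / 3 < θ) (hα' : α ≤ 1 / 2) (hL : 0 ≤ L)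
    (hY : IsDavie T θ L f X (fun s t => areaAction E (XX s t)) Y) : MemBesov T α β q Y := by
  have hC := hf.coeff.nonneg
  have hA := hR.nonneg
  have hTθ := Real.rpow_nonneg hT.le θ
  refine memBesov_of_le (κ := 2 * θ) (D := C + (A' * C + L * T ^ θ)) hT.le hβ hq (by linarith)
    (by linarith) (by positivity) (hY.continuousOn hR hf (by linarith) hL) hX.path
    fun s t hs hst ht => ?_
  have h1 := hY.norm_rem_le hR hf (by linarith) hL hs hst ht
  rw [sq_rpow (by linarith)] at h1
  have hp := Real.rpow_nonneg (by linarith : 0 ≤ t - s) (2 * θ)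
  have e : Y t - Y s = f (Y s) (X t - X s) + (Y t - Y s - f (Y s) (X t - X s)) := by abel
  rw [e]
  refine (norm_add_le _ _).trans (add_le_add ?_ (h1.trans ?_))
  · refine (ContinuousLinearMap.le_opNorm _ _).trans ?_
    gcongr
    exact (hf.coeff.bdd _).trans (le_add_of_nonneg_right (by positivity))
  · exact mul_le_mul_of_nonneg_right (le_add_of_nonneg_left hC) hp

lemma memBesov_coeff (hf : CoeffBound C f) (hT : 0 < T) (hβ : 0 < β) (hq : q ≠ 0)
    (hα' : α ≤ 1 / 2) (hY : MemBesov T α β q Y) : MemBesov T α β q fun t => f (Y t) := by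
  have hC := hf.coeff.nonneg
  refine memBesov_of_le (κ := 1) hT.le hβ hq (by linarith) (by linarith) hC
    (hf.coeff.continuous.comp_continuousOn hY.1) hY fun s t hs hst ht => ?_
  refine (hf.coeff.lip _ _).trans (le_add_of_nonneg_right ?_)
  rw [Real.rpow_one]
  exact mul_nonneg hC (by linarith)

/-- The remainder is Df(Y)f(Y)𝕏 up to the local error of order 3θ > 1 ≥ 2α, so it inherits the
regularity of the second level. -/
lemma IsDavie.memBesov₂_remainder (hX : IsContRoughPath T α β q θ A X XX)
    (hR : RoughBound T θ A' X fun s t => areaAction E (XX s t)) (hf : CoeffBound C f)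
    (hT : 0 < T) (hβ : 0 < β) (hq : q ≠ 0) (hθ : 1 / 3 < θ) (hα' : α ≤ 1 / 2) (hL : 0 ≤ L)
    (hY : IsDavie T θ L f X (fun s t => areaAction E (XX s t)) Y) :
    MemBesov₂ T (2 * α) (β / 2) (q / 2) (remainder X Y fun t => f (Y t)) := by
  obtain ⟨c, hc, hact⟩ := exists_norm_areaAction_le n E
  have hC := hf.coeff.nonneg
  have hYc := hY.continuousOn hR hf (by linarith) hL
  refine ⟨measurable₂_of_continuousOn (continuousOn_remainder hX.path.1 hYc
    (hf.coeff.continuous.comp_continuousOn hYc)), ?_⟩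
  refine LogMem.modulus₂_of_le (κ := 3 * θ) (C := c * C + L) hT.le (half_pos hβ)
    (ENNReal.div_pos hq ENNReal.ofNat_ne_top).ne' (by positivity) (by linarith) (by linarith)
    hX.area.2 hX.area.1.2 fun s t hs hst ht => ?_
  have hp := Real.rpow_nonneg (by linarith : 0 ≤ t - s) (3 * θ)
  have h1 := hY s t hs hst ht
  rw [cube_rpow (by linarith)] at h1
  have e : remainder X Y (fun t => f (Y t)) s t = areaAction E (XX s t) (secondCoeff f (Y s)) +
      (Y t - davieStep f X (fun s t => areaAction E (XX s t)) s t (Y s)) := by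
    simp only [remainder, incr, davieStep]
    abel
  rw [e]
  refine (norm_add_le _ _).trans (add_le_add ?_ (h1.trans ?_))
  · calc ‖areaAction E (XX s t) (secondCoeff f (Y s))‖ ≤ (c * ‖XX s t‖) * C :=
          (ContinuousLinearMap.le_opNorm _ _).trans (mul_le_mul (hact _) (hf.second.bdd _)
            (norm_nonneg _) (by positivity))
      _ = c * C * ‖XX s t‖ := by ring
      _ ≤ (c * C + L) * ‖XX s t‖ := by
          gcongr
          linarith
  · gcongr
    exact le_add_of_nonneg_left (by positivity)

/-- The remainder of `f(Y)` with respect to its Gubinelli derivative `Df(Y) f(Y)`. -/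
lemma logMem_remainder_coeff (hf : CoeffBound C f)
    (hT : 0 < T) (hβ : 0 < β) (hY : MemBesov T α β q Y)
    (hrem : MemBesov₂ T (2 * α) (β / 2) (q / 2) (remainder X Y fun t => f (Y t))) :
    LogMem T (2 * α) (q / 2) (modulus₂ T (β / 2)
      (remainder X (fun t => f (Y t)) fun t => secondCoeff f (Y t))) := by
  have hC := hf.coeff.nonneg
  have hc := continuousOn_incr hY.1
  have hYL : LogMem T α q (modulus₂ T β (incr Y)) := hY.2.2
  obtain ⟨K, hK, hsq⟩ := exists_modulus₂_sq_le hβ hT.le hc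
  have h1 : LogMem T (2 * α) (q / 2) fun τ => ENNReal.ofReal C * (ENNReal.ofReal K *
      (modulus₂ T β (incr Y) τ * modulus₂ T β (incr Y) τ)) +
        ENNReal.ofReal C * modulus₂ T (β / 2) (remainder X Y fun t => f (Y t)) τ := by
    have m1 := measurable_modulus₂ T β (incr Y)
    have m2 := measurable_modulus₂ T (β / 2) (remainder X Y fun t => f (Y t))
    exact ((((logMem_sq hYL).const_mul (m1.mul m1) ENNReal.ofReal_ne_top).const_mul
      ((m1.mul m1).const_mul _) ENNReal.ofReal_ne_top).add
      (LogMem.const_mul hrem.2 m2 ENNReal.ofReal_ne_top)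
      (((m1.mul m1).const_mul _).const_mul _) (m2.const_mul _))
  refine h1.mono fun τ hτ => modulus₂_le fun h h0 hh => ?_
  have hhT : h ∈ Icc 0 T := ⟨h0, hh.trans hτ.2⟩
  refine (luxNorm_add_le (half_pos hβ) (f := fun r => C * ‖incr Y r (r + h)‖ ^ 2)
    (g := fun r => C * ‖remainder X Y (fun t => f (Y t)) r (r + h)‖) ?_
    (ae_of_all _ fun r => ?_)).trans (add_le_add ?_ ?_)
  · exact (((measurable₂_of_continuousOn hc).2 h hhT).norm.aemeasurable.pow_const 2).const_mul C
  · rw [abs_norm, abs_of_nonneg (by positivity), abs_of_nonneg (by positivity)]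
    -- The Taylor part is bounded by the square of the increment of Y, which lies in Φ_{β/2} with
    -- exponent 2α and third index q/2. The other part is bounded by the remainder of Y.
    have e := coeff_sub_eq (f := f) (X := X) r (r + h) (Y r) (Y (r + h))
    simp only [remainder, incr]
    rw [e]
    refine (norm_add_le _ _).trans (add_le_add (norm_taylorRem_le hf.diff hf.deriv _ _) ?_)
    exact (ContinuousLinearMap.le_opNorm _ _).trans
      (mul_le_mul_of_nonneg_right (hf.deriv.bdd _) (norm_nonneg _))
  · refine (luxNorm_le_mul (half_pos hβ) hC (g := fun r => ‖‖incr Y r (r + h)‖ ^ 2‖)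
      (ae_of_all _ fun r => ?_)).trans (mul_le_mul_right ((luxNorm_le_modulus₂ T (β / 2)
        (fun s t => ‖incr Y s t‖ ^ 2) h0 hh).trans (hsq τ hτ.2)) _)
    rw [abs_mul, abs_of_nonneg hC, abs_norm, Real.norm_eq_abs]
  · refine (luxNorm_le_mul (half_pos hβ) hC
      (g := fun r => ‖remainder X Y (fun t => f (Y t)) r (r + h)‖)
      (ae_of_all _ fun r => ?_)).trans (mul_le_mul_right (luxNorm_le_modulus₂ T (β / 2) _ h0 hh) _)
    rw [abs_mul, abs_of_nonneg hC]

/-- A Hölder bound of order 3θ does not give regularity 3α when θ < α. It serves as the a priori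
bound of the sewing lemma, whose gain comes from the defect: the remainder of f(Y) times the
increment of X, and the second level times the increment of Y. -/
lemma IsDavie.logMem_sub_davieStep (hX : IsContRoughPath T α β q θ A X XX)
    (hR : RoughBound T θ A' X fun s t => areaAction E (XX s t)) (hf : CoeffBound C f)
    (hT : 0 < T) (hβ : 0 < β) (hq : q ≠ 0) (hθ : 1 / 3 < θ) (hα : 1 / 3 < α) (hα' : α ≤ 1 / 2)
    (hL : 0 ≤ L) (hY : IsDavie T θ L f X (fun s t => areaAction E (XX s t)) Y) :
    LogMem T (3 * α) (q / 3) (modulus₂ T (β / 3) fun s t =>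
      Y t - davieStep f X (fun s t => areaAction E (XX s t)) s t (Y s)) := by
  obtain ⟨c, hc, hact⟩ := exists_norm_areaAction_le n E
  have hC := hf.coeff.nonneg
  have hb3 : 0 < β / 3 := by positivity
  have hYB := hY.memBesov hX hR hf hT hβ hq hθ hα' hL
  have hYL : LogMem T α q (modulus₂ T β (incr Y)) := hYB.2.2
  have hXL : LogMem T α q (modulus₂ T β (incr X)) := hX.path.2.2
  have hAL : LogMem T (2 * α) (q / 2) (modulus₂ T (β / 2) XX) := hX.area.2
  set RZ := remainder X (fun t => f (Y t)) fun t => secondCoeff f (Y t) with hRZ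
  have hRL : LogMem T (2 * α) (q / 2) (modulus₂ T (β / 2) RZ) :=
    logMem_remainder_coeff hf hT hβ hYB
      (hY.memBesov₂_remainder hX hR hf hT hβ hq hθ hα' hL)
  have hRZc : ContinuousOn (fun z : ℝ × ℝ => RZ z.1 z.2) (simplex T) :=
    continuousOn_remainder hX.path.1 (hf.coeff.continuous.comp_continuousOn hYB.1)
      (hf.second.continuous.comp_continuousOn hYB.1)
  obtain ⟨K₁, hK₁, hm₁⟩ := exists_luxNorm_section_mul_le (half_pos hβ) hβ hb3
    (by field_simp; norm_num) hT.le hRZc (continuousOn_incr hX.path.1)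
  obtain ⟨K₂, hK₂, hm₂⟩ := exists_luxNorm_section_mul_le hβ (half_pos hβ) hb3
    (by field_simp; norm_num) hT.le (continuousOn_incr hYB.1) hX.cont
  set P : ℝ → ℝ≥0∞ := fun τ =>
    ENNReal.ofReal K₁ * (modulus₂ T (β / 2) RZ τ * modulus₂ T β (incr X) τ) +
      ENNReal.ofReal (c * C) * (ENNReal.ofReal K₂ *
        (modulus₂ T (β / 2) XX τ * modulus₂ T β (incr Y) τ)) with hP
  have hPL : LogMem T (3 * α) (q / 3) P := by
    have m1 := measurable_modulus₂ T β (incr X)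
    have m2 := measurable_modulus₂ T β (incr Y)
    have m3 := measurable_modulus₂ T (β / 2) XX
    have m4 := measurable_modulus₂ T (β / 2) RZ
    exact ((hRL.mul hXL m4 m1).const_mul (m4.mul m1) ENNReal.ofReal_ne_top).add
      ((((hAL.mul hYL m3 m2).const_mul (m3.mul m2) ENNReal.ofReal_ne_top).const_mul
        ((m3.mul m2).const_mul _) ENNReal.ofReal_ne_top)) ((m4.mul m1).const_mul _)
      (((m3.mul m2).const_mul _).const_mul _)
  have hPmono : Monotone P := fun x y hxy =>
    add_le_add
      (mul_le_mul_right (mul_le_mul' (monotone_modulus₂ _ _ _ hxy) (monotone_modulus₂ _ _ _ hxy)) _)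
      (mul_le_mul_right (mul_le_mul_right
        (mul_le_mul' (monotone_modulus₂ _ _ _ hxy) (monotone_modulus₂ _ _ _ hxy)) _) _)
  refine logMem_modulus₂_of_sewing (κ := 3 * θ) (L := L) hT.le hb3
    (ENNReal.div_pos hq ENNReal.ofNat_ne_top).ne' (by linarith) (by linarith) hL
    (continuousOn_sub_davieStep hX hf hYB.1) (fun s t hs hst ht => ?_) hPmono hPL
    fun h h0 hh => ?_
  · rw [← cube_rpow (by linarith)]
    exact hY s t hs hst ht
  · refine (luxNorm_add_le hb3 (f := fun r => ‖RZ r (r + h)‖ * ‖incr X (r + h) (r + 2 * h)‖)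
      (g := fun r => c * C * (‖incr Y r (r + h)‖ * ‖XX (r + h) (r + 2 * h)‖)) ?_ ?_).trans
      (add_le_add (hm₁ h h0 hh) ?_)
    · refine ContinuousOn.aemeasurable (ContinuousOn.mul (ContinuousOn.norm (hRZc.comp
        (f := fun r => (r, r + h)) (by fun_prop) fun r hr => ?_)) (ContinuousOn.norm
        ((continuousOn_incr hX.path.1).comp
        (f := fun r => (r + h, r + 2 * h)) (by fun_prop) fun r hr => ?_))) measurableSet_Icc
      · exact ⟨hr.1, by linarith, by linarith [hr.2]⟩
      · exact ⟨by linarith [hr.1], by linarith, by linarith [hr.2]⟩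
    · filter_upwards [ae_restrict_mem measurableSet_Icc] with r hr
      have e := sub_davieStep (f := f) hR hr.1 (by linarith : r ≤ r + h)
        (by linarith : r + h ≤ r + 2 * h) (by linarith [hr.2]) (Y r) (Y (r + h)) (Y (r + 2 * h))
      rw [e, abs_norm, abs_of_nonneg (by positivity), abs_of_nonneg (by positivity)]
      rw [add_assoc, add_sub_cancel_left, add_sub_cancel_left]
      unfold davieDefect
      refine (norm_add_le _ _).trans (add_le_add (ContinuousLinearMap.le_opNorm _ _) ?_)
      refine (ContinuousLinearMap.le_opNorm _ _).trans ((mul_le_mul (hact _)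
        (hf.second.lip _ _) (norm_nonneg _) (by positivity)).trans (le_of_eq ?_))
      simp only [incr]
      ring
    · refine (luxNorm_le_mul hb3 (by positivity : 0 ≤ c * C)
        (g := fun r => ‖incr Y r (r + h)‖ * ‖XX (r + h) (r + 2 * h)‖)
        (ae_of_all _ fun r => ?_)).trans ?_
      · rw [abs_mul, abs_of_nonneg (by positivity : 0 ≤ c * C)]
      · rw [mul_comm (modulus₂ T (β / 2) XX h)]
        exact mul_le_mul_right (hm₂ h h0 hh) _

end DavieSolution

section DavieSolution

variable {m n : ℕ} {T α β θ A A' C L : ℝ} {q : ℝ≥0∞} {X : ℝ → EuclideanSpace ℝ (Fin n)}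
  {XX : ℝ → ℝ → EuclideanSpace ℝ (Fin n × Fin n)}
  {f : EuclideanSpace ℝ (Fin m) → EuclideanSpace ℝ (Fin n) →L[ℝ] EuclideanSpace ℝ (Fin m)}
  {Y : ℝ → EuclideanSpace ℝ (Fin m)}

/-- A solution in the sense of Davie is a solution in Besov-Orlicz spaces. -/
theorem IsDavie.isSolution (hX : IsContRoughPath T α β q θ A X XX)
    (hR : RoughBound T θ A' X fun s t => areaAction (EuclideanSpace ℝ (Fin m)) (XX s t))
    (hf : CoeffBound C f) (hT : 0 < T) (hβ : 0 < β) (hq : q ≠ 0) (hθ : 1 / 3 < θ)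
    (hα : 1 / 3 < α) (hα' : α ≤ 1 / 2) (hL : 0 ≤ L)
    (hY : IsDavie T θ L f X (fun s t => areaAction (EuclideanSpace ℝ (Fin m)) (XX s t)) Y) :
    IsSolution T α β q X XX f (Y 0) Y fun t => f (Y t) := by
  have hYB := hY.memBesov hX hR hf hT hβ hq hθ hα' hL
  have hN := hY.logMem_sub_davieStep hX hR hf hT hβ hq hθ hα hα' hL
  have hNc := continuousOn_sub_davieStep hX hf hYB.1
  have hincr : incr (fun t => Y t - Y 0) = incr Y := by
    funext s t
    simp [incr]
  refine ⟨⟨hYB, memBesov_coeff hf hT hβ hq hα' hYB,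
    hY.memBesov₂_remainder hX hR hf hT hβ hq hθ hα' hL⟩, fun t _ => rfl,
    fun t => Y t - Y 0, ⟨hYB.1.sub continuousOn_const, sub_self _, ?_, ?_⟩,
    fun t _ => (add_sub_cancel _ _).symm⟩
  · rw [hincr]
    simp only [incr_sub_localApprox]
    exact ⟨measurable₂_of_continuousOn hNc, hN⟩
  -- Increments are additive over a partition, so the error of the compensated sum is the partition
  -- sum of the local error.
  · intro r hr hr' π hπ
    have e : ∀ k, (fun s t => incr (fun t => Y t - Y 0) s t - (π k).sum (localApprox X XX
        (fun s => f (Y s)) fun s => (fderiv ℝ f (Y s)).comp (f (Y s))) s t) =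
        (π k).sum fun s t => Y t - davieStep f X
          (fun s t => areaAction (EuclideanSpace ℝ (Fin m)) (XX s t)) s t (Y s) := by
      intro k
      funext s t
      rw [hincr]
      simp only [← incr_sub_localApprox]
      rw [UnitPartition.sum_sub, UnitPartition.sum_incr]
    simp only [e]
    exact tendsto_besovNorm₂_partition_sum hT (by positivity) (by linarith)
      (ENNReal.div_pos hq ENNReal.ofNat_ne_top).ne' hr hr' hNc hN hπ

end DavieSolution

/-! ### Solutions in Besov-Orlicz spaces are solutions in Hölder spaces -/

section DavieSubadditive

set_option maxSynthPendingDepth 3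

variable {E U : Type*} [NormedAddCommGroup E] [NormedSpace ℝ E] [NormedAddCommGroup U]
  [NormedSpace ℝ U]

/-- The almost subadditivity that the chaining argument needs at order 3θ. It presupposes the Hölder
bounds of orders θ and 2θ on the path and its remainder. -/
lemma norm_sub_davieStep_le {T θ A C K₁ K₂ : ℝ} {f : E → U →L[ℝ] E} {X : ℝ → U}
    {XX : ℝ → ℝ → (U →L[ℝ] U →L[ℝ] E) →L[ℝ] E} {Y : ℝ → E} (hX : RoughBound T θ A X XX)
    (hf : CoeffBound C f) (hθ : 0 ≤ θ) (hK₁ : 0 ≤ K₁) (hK₂ : 0 ≤ K₂)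
    (h₁ : ∀ s t, 0 ≤ s → s ≤ t → t ≤ T → ‖Y t - Y s‖ ≤ K₁ * (t - s) ^ θ)
    (h₂ : ∀ s t, 0 ≤ s → s ≤ t → t ≤ T →
      ‖Y t - Y s - f (Y s) (X t - X s)‖ ≤ K₂ * (t - s) ^ (2 * θ))
    {s u t : ℝ} (hs : 0 ≤ s) (hsu : s ≤ u) (hut : u ≤ t) (ht : t ≤ T) :
    ‖Y t - davieStep f X XX s t (Y s)‖ ≤ ‖Y u - davieStep f X XX s u (Y s)‖ +
      ‖Y t - davieStep f X XX u t (Y u)‖ +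
      ((C * K₁ ^ 2 + C * K₂) * A + A * (C * K₁)) * (t - s) ^ (3 * θ) := by
  have hC := hf.coeff.nonneg
  have hA := hX.nonneg
  set η := (t - s) ^ θ with hη
  have hη0 : 0 ≤ η := Real.rpow_nonneg (by linarith) θ
  have e1 : (t - u) ^ θ ≤ η := Real.rpow_le_rpow (by linarith) (by linarith) hθ
  have e2 : (u - s) ^ θ ≤ η := Real.rpow_le_rpow (by linarith) (by linarith) hθ
  have p1 := Real.rpow_nonneg (by linarith : 0 ≤ t - u) θ
  have p2 := Real.rpow_nonneg (by linarith : 0 ≤ u - s) θ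
  rw [sub_davieStep hX hs hsu hut ht (Y s) (Y u) (Y t)]
  refine norm_add₃_le.trans (add_le_add le_rfl ?_)
  refine (norm_davieDefect_le (η := η) (δ := K₁ * η) (ρ := K₂ * η ^ 2) hf hA
    ((hX.path u t (hs.trans hsu) hut ht).trans (by gcongr))
    ((hX.area u t (hs.trans hsu) hut ht).trans (by gcongr))
    ((h₁ s u hs hsu (hut.trans ht)).trans (by gcongr)) ?_).trans (le_of_eq ?_)
  · refine (h₂ s u hs hsu (hut.trans ht)).trans ?_
    rw [← sq_rpow (by linarith)]
    gcongr
  · rw [← cube_rpow (by linarith), ← hη]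
    ring

end DavieSubadditive

section SolutionDavie

variable {m n : ℕ} {T α β θ A A' C : ℝ} {q : ℝ≥0∞} {X : ℝ → EuclideanSpace ℝ (Fin n)}
  {XX : ℝ → ℝ → EuclideanSpace ℝ (Fin n × Fin n)}
  {f : EuclideanSpace ℝ (Fin m) → EuclideanSpace ℝ (Fin n) →L[ℝ] EuclideanSpace ℝ (Fin m)}
  {y : EuclideanSpace ℝ (Fin m)} {Y : ℝ → EuclideanSpace ℝ (Fin m)}
  {Y' : ℝ → EuclideanSpace ℝ (Fin n) →L[ℝ] EuclideanSpace ℝ (Fin m)}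

lemma IsSolution.memBesov₂_remainder (hβ : 0 < β) (hY : IsSolution T α β q X XX f y Y Y') :
    MemBesov₂ T (2 * α) (β / 2) (q / 2) (remainder X Y fun t => f (Y t)) := by
  refine hY.controlled.rem.congr_null (half_pos hβ) (N := ∅) measure_empty
    fun s t hs hst ht _ _ => ?_
  simp only [remainder, hY.deriv_eq s ⟨hs, hst.trans ht⟩]

lemma IsSolution.memBesov₂_sub_davieStep (hβ : 0 < β)
    (hY : IsSolution T α β q X XX f y Y Y') :
    MemBesov₂ T (3 * α) (β / 3) (q / 3) fun s t => Y t -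
      davieStep f X (fun s t => areaAction (EuclideanSpace ℝ (Fin m)) (XX s t)) s t (Y s) := by
  obtain ⟨I, hI, hYI⟩ := hY.eq
  -- The null set is empty: the two functions agree at all pairs of the simplex, but the relations
  -- Y' = f(Y) and Y = y + I are known on [0,T] only.
  refine hI.approx.congr_null (by positivity) (N := ∅) measure_empty fun s t hs hst ht _ _ => ?_
  have e : incr I s t = incr Y s t := by
    simp only [incr]
    rw [hYI s ⟨hs, hst.trans ht⟩, hYI t ⟨hs.trans hst, ht⟩]
    abel
  rw [← incr_sub_localApprox, e]
  simp only [localApprox, hY.deriv_eq s ⟨hs, hst.trans ht⟩]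

/-- The remainder is additive up to the product of δf(Y) and δX, which is of order 2θ once Y is
known to be θ-Hölder. -/
lemma IsSolution.exists_norm_remainder_le (hX : IsContRoughPath T α β q θ A X XX)
    (hf : CoeffBound C f) (hT : 0 < T) (hβ : 0 < β) (hq : q ≠ 0) (hθ : 0 < θ) (hα : θ < α)
    (hY : IsSolution T α β q X XX f y Y Y') {K : ℝ} (hK : 0 ≤ K)
    (h : ∀ s t, 0 ≤ s → s ≤ t → t ≤ T → ‖Y t - Y s‖ ≤ K * (t - s) ^ θ) :
    ∃ K', 0 ≤ K' ∧ ∀ s t, 0 ≤ s → s ≤ t → t ≤ T →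
      ‖remainder X Y (fun t => f (Y t)) s t‖ ≤ K' * (t - s) ^ (2 * θ) := by
  have hC := hf.coeff.nonneg
  have hA := hX.nonneg
  have hYc := hY.controlled.path.1
  have hrem := hY.memBesov₂_remainder hβ
  have htri : ∀ s u t, 0 ≤ s → s ≤ u → u ≤ t → t ≤ T →
      ‖remainder X Y (fun t => f (Y t)) s t‖ ≤ ‖remainder X Y (fun t => f (Y t)) s u‖ +
        ‖remainder X Y (fun t => f (Y t)) u t‖ + C * K * A * (t - s) ^ (2 * θ) := by
    intro s u t hs hsu hut ht
    have e : remainder X Y (fun t => f (Y t)) s t = remainder X Y (fun t => f (Y t)) s u +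
        remainder X Y (fun t => f (Y t)) u t + (f (Y u) - f (Y s)) (X t - X u) := by
      have e1 : X t - X s = (X u - X s) + (X t - X u) := by abel
      simp only [remainder, incr, sub_apply, e1, map_add]
      abel
    rw [e]
    refine norm_add₃_le.trans (add_le_add le_rfl ?_)
    have p1 := Real.rpow_nonneg (by linarith : 0 ≤ u - s) θ
    calc ‖(f (Y u) - f (Y s)) (X t - X u)‖ ≤ (C * (K * (u - s) ^ θ)) * (A * (t - u) ^ θ) :=
          (ContinuousLinearMap.le_opNorm _ _).trans (mul_le_mul ((hf.coeff.lip _ _).trans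
            (mul_le_mul_of_nonneg_left (h s u hs hsu (hut.trans ht)) hC))
            (hX.path_le u t (hs.trans hsu) hut ht) (norm_nonneg _) (by positivity))
      _ = C * K * A * ((u - s) ^ θ * (t - u) ^ θ) := by ring
      _ ≤ _ := by
          gcongr
          exact rpow_mul_rpow_le hθ.le hsu hut
  exact exists_holder_of_logMem (θ := 2 * θ) (B := C * K * A)
    (A := remainder X Y fun t => f (Y t)) hT (half_pos hβ)
    (ENNReal.div_pos hq ENNReal.ofNat_ne_top).ne' (by linarith) (by linarith) (by positivity)
    (continuousOn_remainder hX.path.1 hYc (hf.coeff.continuous.comp_continuousOn hYc))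
    (fun s => by simp [remainder, incr]) hrem.1.1 hrem.2 htri

/-- A solution in Besov-Orlicz spaces is a solution in the sense of Davie. -/
theorem IsSolution.exists_isDavie (hX : IsContRoughPath T α β q θ A X XX)
    (hR : RoughBound T θ A' X fun s t => areaAction (EuclideanSpace ℝ (Fin m)) (XX s t))
    (hf : CoeffBound C f) (hT : 0 < T) (hβ : 0 < β) (hq : q ≠ 0) (hθ : 0 < θ) (hα : θ < α)
    (hY : IsSolution T α β q X XX f y Y Y') :
    ∃ L, IsDavie T θ L f X (fun s t => areaAction (EuclideanSpace ℝ (Fin m)) (XX s t)) Y := by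
  have hC := hf.coeff.nonneg
  have hA := hR.nonneg
  -- The chaining argument is applied three times, at orders θ, 2θ and 3θ. Each application supplies
  -- the almost subadditivity for the next.
  obtain ⟨K₁, hK₁, h₁⟩ := hY.controlled.path.exists_holder hT hβ hq hθ hα
  obtain ⟨K₂, hK₂, h₂⟩ := hY.exists_norm_remainder_le hX hf hT hβ hq hθ hα hK₁ h₁
  have hN := hY.memBesov₂_sub_davieStep hβ
  set D : ℝ → ℝ → EuclideanSpace ℝ (Fin m) := fun s t => Y t -
    davieStep f X (fun s t => areaAction (EuclideanSpace ℝ (Fin m)) (XX s t)) s t (Y s) with hD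
  have htri : ∀ s u t, 0 ≤ s → s ≤ u → u ≤ t → t ≤ T → ‖D s t‖ ≤ ‖D s u‖ + ‖D u t‖ +
      ((C * K₁ ^ 2 + C * K₂) * A' + A' * (C * K₁)) * (t - s) ^ (3 * θ) := by
    intro s u t hs hsu hut ht
    exact norm_sub_davieStep_le hR hf hθ.le hK₁ hK₂ h₁ h₂ hs hsu hut ht
  obtain ⟨K₃, hK₃, h₃⟩ := exists_holder_of_logMem (θ := 3 * θ) (A := D) hT
    (by positivity) (ENNReal.div_pos hq ENNReal.ofNat_ne_top).ne' (by linarith) (by linarith)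
    (by positivity) (continuousOn_sub_davieStep hX hf hY.controlled.path.1)
    (fun s => by simp [hD, davieStep, hX.diag, areaAction]) hN.1.1 hN.2 htri
  refine ⟨K₃, fun s t hs hst ht => ?_⟩
  rw [cube_rpow (by linarith)]
  exact h₃ s t hs hst ht

end SolutionDavie

end BesovOrlicz

end

/-! ### Existence and uniqueness in Besov–Orlicz spaces -/

theorem theorem5p1 {m n : ℕ} (T α β : ℝ) (q : ℝ≥0∞) (hT : 0 < T) (hα : 1 / 3 < α)
    (hα' : α ≤ 1 / 2) (hβ : 0 < β) (hq : 0 < q)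
    (X : ℝ → EuclideanSpace ℝ (Fin n)) (XX : ℝ → ℝ → EuclideanSpace ℝ (Fin n × Fin n))
    (hX : BesovOrlicz.IsRoughPath T α β q X XX)
    (f : EuclideanSpace ℝ (Fin m) → EuclideanSpace ℝ (Fin n) →L[ℝ] EuclideanSpace ℝ (Fin m))
    (hf : BesovOrlicz.IsCb3 f) (y : EuclideanSpace ℝ (Fin m)) :
    ∃ (Y : ℝ → EuclideanSpace ℝ (Fin m))
      (Y' : ℝ → EuclideanSpace ℝ (Fin n) →L[ℝ] EuclideanSpace ℝ (Fin m)),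
      BesovOrlicz.IsSolution T α β q X XX f y Y Y' ∧
      ∀ (Z : ℝ → EuclideanSpace ℝ (Fin m))
        (Z' : ℝ → EuclideanSpace ℝ (Fin n) →L[ℝ] EuclideanSpace ℝ (Fin m)),
        BesovOrlicz.IsSolution T α β q X XX f y Z Z' →
          EqOn Z Y (Icc 0 T) ∧ EqOn Z' Y' (Icc 0 T) := by
  -- The Hölder exponent is the midpoint of 1/3 and α. Any value strictly between them would serve.
  have hθ : 1 / 3 < (1 / 3 + α) / 2 := by linarith
  have hθα : (1 / 3 + α) / 2 < α := by linarith
  obtain ⟨C, hfC⟩ := hf.coeffBound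
  obtain ⟨XX', N, A, hN, heq, hX'⟩ :=
    hX.exists_continuous_version hT hβ hq.ne' (by linarith) hθα
  obtain ⟨A', hR⟩ := hX'.exists_roughBound (EuclideanSpace ℝ (Fin m))
  obtain ⟨L, Y, hL, rfl, hY⟩ := BesovOrlicz.exists_isDavie hT hθ hR hfC hX'.path.1
    (BesovOrlicz.continuous_areaAction.comp_continuousOn hX'.cont) y
  refine ⟨Y, fun t => f (Y t), ?_, fun Z Z' hZ => ?_⟩
  -- The solution is constructed for the continuous version of the second level and then transferred
  -- to the given one. Uniqueness uses the transfer in the opposite direction.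
  · exact (hY.isSolution hX' hR hfC hT hβ hq.ne' hθ hα hα' hL).congr_area hβ hN
      fun s t h1 h2 h3 h4 h5 => (heq s t h1 h2 h3 h4 h5).symm
  · obtain ⟨L', hZ'⟩ := (hZ.congr_area hβ hN heq).exists_isDavie hX' hR hfC hT hβ hq.ne'
      (by linarith) hθα
    have h0 : Z 0 = Y 0 := by
      obtain ⟨I, hI, hZI⟩ := hZ.eq
      rw [hZI 0 ⟨le_rfl, hT.le⟩, hI.zero, add_zero]
    have hZY : EqOn Z Y (Icc 0 T) := hZ'.eqOn hT hθ hR hfC hY h0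
    exact ⟨hZY, fun t ht => by rw [hZ.deriv_eq t ht, hZY ht]⟩
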